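/- Write $\mathbf{e}(z)=e^{2\pi i z}$, $q=\mathbf{e}(\tau)$, and $\tau=u+iv$ with $v>0$. Let $\eta^3(\tau)=q^{1/8}\prod_{n\ge1}(1-q^n)^3$ and $E_2(\tau)=1-24\sum_{n\ge1}\sigma_1(n)q^n$. For $x\in\mathbb{R}$ put $g_\tau(x)=g_\tau^+(x)-g_\tau^*(x)$ with $$g^+_\tau(x)=\mathbf{e}\Bigl(-\frac{x^2}{2}\tau\Bigr)\frac{\mathrm{sgn}(x)}{i\,\eta^3(\tau)}\sum_{m\in\mathbb{Z}+\frac12,\ m>|x|}(m-|x|)\,\mathbf{e}\Bigl(\frac{m^2}{2}\tau+\frac m2\Bigr),\qquad g^*_\tau(x)=\mathbf{e}\Bigl(-\frac{x^2}{2}\tau\Bigr)\frac{\mathrm{sgn}(x)}{2}\,\mathrm{erfc}\bigl(\sqrt{2\pi v}\,|x|\bigr),$$ where $\mathrm{sgn}(0)=0$. Let $N$ be a positive even integer, let $P_N=N\mathbb{Z}$ be the even lattice with quadratic form $Q(x)=x^2/2$ and dual lattice $P_N^*=\frac1N\mathbb{Z}$, and let $\rho_N$ be its Weil representation, i.e.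 the representation of the metaplectic group $\mathrm{Mp}_2(\mathbb{Z})$ on $\mathbb{C}[P_N^*/P_N]$ with $$\rho_N(\tilde T)\mathfrak{e}_h=\mathbf{e}(h^2/2)\,\mathfrak{e}_h,\qquad \rho_N(\tilde S)\mathfrak{e}_h=\frac{\mathbf{e}(-1/8)}{N}\sum_{\delta\in P_N^*/P_N}\mathbf{e}(-\delta h)\,\mathfrak{e}_\delta,$$ where $\tilde T=\bigl(\begin{pmatrix}1&1\\0&1\end{pmatrix},1\bigr)$ and $\tilde S=\bigl(\begin{pmatrix}0&-1\\1&0\end{pmatrix},\sqrt\tau\bigr)$. For $h\in P_N^*/P_N$ let $$\boldsymbol\theta_{N,h}(\tau)=\sum_{r\in P_N+h}r\,\mathbf{e}\Bigl(\frac{r^2}{2}\tau\Bigr),\qquad \tilde{\boldsymbol\theta}_{N,h}(\tau)=\sum_{r\in P_N+h}g_\tau(r)+\begin{cases}\dfrac{\mathbf{e}(h/2)\,E_2(\tau)}{12N\,i\,\eta^3(\tau)}, & h\in(\mathbb{Z}+\frac12)/P_N,\\[2mm] 0,&\text{otherwise,}\end{cases}$$ and $\boldsymbol\theta_N=\sum_h\boldsymbol\theta_{N,h}\mathfrak{e}_h$,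 $\tilde{\boldsymbol\theta}_N=\sum_h\tilde{\boldsymbol\theta}_{N,h}\mathfrak{e}_h$. Let $\xi_k=2iv^k\,\overline{\partial/\partial\bar\tau}$ and $\Delta_k=\xi_{2-k}\circ\xi_k$. Then the series $\sum_{r\in P_N+h}g_\tau(r)$ converge absolutely, $\xi_{1/2}\tilde{\boldsymbol\theta}_N=\frac{1}{\sqrt2}\boldsymbol\theta_N$, and $\tilde{\boldsymbol\theta}_N$ is a harmonic Maass form of weight $\frac12$ and representation $\overline{\rho_N}$: it is real-analytic, satisfies $f(A\tau)=\varphi(\tau)\,\overline{\rho_N}(A,\varphi)f(\tau)$ for all $(A,\varphi)\in\mathrm{Mp}_2(\mathbb{Z})$, is annihilated by $\Delta_{1/2}$, has at most linear exponential growth at $i\infty$ (that is, it is $O(e^{Cv})$ as $v\to\infty$ for some constant $C$), and $\xi_{1/2}\tilde{\boldsymbol\theta}_N$ vanishes at $i\infty$. Moreover its components have expansions $$\tilde{\boldsymbol\theta}_{N,h}(\tau)=\sum_{n\gg-\infty}a(n,h)\,q^n-(4\pi)^{-1/2}\sum_{n>0}b(n,h)\,\Gamma\bigl(\tfrac12,4\pi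 nv\bigr)\,q^{-n}$$ over rational $n$ with bounded denominators, in which all coefficients $a(n,h)$ of the holomorphic part are rational with $12N\,a(n,h)\in\mathbb{Z}$. -/

import Mathlib

open scoped UpperHalfPlane MatrixGroups

namespace WeilMaass

/-- `𝐞(z) = exp(2πiz)`. -/
noncomputable def e (z : ℂ) : ℂ := Complex.exp (2 * Real.pi * Complex.I * z)

/-- The factor of automorphy `cτ + d`. -/
noncomputable def autFactor (A : SL(2, ℤ)) (τ : ℍ) : ℂ :=
  ((A 1 0 : ℤ) : ℂ) * (τ : ℂ) + ((A 1 1 : ℤ) : ℂ)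

theorem autFactor_ne_zero (A : SL(2, ℤ)) (τ : ℍ) : autFactor A τ ≠ 0 := by
  have := UpperHalfPlane.denom_ne_zero (A : GL (Fin 2) ℝ) τ
  simpa [autFactor, UpperHalfPlane.denom] using this

theorem coe_smul_eq (A : SL(2, ℤ)) (τ : ℍ) : ((A • τ : ℍ) : ℂ) =
    (((A 0 0 : ℤ) : ℂ) * (τ : ℂ) + ((A 0 1 : ℤ) : ℂ)) / autFactor A τ := by
  rw [UpperHalfPlane.coe_specialLinearGroup_apply]
  simp [autFactor]

theorem autFactor_mul (A B : SL(2, ℤ)) (τ : ℍ) :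
    autFactor (A * B) τ = autFactor A (B • τ) * autFactor B τ := by
  have h := autFactor_ne_zero B τ
  rw [autFactor, autFactor, coe_smul_eq]
  field_simp
  simp only [Matrix.SpecialLinearGroup.coe_mul, Matrix.mul_apply, Fin.sum_univ_two, autFactor]
  push_cast
  ring

theorem continuous_smul_SL (A : SL(2, ℤ)) : Continuous fun τ : ℍ => A • τ :=
  continuous_const_smul (Matrix.SpecialLinearGroup.mapGL ℝ A)

/-- The metaplectic group `Mp₂(ℤ)`: pairs `(A, φ)` with `A ∈ SL₂(ℤ)` and `φ` a continuous (hence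
holomorphic) function on the upper half-plane with `φ(τ)² = cτ + d`. -/
@[ext]
structure Mp2Z where
  mat : SL(2, ℤ)
  root : ℍ → ℂ
  continuous_root : Continuous root
  root_sq : ∀ τ, root τ ^ 2 = autFactor mat τ

namespace Mp2Z

theorem root_ne_zero (A : Mp2Z) (τ : ℍ) : A.root τ ≠ 0 := by
  intro h
  apply autFactor_ne_zero A.mat τ
  rw [← A.root_sq, h]
  simp

instance : One Mp2Z := ⟨⟨1, fun _ => 1, continuous_const, fun τ => by simp [autFactor]⟩⟩

/-- `(A, φ)(B, ψ) = (AB, φ(Bτ) ψ(τ))`. -/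
noncomputable instance : Mul Mp2Z := ⟨fun A B => ⟨A.mat * B.mat, fun τ => A.root (B.mat • τ) * B.root τ,
  (A.continuous_root.comp (continuous_smul_SL _)).mul B.continuous_root,
  fun τ => by rw [mul_pow, A.root_sq, B.root_sq, autFactor_mul]⟩⟩

noncomputable instance : Inv Mp2Z := ⟨fun A => ⟨A.mat⁻¹, fun τ => (A.root (A.mat⁻¹ • τ))⁻¹,
  (A.continuous_root.comp (continuous_smul_SL _)).inv₀ fun _ => A.root_ne_zero _,
  fun τ => by
    have h := autFactor_mul A.mat A.mat⁻¹ τ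
    rw [mul_inv_cancel] at h
    have h1 : autFactor 1 τ = 1 := by simp [autFactor]
    rw [inv_pow, A.root_sq]
    exact inv_eq_of_mul_eq_one_right (by rw [← h, h1])⟩⟩

@[simp] theorem mat_one : (1 : Mp2Z).mat = 1 := rfl
@[simp] theorem root_one (τ : ℍ) : (1 : Mp2Z).root τ = 1 := rfl
@[simp] theorem mat_mul (A B : Mp2Z) : (A * B).mat = A.mat * B.mat := rfl
@[simp] theorem root_mul (A B : Mp2Z) (τ : ℍ) :
    (A * B).root τ = A.root (B.mat • τ) * B.root τ := rfl
@[simp] theorem mat_inv (A : Mp2Z) : (A⁻¹).mat = A.mat⁻¹ := rfl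
@[simp] theorem root_inv (A : Mp2Z) (τ : ℍ) : (A⁻¹).root τ = (A.root (A.mat⁻¹ • τ))⁻¹ := rfl

noncomputable instance : Group Mp2Z where
  mul_assoc A B C := by
    ext1
    · simp [mul_assoc]
    · funext τ
      simp [mul_assoc, mul_smul]
  one_mul A := by
    ext1
    · simp
    · funext τ
      simp
  mul_one A := by
    ext1
    · simp
    · funext τ
      simp
  inv_mul_cancel A := by
    ext1
    · simp
    · funext τ
      simp [A.root_ne_zero]

/-- The generator `T̃ = ((1 1; 0 1), 1)`. -/
def T : Mp2Z := ⟨ModularGroup.T, fun _ => 1, continuous_const, fun τ => by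
  simp [autFactor, ModularGroup.T]⟩

/-- The generator `S̃ = ((0 -1; 1 0), √τ)`, with the principal branch of the square root. -/
noncomputable def S : Mp2Z := ⟨ModularGroup.S, fun τ => (τ : ℂ) ^ (1 / 2 : ℂ),
  UpperHalfPlane.continuous_coe.cpow continuous_const fun τ => Or.inr (by simpa using τ.im_ne_zero),
  fun τ => by
    rw [← Complex.cpow_nat_mul]
    simp [autFactor, ModularGroup.S]⟩

theorem eq_or_eq_of_mat_eq {A B : Mp2Z} (h : A.mat = B.mat) :
    A.root = B.root ∨ A.root = -B.root := by
  have hpc : IsPreconnected (Set.univ : Set ℍ) := isPreconnected_univ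
  have := hpc.eq_or_eq_neg_of_sq_eq (f := A.root) (g := B.root) A.continuous_root.continuousOn
    B.continuous_root.continuousOn (fun τ _ => by simp [A.root_sq, B.root_sq, h])
    (fun {τ} _ => B.root_ne_zero τ)
  rcases this with h | h
  · left; funext τ; exact h (Set.mem_univ τ)
  · right; funext τ; exact h (Set.mem_univ τ)

theorem closure_S_T : Subgroup.closure ({S, T} : Set Mp2Z) = ⊤ := by
  set H := Subgroup.closure ({S, T} : Set Mp2Z)
  have hS : S ∈ H := Subgroup.subset_closure (by simp)
  have hT : T ∈ H := Subgroup.subset_closure (by simp)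
  have key : ∀ B : SL(2, ℤ), ∃ A ∈ H, A.mat = B := by
    intro B
    have hB : B ∈ Subgroup.closure {ModularGroup.S, ModularGroup.T} := by
      rw [SpecialLinearGroup.SL2Z_generators]; trivial
    induction hB using Subgroup.closure_induction with
    | mem x hx =>
      rcases hx with rfl | rfl
      · exact ⟨S, hS, rfl⟩
      · exact ⟨T, hT, rfl⟩
    | one => exact ⟨1, one_mem _, rfl⟩
    | mul x y _ _ hx hy =>
      obtain ⟨a, ha, rfl⟩ := hx
      obtain ⟨b, hb, rfl⟩ := hy
      exact ⟨a * b, mul_mem ha hb, rfl⟩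
    | inv x _ hx =>
      obtain ⟨a, ha, rfl⟩ := hx
      exact ⟨a⁻¹, inv_mem ha, rfl⟩
  have hSS : (ModularGroup.S * ModularGroup.S : SL(2, ℤ)) = -1 := by
    apply Subtype.ext
    rw [Matrix.SpecialLinearGroup.coe_mul, ModularGroup.S_mul_S_eq]
    simp
  have hS4 : (S * S * (S * S)).mat = 1 := by
    change ModularGroup.S * ModularGroup.S * (ModularGroup.S * ModularGroup.S) = 1
    rw [hSS]; simp
  have hroot : ∀ τ, (S * S * (S * S)).root τ = -1 := by
    have hor := eq_or_eq_of_mat_eq (A := S * S * (S * S)) (B := 1) (by rw [hS4]; rfl)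
    -- the two values at `τ = i` differ
    have hval : (S * S * (S * S)).root UpperHalfPlane.I = -1 := by
      have hI : (S.mat • UpperHalfPlane.I : ℍ) = UpperHalfPlane.I := by
        ext
        change ((ModularGroup.S • UpperHalfPlane.I : ℍ) : ℂ) = _
        rw [coe_smul_eq]
        simp [autFactor, ModularGroup.S]
      simp only [root_mul, mat_mul, mul_smul, hI]
      have h2 := S.root_sq UpperHalfPlane.I
      have h3 : autFactor S.mat UpperHalfPlane.I = Complex.I := by
        simp [autFactor, S, ModularGroup.S]
      rw [h3] at h2
      calc _ = (S.root UpperHalfPlane.I ^ 2) ^ 2 := by ring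
        _ = -1 := by rw [h2]; simp
    rcases hor with h | h
    · exfalso
      rw [h] at hval
      simp at hval
      norm_num [Complex.ext_iff] at hval
    · intro τ
      rw [h]; simp
  rw [eq_top_iff]
  intro B _
  obtain ⟨A, hA, hAB⟩ := key B.mat
  rcases eq_or_eq_of_mat_eq hAB with h | h
  · have : A = B := Mp2Z.ext hAB h
    exact this ▸ hA
  · have : A * (S * S * (S * S)) = B := by
      apply Mp2Z.ext
      · rw [mat_mul, hS4, mul_one, hAB]
      · funext τ
        rw [root_mul, hS4, one_smul, hroot, h]
        simp
    exact this ▸ mul_mem hA (mul_mem (mul_mem hS hS) (mul_mem hS hS))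

end Mp2Z

theorem e_add (z w : ℂ) : e (z + w) = e z * e w := by
  rw [e, e, e, ← Complex.exp_add]; ring_nf

theorem e_neg (z : ℂ) : e (-z) = (e z)⁻¹ := by
  rw [e, e, ← Complex.exp_neg]; ring_nf

theorem e_ne_zero (z : ℂ) : e z ≠ 0 := Complex.exp_ne_zero _

theorem e_zero : e 0 = 1 := by simp [e]

theorem e_int (n : ℤ) : e n = 1 := by
  rw [e, Complex.exp_eq_one_iff]
  exact ⟨n, by ring⟩

theorem e_add_int (z : ℂ) (n : ℤ) : e (z + n) = e z := by
  rw [e_add, e_int, mul_one]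

theorem stdAddChar_eq_e {M : ℕ} [NeZero M] (j : ℤ) :
    ZMod.stdAddChar (j : ZMod M) = e ((j : ℂ) / M) := by
  rw [ZMod.stdAddChar_coe, e]; congr 1; ring

section Weil

variable (N : ℕ) [NeZero N]

/-- Index set of the cosets `P*/P`, where `P = Nℤ` with `Q(x) = x²/2` and `P* = N⁻¹ℤ`: the class of
`k` in `ℤ/N²` stands for the coset `k/N + Nℤ`. -/
abbrev Disc : Type := ZMod (N ^ 2)

/-- The representative `k/N` of a coset, with `0 ≤ k < N²`. -/
noncomputable def rep (h : Disc N) : ℝ := (h.val : ℝ) / N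

/-- The matrix of `ρ(T̃)`: `𝔢_h ↦ 𝐞(h²/2) 𝔢_h`. -/
noncomputable def weilT : Matrix (Disc N) (Disc N) ℂ :=
  Matrix.diagonal fun h => e ((rep N h : ℂ) ^ 2 / 2)

/-- The matrix of `ρ(S̃)`: `𝔢_h ↦ 𝐞(-1/8) |P*/P|^(-1/2) ∑_δ 𝐞(-δh) 𝔢_δ`. -/
noncomputable def weilS : Matrix (Disc N) (Disc N) ℂ :=
  Matrix.of fun δ h => e (-1 / 8) / N * e (-((rep N δ : ℂ) * (rep N h : ℂ)))

/-- `ρ(T̃)` as an invertible matrix. -/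
noncomputable def weilTUnit : GL (Disc N) ℂ where
  val := weilT N
  inv := Matrix.diagonal fun h => e (-((rep N h : ℂ) ^ 2 / 2))
  val_inv := by
    rw [weilT, Matrix.diagonal_mul_diagonal, ← Matrix.diagonal_one]
    congr 1
    funext h
    rw [← e_add, add_neg_cancel, e_zero]
  inv_val := by
    rw [weilT, Matrix.diagonal_mul_diagonal, ← Matrix.diagonal_one]
    congr 1
    funext h
    rw [← e_add, neg_add_cancel, e_zero]

theorem e_rep_mul (δ h : Disc N) :
    e ((rep N δ : ℂ) * (rep N h : ℂ)) = ZMod.stdAddChar (δ * h) := by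
  have hd : δ * h = (((δ.val * h.val : ℕ) : ℤ) : ZMod (N ^ 2)) := by
    push_cast
    simp
  rw [hd, stdAddChar_eq_e]
  congr 1
  simp only [rep]
  push_cast
  ring

theorem e_neg_rep_mul (δ h : Disc N) :
    e (-((rep N δ : ℂ) * (rep N h : ℂ))) = ZMod.stdAddChar (-(δ * h)) := by
  rw [e_neg, e_rep_mul, AddChar.map_neg_eq_inv]

/-- `ρ(S̃)` as an invertible matrix. -/
noncomputable def weilSUnit : GL (Disc N) ℂ :=
  have hmul : weilS N * Matrix.of (fun δ h => e (1 / 8) / N *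
      e ((rep N δ : ℂ) * (rep N h : ℂ))) = 1 := by
    have hN : (N : ℂ) ≠ 0 := Nat.cast_ne_zero.2 (NeZero.ne N)
    ext i j
    have h8 : e (-1 / 8) * e (1 / 8) = 1 := by
      rw [← e_add]; norm_num [e_zero]
    have hterm : ∀ k : Disc N, weilS N i k * (Matrix.of (fun δ h => e (1 / 8) / N *
        e ((rep N δ : ℂ) * (rep N h : ℂ))) : Matrix (Disc N) (Disc N) ℂ) k j
        = (1 / (N : ℂ) ^ 2) * ZMod.stdAddChar (k * (j - i)) := by
      intro k
      rw [weilS, Matrix.of_apply, Matrix.of_apply, e_neg_rep_mul, e_rep_mul]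
      have : k * (j - i) = -(i * k) + k * j := by ring
      rw [this, AddChar.map_add_eq_mul]
      calc _ = (e (-1 / 8) * e (1 / 8)) / (N : ℂ) ^ 2 *
            (ZMod.stdAddChar (-(i * k)) * ZMod.stdAddChar (k * j)) := by ring
        _ = _ := by rw [h8]
    rw [Matrix.mul_apply, Finset.sum_congr rfl fun k _ => hterm k, ← Finset.mul_sum,
      AddChar.sum_mulShift _ (ZMod.isPrimitive_stdAddChar _), Matrix.one_apply]
    by_cases hij : i = j
    · subst hij
      simp [ZMod.card, hN]
    · have : j - i ≠ 0 := sub_ne_zero.2 (Ne.symm hij)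
      simp [hij, this]
  ⟨weilS N, _, hmul, mul_eq_one_comm.1 hmul⟩

/-- Division with remainder by `N²`. -/
def discEquiv : ℤ ≃ ℤ × Disc N where
  toFun m := (m / ((N ^ 2 : ℕ) : ℤ), (m : Disc N))
  invFun p := p.1 * ((N ^ 2 : ℕ) : ℤ) + (p.2.val : ℤ)
  left_inv m := by
    simp only [ZMod.val_intCast]
    exact Int.ediv_mul_add_emod m _
  right_inv p := by
    have hpos : (0 : ℤ) < ((N ^ 2 : ℕ) : ℤ) := by exact_mod_cast NeZero.pos (N ^ 2)
    have hlt : (p.2.val : ℤ) < ((N ^ 2 : ℕ) : ℤ) := by exact_mod_cast ZMod.val_lt p.2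
    ext1
    · simp only
      rw [Int.add_comm, Int.add_mul_ediv_right _ _ hpos.ne',
        Int.ediv_eq_zero_of_lt (by positivity) hlt, zero_add]
    · simp only [Int.cast_add, Int.cast_mul, Int.cast_natCast, ZMod.natCast_self, mul_zero,
        zero_add, ZMod.natCast_zmod_val]

/-- The two-variable theta function `∑_{r ∈ P + h} 𝐞(r²τ/2 + rz)` of a coset. -/
noncomputable def jacobiTheta (τ z : ℂ) (h : Disc N) : ℂ :=
  ∑' n : ℤ, e (((N : ℂ) * n + rep N h) ^ 2 / 2 * τ + ((N : ℂ) * n + rep N h) * z)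

theorem jacobiTheta_eq (τ z : ℂ) (h : Disc N) : jacobiTheta N τ z h =
    e ((rep N h : ℂ) ^ 2 / 2 * τ + rep N h * z) *
      jacobiTheta₂ (N * (z + rep N h * τ)) ((N : ℂ) ^ 2 * τ) := by
  rw [jacobiTheta, jacobiTheta₂, ← tsum_mul_left]
  congr 1
  funext n
  rw [jacobiTheta₂_term, e, e, ← Complex.exp_add]
  congr 1
  ring

theorem jacobiTheta_T (hN : Even N) (τ z : ℂ) (h : Disc N) :
    jacobiTheta N (τ + 1) z h = e ((rep N h : ℂ) ^ 2 / 2) * jacobiTheta N τ z h := by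
  have hN0 : (N : ℂ) ≠ 0 := Nat.cast_ne_zero.2 (NeZero.ne N)
  obtain ⟨M, hM⟩ := hN
  have hMc : (N : ℂ) = M + M := by exact_mod_cast hM
  rw [jacobiTheta, jacobiTheta, ← tsum_mul_left]
  congr 1
  funext n
  have hr : (N : ℂ) * rep N h = h.val := by
    rw [rep]; push_cast; field_simp
  rw [← e_add, ← e_add_int _ (-(M * N * n ^ 2 + n * h.val))]
  congr 1
  push_cast
  rw [← hr]
  have : (N : ℂ) ^ 2 = 2 * M * N := by rw [sq]; nth_rewrite 1 [hMc]; ring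
  linear_combination (n : ℂ) ^ 2 / 2 * this

theorem jacobiTheta_S (τ z : ℂ) (hτ : 0 < τ.im) (h : Disc N) :
    jacobiTheta N (-1 / τ) (z / τ) h = τ ^ (1 / 2 : ℂ) * e (z ^ 2 / (2 * τ)) *
      ∑ j, weilS N h j * jacobiTheta N τ z j := by
  have hN0 : (N : ℂ) ≠ 0 := Nat.cast_ne_zero.2 (NeZero.ne N)
  have hτ0 : τ ≠ 0 := by rintro rfl; simp at hτ
  have hfe := jacobiTheta₂_functional_equation ((z - rep N h) / N) (τ / (N : ℂ) ^ 2)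
  have hsqrt : (-Complex.I * (τ / (N : ℂ) ^ 2)) ^ (1 / 2 : ℂ) =
      e (-1 / 8) / N * τ ^ (1 / 2 : ℂ) := by
    have hNpos : (0 : ℝ) < N := by exact_mod_cast NeZero.pos N
    have hr : (0 : ℝ) < ((N : ℝ) ^ 2)⁻¹ := by positivity
    have h1 : -Complex.I * (τ / (N : ℂ) ^ 2) = ((((N : ℝ) ^ 2)⁻¹ : ℝ) : ℂ) * (-Complex.I * τ) := by
      push_cast
      field_simp
    have hI : (-Complex.I) ≠ 0 := by simp
    have hlogI : Complex.log (-Complex.I * τ) = Complex.log (-Complex.I) + Complex.log τ := by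
      rw [Complex.log_mul_eq_add_log_iff hI hτ0, Complex.arg_neg_I]
      have ha := Complex.arg_nonneg_iff.2 hτ.le
      have hb := Complex.arg_le_pi τ
      constructor <;> linarith [Real.pi_pos]
    rw [h1, Complex.cpow_def_of_ne_zero (by simp [hτ0, hN0]), Complex.cpow_def_of_ne_zero hτ0,
      Complex.log_ofReal_mul hr (mul_ne_zero hI hτ0), hlogI, Complex.log_neg_I, add_mul,
      Complex.exp_add, add_mul, Complex.exp_add, ← mul_assoc]
    congr 1
    have hlogN : Complex.exp (((Real.log ((N : ℝ) ^ 2)⁻¹ : ℝ) : ℂ) * (1 / 2)) = 1 / N := by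
      rw [Real.log_inv, Real.log_pow]
      have : ((-(((2 : ℕ) : ℝ) * Real.log N) : ℝ) : ℂ) * (1 / 2) = ((-Real.log N : ℝ) : ℂ) := by
        push_cast
        ring
      rw [this, ← Complex.ofReal_exp, Real.exp_neg, Real.exp_log hNpos]
      simp
    rw [hlogN, e]
    have : -(Real.pi / 2 : ℂ) * Complex.I * (1 / 2) = 2 * Real.pi * Complex.I * (-1 / 8) := by ring
    rw [this]
    ring
  have hA0 : (-Complex.I * (τ / (N : ℂ) ^ 2)) ^ (1 / 2 : ℂ) ≠ 0 := by
    rw [Ne, Complex.cpow_eq_zero_iff]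
    simp [hτ0, hN0]
  have hsplit : jacobiTheta₂ ((z - rep N h) / N) (τ / (N : ℂ) ^ 2) =
      ∑ j, e (-((rep N h : ℂ) * rep N j)) * jacobiTheta N τ z j := by
    have him : 0 < (τ / (N : ℂ) ^ 2).im := by
      rw [← Nat.cast_pow, Complex.div_natCast_im]
      have : (0 : ℝ) < ((N ^ 2 : ℕ) : ℝ) := by exact_mod_cast NeZero.pos (N ^ 2)
      positivity
    have hs := (hasSum_jacobiTheta₂_term ((z - rep N h) / N) him)
    rw [← (discEquiv N).symm.hasSum_iff] at hs
    have hs' := (Equiv.prodComm (Disc N) ℤ).hasSum_iff.2 hs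
    have hsum := hs'.summable
    rw [← hs'.tsum_eq, hsum.tsum_prod, tsum_fintype]
    refine Finset.sum_congr rfl fun j _ => ?_
    rw [jacobiTheta, ← tsum_mul_left]
    congr 1
    funext n
    have hx : (N : ℂ) * rep N h = h.val := by
      rw [rep]; push_cast; field_simp
    have hj : (N : ℂ) * rep N j = j.val := by
      rw [rep]; push_cast; field_simp
    simp only [Function.comp_apply, Equiv.prodComm_apply, Prod.swap_prod_mk, discEquiv,
      Equiv.coe_fn_symm_mk, jacobiTheta₂_term]
    rw [← e_add, ← e_add_int _ (-(n * h.val)), e]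
    congr 1
    push_cast
    rw [← hx, ← hj]
    field_simp
    ring
  have harg1 : (z - rep N h) / N / (τ / (N : ℂ) ^ 2) = N * (z / τ + rep N h * (-1 / τ)) := by
    field_simp
    ring
  have harg2 : -1 / (τ / (N : ℂ) ^ 2) = (N : ℂ) ^ 2 * (-1 / τ) := by
    field_simp
  rw [harg1, harg2, hsplit] at hfe
  set A := (-Complex.I * (τ / (N : ℂ) ^ 2)) ^ (1 / 2 : ℂ)
  set J := jacobiTheta₂ (N * (z / τ + rep N h * (-1 / τ))) ((N : ℂ) ^ 2 * (-1 / τ)) with hJ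
  have hexp : Complex.exp (-Real.pi * Complex.I * ((z - rep N h) / N) ^ 2 / (τ / (N : ℂ) ^ 2)) =
      e (-((z - rep N h) ^ 2 / (2 * τ))) := by
    rw [e]
    congr 1
    field_simp
  rw [hexp] at hfe
  have hsum : ∑ j, weilS N h j * jacobiTheta N τ z j =
      e (-1 / 8) / N * ∑ j, e (-((rep N h : ℂ) * rep N j)) * jacobiTheta N τ z j := by
    rw [Finset.mul_sum]
    refine Finset.sum_congr rfl fun j _ => ?_
    rw [weilS, Matrix.of_apply, mul_assoc]
  rw [jacobiTheta_eq, ← hJ, hsum, hfe]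
  have he : e (z ^ 2 / (2 * τ)) * e (-((z - rep N h) ^ 2 / (2 * τ))) =
      e ((rep N h : ℂ) ^ 2 / 2 * (-1 / τ) + rep N h * (z / τ)) := by
    rw [← e_add]
    congr 1
    field_simp
    ring
  rw [← he]
  field_simp
  rw [hsqrt]
  field_simp

theorem jacobiTheta_linearIndependent :
    LinearIndependent ℂ fun (h : Disc N) (z : ℂ) => jacobiTheta N Complex.I z h := by
  have hN0 : (N : ℂ) ≠ 0 := Nat.cast_ne_zero.2 (NeZero.ne N)
  let f : Module.End ℂ (ℂ → ℂ) := LinearMap.funLeft ℂ ℂ fun z => z + 1 / N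
  refine Module.End.eigenvectors_linearIndependent' f
    (fun h : Disc N => (ZMod.stdAddChar h : ℂ)) (ZMod.injective_stdAddChar) _ fun h => ⟨?_, ?_⟩
  · rw [Module.End.mem_eigenspace_iff]
    funext z
    simp only [f, LinearMap.funLeft_apply, Pi.smul_apply, smul_eq_mul, jacobiTheta]
    rw [← tsum_mul_left]
    congr 1
    funext n
    have hh : h = (((h.val : ℕ) : ℤ) : ZMod (N ^ 2)) := by simp
    have hs : (ZMod.stdAddChar h : ℂ) = e ((h.val : ℂ) / (N : ℂ) ^ 2) := by
      conv_lhs => rw [hh, stdAddChar_eq_e]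
      push_cast
      rfl
    rw [hs, ← e_add, ← e_add_int _ (-n)]
    congr 1
    simp only [rep]
    push_cast
    field_simp
    ring
  · intro h0
    have h1 := congrFun h0 (-(rep N h * Complex.I))
    simp only [Pi.zero_apply] at h1
    rw [jacobiTheta_eq, mul_eq_zero] at h1
    rcases h1 with h1 | h1
    · exact e_ne_zero _ h1
    · have hz : (N : ℂ) * (-(rep N h * Complex.I) + rep N h * Complex.I) = 0 := by ring
      rw [hz] at h1
      have him : 0 < ((N : ℂ) ^ 2 * Complex.I).im := by
        have : 0 < (N : ℝ) ^ 2 := by have := NeZero.pos N; positivity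
        have h2 : ((N : ℂ) ^ 2 * Complex.I).im = (N : ℝ) ^ 2 := by
          rw [← Nat.cast_pow, ← Nat.cast_pow, ← Complex.ofReal_natCast, Complex.im_ofReal_mul]; simp
        rw [h2]; exact this
      have hs := hasSum_jacobiTheta₂_term 0 him
      rw [h1] at hs
      have hs2 := Complex.hasSum_re hs
      have hpos : ∀ n : ℤ, (jacobiTheta₂_term n 0 ((N : ℂ) ^ 2 * Complex.I)).re
          = Real.exp (-(Real.pi * n ^ 2 * N ^ 2)) := by
        intro n
        rw [jacobiTheta₂_term]
        have : 2 * (Real.pi : ℂ) * Complex.I * n * 0 +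
            Real.pi * Complex.I * n ^ 2 * ((N : ℂ) ^ 2 * Complex.I)
            = ((-(Real.pi * n ^ 2 * N ^ 2) : ℝ) : ℂ) := by
          push_cast
          linear_combination (Real.pi * n ^ 2 * (N : ℂ) ^ 2) * Complex.I_sq
        rw [this, Complex.exp_ofReal_re]
      simp only [hpos] at hs2
      have h3 := hs2.summable.tsum_pos (fun n => (Real.exp_pos _).le) 0 (Real.exp_pos _)
      rw [hs2.tsum_eq] at h3
      simp at h3

/-- The pairs `(A, M)` with `ϑ(Aτ, z/(cτ+d)) = φ(τ) 𝐞(cz²/(2(cτ+d))) M ϑ(τ, z)`. -/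
def thetaLaw : Subgroup (Mp2Z × GL (Disc N) ℂ) where
  carrier := {g | ∀ (τ : ℍ) (z : ℂ),
    jacobiTheta N ((g.1.mat • τ : ℍ) : ℂ) (z / autFactor g.1.mat τ) =
      (g.1.root τ * e (((g.1.mat 1 0 : ℤ) : ℂ) * z ^ 2 / (2 * autFactor g.1.mat τ))) •
        (g.2 : Matrix (Disc N) (Disc N) ℂ).mulVec (jacobiTheta N τ z)}
  one_mem' := by
    intro τ z
    simp [autFactor, e_zero]
  mul_mem' := by
    intro g g' hg hg' τ z
    have h0 := autFactor_ne_zero g'.1.mat τ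
    have h0' := autFactor_ne_zero g.1.mat (g'.1.mat • τ)
    have h1 := hg (g'.1.mat • τ) (z / autFactor g'.1.mat τ)
    rw [hg' τ z, ← mul_smul, div_div, mul_comm (autFactor g'.1.mat τ), ← autFactor_mul] at h1
    simp only [Prod.fst_mul, Prod.snd_mul, Mp2Z.mat_mul, Mp2Z.root_mul, Units.val_mul]
    rw [h1, Matrix.mulVec_smul, Matrix.mulVec_mulVec, smul_smul]
    congr 1
    have he : ((((g.1.mat * g'.1.mat) 1 0 : ℤ) : ℂ)) * z ^ 2 /
        (2 * autFactor (g.1.mat * g'.1.mat) τ) =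
        ((g.1.mat 1 0 : ℤ) : ℂ) * (z / autFactor g'.1.mat τ) ^ 2 /
          (2 * autFactor g.1.mat (g'.1.mat • τ)) +
        ((g'.1.mat 1 0 : ℤ) : ℂ) * z ^ 2 / (2 * autFactor g'.1.mat τ) := by
      have hdet := g'.1.mat.det_coe
      rw [Matrix.det_fin_two] at hdet
      have hdet' : ((g'.1.mat 0 0 : ℤ) : ℂ) * ((g'.1.mat 1 1 : ℤ) : ℂ) -
          ((g'.1.mat 0 1 : ℤ) : ℂ) * ((g'.1.mat 1 0 : ℤ) : ℂ) = 1 := by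
        exact_mod_cast hdet
      have key : ((((g.1.mat * g'.1.mat) 1 0 : ℤ) : ℂ)) * autFactor g'.1.mat τ =
          ((g.1.mat 1 0 : ℤ) : ℂ) +
            ((g'.1.mat 1 0 : ℤ) : ℂ) * autFactor (g.1.mat * g'.1.mat) τ := by
        simp only [Matrix.SpecialLinearGroup.coe_mul, Matrix.mul_apply, Fin.sum_univ_two,
          autFactor]
        push_cast
        linear_combination ((g.1.mat 1 0 : ℤ) : ℂ) * hdet'
      rw [autFactor_mul] at key ⊢
      field_simp
      linear_combination z ^ 2 * key
    rw [he, e_add]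
    ring
  inv_mem' := by
    intro g hg τ z
    have h0 := autFactor_ne_zero g.1.mat⁻¹ τ
    have hj : autFactor g.1.mat (g.1.mat⁻¹ • τ) * autFactor g.1.mat⁻¹ τ = 1 := by
      rw [← autFactor_mul, mul_inv_cancel]
      simp [autFactor]
    have hj' : autFactor g.1.mat (g.1.mat⁻¹ • τ) = (autFactor g.1.mat⁻¹ τ)⁻¹ :=
      eq_inv_of_mul_eq_one_left hj
    have h1 := hg (g.1.mat⁻¹ • τ) (z / autFactor g.1.mat⁻¹ τ)
    rw [hj', smul_inv_smul] at h1
    have hz : z / autFactor g.1.mat⁻¹ τ / (autFactor g.1.mat⁻¹ τ)⁻¹ = z := by field_simp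
    have hc : (((g.1.mat⁻¹) 1 0 : ℤ) : ℂ) = -((g.1.mat 1 0 : ℤ) : ℂ) := by
      rw [Matrix.SpecialLinearGroup.SL2_inv_expl]
      simp
    rw [hz] at h1
    simp only [Prod.fst_inv, Prod.snd_inv, Mp2Z.mat_inv, Mp2Z.root_inv]
    rw [h1, Matrix.mulVec_smul, Matrix.mulVec_mulVec, smul_smul, ← Units.val_mul,
      inv_mul_cancel, Units.val_one, Matrix.one_mulVec]
    have hr := g.1.root_ne_zero (g.1.mat⁻¹ • τ)
    have he : ((g.1.mat 1 0 : ℤ) : ℂ) * (z / autFactor g.1.mat⁻¹ τ) ^ 2 /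
        (2 * (autFactor g.1.mat⁻¹ τ)⁻¹) =
        -((((g.1.mat⁻¹) 1 0 : ℤ) : ℂ) * z ^ 2 / (2 * autFactor g.1.mat⁻¹ τ)) := by
      rw [hc]
      field_simp
    rw [he, e_neg]
    have h2 := e_ne_zero ((((g.1.mat⁻¹) 1 0 : ℤ) : ℂ) * z ^ 2 / (2 * autFactor g.1.mat⁻¹ τ))
    have h3 : ∀ a b : ℂ, a ≠ 0 → b ≠ 0 → (a⁻¹ * b) * (a * b⁻¹) = 1 := by
      intro a b ha hb
      field_simp
    rw [h3 _ _ hr h2, one_smul]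

theorem weilT_mem (hN : Even N) : (Mp2Z.T, weilTUnit N) ∈ thetaLaw N := by
  intro τ z
  have hmat : Mp2Z.T.mat = ModularGroup.T := rfl
  have hr : Mp2Z.T.root τ = 1 := rfl
  have hsm : ((ModularGroup.T • τ : ℍ) : ℂ) = τ + 1 := by
    rw [coe_smul_eq]
    simp [autFactor, ModularGroup.T]
  have ha : autFactor ModularGroup.T τ = 1 := by simp [autFactor, ModularGroup.T]
  have hc : (ModularGroup.T 1 0 : ℤ) = 0 := by simp [ModularGroup.T]
  simp only [hmat, hr, hsm, ha, hc]
  funext h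
  simp only [div_one, Int.cast_zero, zero_mul, zero_div, e_zero, one_smul, weilTUnit, weilT,
    mul_one, Matrix.mulVec_diagonal]
  exact jacobiTheta_T N hN τ z h

theorem weilS_mem : (Mp2Z.S, weilSUnit N) ∈ thetaLaw N := by
  intro τ z
  have hmat : Mp2Z.S.mat = ModularGroup.S := rfl
  have hr : Mp2Z.S.root τ = (τ : ℂ) ^ (1 / 2 : ℂ) := rfl
  have hsm : ((ModularGroup.S • τ : ℍ) : ℂ) = -1 / τ := by
    rw [coe_smul_eq]
    simp [autFactor, ModularGroup.S]
  have ha : autFactor ModularGroup.S τ = τ := by simp [autFactor, ModularGroup.S]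
  have hc : (ModularGroup.S 1 0 : ℤ) = 1 := by simp [ModularGroup.S]
  simp only [hmat, hr, hsm, ha, hc]
  funext h
  rw [jacobiTheta_S N τ z τ.im_pos h]
  simp [weilSUnit, Matrix.mulVec, dotProduct]

/-- The subgroup of `Mp₂(ℤ) × GL(ℂ[P*/P])` generated by `(T̃, ρ(T̃))` and `(S̃, ρ(S̃))`. -/
noncomputable def weilGraph : Subgroup (Mp2Z × GL (Disc N) ℂ) :=
  Subgroup.closure {(Mp2Z.S, weilSUnit N), (Mp2Z.T, weilTUnit N)}

theorem weilGraph_bijective (hN : Even N) :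
    Function.Bijective ((MonoidHom.fst Mp2Z (GL (Disc N) ℂ)).comp (weilGraph N).subtype) := by
  constructor
  · rw [injective_iff_map_eq_one]
    rintro ⟨⟨A, M⟩, hg⟩ hA
    simp only [MonoidHom.coe_comp, Function.comp_apply, Subgroup.subtype_apply,
      MonoidHom.coe_fst] at hA
    subst hA
    have hle : weilGraph N ≤ thetaLaw N := by
      rw [weilGraph, Subgroup.closure_le]
      rintro x (rfl | rfl)
      · exact weilS_mem N
      · exact weilT_mem N hN
    have hlaw := hle hg UpperHalfPlane.I
    have hM : M = 1 := by
      apply Units.ext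
      ext i j
      have hli := Fintype.linearIndependent_iff.1 (jacobiTheta_linearIndependent N)
        (fun j => (M : Matrix (Disc N) (Disc N) ℂ) i j - (1 : Matrix (Disc N) (Disc N) ℂ) i j) (by
          funext z
          have h1 := congrFun (hlaw z) i
          simp [autFactor, e_zero, Matrix.mulVec, dotProduct] at h1
          simp [sub_mul, Finset.sum_sub_distrib, Matrix.one_apply, ← h1]) j
      simpa [sub_eq_zero] using hli
    subst hM
    rfl
  · rw [← MonoidHom.range_eq_top, eq_top_iff, ← Mp2Z.closure_S_T, Subgroup.closure_le]
    rintro x (rfl | rfl)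
    · exact ⟨⟨(Mp2Z.S, weilSUnit N), Subgroup.subset_closure (by simp)⟩, rfl⟩
    · exact ⟨⟨(Mp2Z.T, weilTUnit N), Subgroup.subset_closure (by simp)⟩, rfl⟩

/-- The Weil representation `ρ_N` of `Mp₂(ℤ)` on `ℂ[P*/P]` attached to the even lattice `P = Nℤ`,
`Q(x) = x²/2`: the homomorphism with `T̃ ↦ ρ(T̃)` and `S̃ ↦ ρ(S̃)`. -/
noncomputable def weilRep (hN : Even N) : Mp2Z →* GL (Disc N) ℂ :=
  ((MonoidHom.snd Mp2Z (GL (Disc N) ℂ)).comp (weilGraph N).subtype).comp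
    (MulEquiv.ofBijective _ (weilGraph_bijective N hN)).symm.toMonoidHom

theorem weilRep_eq (hN : Even N) {A : Mp2Z} {M : GL (Disc N) ℂ} (h : (A, M) ∈ weilGraph N) :
    weilRep N hN A = M := by
  have : (MulEquiv.ofBijective _ (weilGraph_bijective N hN)).symm A = ⟨(A, M), h⟩ := by
    rw [MulEquiv.symm_apply_eq]
    rfl
  simp only [weilRep, MonoidHom.comp_apply, MulEquiv.coe_toMonoidHom, this]
  rfl

theorem weilRep_T (hN : Even N) :
    (weilRep N hN Mp2Z.T : Matrix (Disc N) (Disc N) ℂ) = weilT N := by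
  rw [weilRep_eq N hN (Subgroup.subset_closure (by simp) : (Mp2Z.T, weilTUnit N) ∈ weilGraph N)]
  rfl

theorem weilRep_S (hN : Even N) :
    (weilRep N hN Mp2Z.S : Matrix (Disc N) (Disc N) ℂ) = weilS N := by
  rw [weilRep_eq N hN (Subgroup.subset_closure (by simp) : (Mp2Z.S, weilSUnit N) ∈ weilGraph N)]
  rfl

end Weil

section HarmonicMaass

/-- `∂F/∂τ̄ = (∂F/∂u + i ∂F/∂v)/2` for a function on the upper half-plane, `τ = u + iv`. -/
noncomputable def dbar (F : ℍ → ℂ) (τ : ℍ) : ℂ :=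
  (fderiv ℝ (F ∘ UpperHalfPlane.ofComplex) τ 1 +
    Complex.I * fderiv ℝ (F ∘ UpperHalfPlane.ofComplex) τ Complex.I) / 2

/-- `ξ_k F = 2 i v^k conj(∂F/∂τ̄)`. -/
noncomputable def xi (k : ℝ) (F : ℍ → ℂ) (τ : ℍ) : ℂ :=
  2 * Complex.I * ((τ.im ^ k : ℝ) : ℂ) * (starRingEnd ℂ) (dbar F τ)

/-- `Δ_k = ξ_{2-k} ∘ ξ_k`. -/
noncomputable def laplacian (k : ℝ) (F : ℍ → ℂ) : ℍ → ℂ := xi (2 - k) (xi k F)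

/-- `F` is real-analytic on the upper half-plane. -/
def IsRealAnalytic (F : ℍ → ℂ) : Prop :=
  AnalyticOnNhd ℝ (F ∘ UpperHalfPlane.ofComplex) {z : ℂ | 0 < z.im}

variable {ι : Type*} [Fintype ι] [DecidableEq ι]

/-- The complex conjugate of a matrix representation. -/
noncomputable def conjRep (ρ : Mp2Z →* GL ι ℂ) : Mp2Z →* GL ι ℂ :=
  (Matrix.GeneralLinearGroup.map (starRingEnd ℂ)).comp ρ

/-- Harmonic Maass forms of weight `κ/2` and representation `ρ` on `Mp₂(ℤ)`, whose only cusp is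
`i∞`. -/
structure IsHarmonicMaassForm (κ : ℤ) (ρ : Mp2Z →* GL ι ℂ) (f : ℍ → ι → ℂ) : Prop where
  realAnalytic : ∀ j, IsRealAnalytic fun τ => f τ j
  /-- `f(Aτ) = φ(τ)^κ ρ(A, φ) f(τ)` -/
  modular : ∀ (A : Mp2Z) (τ : ℍ), f (A.mat • τ) =
    (A.root τ ^ κ) • (ρ A : Matrix ι ι ℂ).mulVec (f τ)
  harmonic : ∀ j τ, laplacian ((κ : ℝ) / 2) (fun τ => f τ j) τ = 0
  /-- at most linear exponential growth at the cusp -/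
  growth : ∃ C : ℝ, ∀ j, (fun τ => f τ j) =O[UpperHalfPlane.atImInfty]
    fun τ => Real.exp (C * τ.im)
  /-- `ξ_k f` vanishes at the cusp -/
  xi_cusp : ∀ j, UpperHalfPlane.IsZeroAtImInfty (xi ((κ : ℝ) / 2) fun τ => f τ j)

/-- The upper incomplete Gamma function `Γ(s, x) = ∫_x^∞ t^(s-1) e^(-t) dt`. -/
noncomputable def upperGamma (s x : ℝ) : ℝ :=
  ∫ t in Set.Ioi x, t ^ (s - 1) * Real.exp (-t)

/-- `f = f⁺ - f^*` with holomorphic part `f⁺ = ∑_{n ≫ -∞} a(n, j) q^n` and non-holomorphic part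
`f^* = (4π)^(k-1) ∑_{n > 0} b(n, j) Γ(1-k, 4πnv) q^(-n)`, the exponents `n` being rational with
bounded denominators. -/
structure HasHarmonicExpansion (k : ℝ) (f : ℍ → ι → ℂ) (a b : ι → ℚ → ℂ) : Prop where
  exponents : ∃ D : ℕ, 0 < D ∧ ∀ j n, (a j n ≠ 0 ∨ b j n ≠ 0) → ∃ m : ℤ, n = m / D
  bddBelow : ∃ n₀ : ℚ, ∀ j n, a j n ≠ 0 → n₀ ≤ n
  pos : ∀ j n, b j n ≠ 0 → 0 < n
  summable_holo : ∀ j (τ : ℍ), Summable fun n : ℚ => a j n * e (n * τ)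
  summable_nonholo : ∀ j (τ : ℍ), Summable fun n : ℚ =>
    b j n * (upperGamma (1 - k) (4 * Real.pi * n * τ.im) : ℂ) * e (-n * τ)
  eq : ∀ j (τ : ℍ), f τ j = (∑' n : ℚ, a j n * e (n * τ)) -
    (((4 * Real.pi) ^ (k - 1) : ℝ) : ℂ) * ∑' n : ℚ,
      b j n * (upperGamma (1 - k) (4 * Real.pi * n * τ.im) : ℂ) * e (-n * τ)

end HarmonicMaass

section Theta

/-- The complementary error function. -/
noncomputable def erfc (x : ℝ) : ℝ :=
  2 / Real.sqrt Real.pi * ∫ t in Set.Ioi x, Real.exp (-t ^ 2)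

/-- `η(τ)³`. -/
noncomputable def etaCubed (τ : ℍ) : ℂ := ModularForm.eta τ ^ 3

open Classical in
/-- `g_τ^+(x)`, with the summation over half-integers `m = n + 1/2 > |x|`. -/
noncomputable def gPlus (τ : ℍ) (x : ℝ) : ℂ :=
  e (-((x : ℂ) ^ 2 / 2 * τ)) * ((Real.sign x : ℂ) / (Complex.I * etaCubed τ)) *
    ∑' n : ℤ, if |x| < (n : ℝ) + 1 / 2 then
      (((n : ℝ) + 1 / 2 - |x| : ℝ) : ℂ) *
        e (((n : ℂ) + 1 / 2) ^ 2 / 2 * τ + ((n : ℂ) + 1 / 2) / 2)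
    else 0

/-- `g_τ^*(x)`. -/
noncomputable def gStar (τ : ℍ) (x : ℝ) : ℂ :=
  e (-((x : ℂ) ^ 2 / 2 * τ)) * ((Real.sign x : ℂ) / 2) *
    (erfc (Real.sqrt (2 * Real.pi * τ.im) * |x|) : ℂ)

/-- `g_τ(x) = g_τ^+(x) - g_τ^*(x)`. -/
noncomputable def g (τ : ℍ) (x : ℝ) : ℂ := gPlus τ x - gStar τ x

/-- The coset of `h` lies in `(ℤ + 1/2)/Nℤ`. -/
def IsHalfIntegral (N : ℕ) (h : Disc N) : Prop := ∃ m : ℤ, rep N h = m + 1 / 2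

/-- The unary theta series `𝛉_{N,h}(τ) = ∑_{r ∈ Nℤ + h} r 𝐞(r²τ/2)` of weight `3/2`. -/
noncomputable def unaryTheta (N : ℕ) (τ : ℍ) (h : Disc N) : ℂ :=
  ∑' n : ℤ, ((N : ℂ) * n + rep N h) * e (((N : ℂ) * n + rep N h) ^ 2 / 2 * τ)

open Classical in
/-- The function `θ̃_{N,h}(τ)`: the sum of `g_τ` over the coset `Nℤ + h`, plus
`𝐞(h/2) E₂(τ) / (12 N i η³(τ))` on half-integral cosets. -/
noncomputable def thetaTilde (N : ℕ) (τ : ℍ) (h : Disc N) : ℂ :=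
  (if IsHalfIntegral N h then
    e ((rep N h : ℂ) / 2) * EisensteinSeries.E2 τ / (12 * N * Complex.I * etaCubed τ) else 0) +
  ∑' n : ℤ, g τ ((N : ℝ) * n + rep N h)

end Theta

end WeilMaass

namespace WeilMaass

/-! The function `g τ` is odd, continuous and integrable, and up to the factor i/(-iτ)^{1/2} its
Fourier transform is g at -1/τ (`fourier_g`). To see this, strip off the Gaussian 𝐞(-x²τ/2). What
remains is sgn(x)W(|x|), whose Fourier–Laplace transform at z can be computed term by term
(`integral_profile`): with w = 2πiz it is ϑ(z)/(iη³w²) - exp(-πz²/2v)/w, where ϑ is the odd Jacobi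
theta function. The inversion formula for ϑ (`oddTheta_S`) relates the transforms at τ and at -1/τ,
and uniqueness of the Fourier transform gives the claim. Jacobi's identity for η³ (`thetaConst_eq`)
enters here: it makes W(0) = 0, so that g is continuous at the origin, and it cancels the simple
poles in w. The identity itself holds because the quotient of the two sides is a modular form of
weight 0 and level one.

Modularity under S then comes from Poisson summation over a coset of Nℤ, with one anomaly. Just to
the left of a positive half-integer m, at m - ε, the series of g⁺ contains a term of size about
ε·exp(-2πvmε). Each such term vanishes as ε → 0, but their sum over a half-integral coset is a
geometric series which tends to a nonzero limit proportional to 1/(Nτ) (`tsum_g_S` via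
`tendsto_tsum_g_left`). Hence the periodization is not continuous, and Poisson summation has to be
used with its left limit (`poisson_left`), obtained by averaging over a short interval. The defect
is exactly compensated by the failure of E₂ to be modular, which is why the E₂/η³ term is added on
half-integral cosets (`thetaTilde_S`). The behaviour under T is read off from the exponents, and S
and T generate the metaplectic group (`thetaTilde_modular`).

For the analytic statements, split the function into `thetaPlus` and `thetaStar`. The first is an
absolutely convergent series in powers of q with exponents at least -1/8, hence holomorphic with
growth at most O(e^{πv/4}). The second is an inner product in ℓ²(ℤ) of a vector holomorphic in τ
with a vector holomorphic in v (`hasSum_gStar`). This gives real-analyticity at once and allows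
∂/∂τ̄ to be computed by the product rule; the erfc contributions cancel and a multiple of the
conjugate of the weight 3/2 theta series is left (`dbar_tsum_gStar`). Since that theta series is
holomorphic and decays at the cusp, harmonicity and the cusp condition follow.

Integrality: Jacobi's identity shows that q^{1/8}/η³ is the inverse of an integral power series with
constant term 1, so it is integral (`exists_hasSum_inv_etaCubed`). The weights m - |r| lie in N⁻¹ℤ
because N is even, and the E₂ term has denominator 12N since 𝐞(h/2)/i = ±1 on half-integral cosets
(`exists_mul_holoCoeff_eq`). -/

theorem norm_e (z : ℂ) : ‖e z‖ = Real.exp (-2 * Real.pi * z.im) := by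
  rw [e, Complex.norm_exp]
  congr 1
  simp

theorem norm_e_ofReal (x : ℝ) : ‖e x‖ = 1 := by simp [norm_e]

theorem norm_e_mul (x : ℝ) (z : ℂ) : ‖e (x * z)‖ = Real.exp (-2 * Real.pi * x * z.im) := by
  rw [norm_e, Complex.im_ofReal_mul]; ring_nf

theorem hasDerivAt_e (z : ℂ) : HasDerivAt e (2 * Real.pi * Complex.I * e z) z := by
  have := ((hasDerivAt_id z).const_mul (2 * Real.pi * Complex.I)).cexp
  rw [mul_comm]
  simpa only [e, id, mul_one] using! this

theorem differentiable_e : Differentiable ℂ e := fun z => (hasDerivAt_e z).differentiableAt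

theorem continuous_e : Continuous e := differentiable_e.continuous

theorem e_conj (z : ℂ) : (starRingEnd ℂ) (e z) = e (-(starRingEnd ℂ) z) := by
  rw [e, e, ← Complex.exp_conj]
  congr 1
  simp [Complex.conj_ofNat]

theorem e_nat_mul (n : ℕ) (z : ℂ) : e (n * z) = e z ^ n := by
  rw [e, e, ← Complex.exp_nat_mul]; ring_nf

theorem e_half : e (1 / 2) = -1 := by
  rw [e, ← Complex.exp_pi_mul_I]; ring_nf

theorem e_quarter : e (1 / 4) = Complex.I := by
  rw [e, show (2 * Real.pi * Complex.I * (1 / 4) : ℂ) = Real.pi / 2 * Complex.I by ring,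
    Complex.exp_pi_div_two_mul_I]

/-! ### Generalized exponential series -/

section ExpSeries

variable {ι : Type*} {c : ι → ℂ} {ν : ι → ℝ} {ν₀ : ℝ}

/-- Every term that is present decays at least like exp(-2πν₀v), so convergence on one horizontal
line controls the series everywhere above that line. -/
theorem norm_mul_e_le_of_le (hν : ∀ i, c i ≠ 0 → ν₀ ≤ ν i) {v₁ : ℝ} {z : ℂ} (hz : v₁ ≤ z.im)
    (i : ι) : ‖c i * e (ν i * z)‖ ≤
      ‖c i * e (ν i * (v₁ * Complex.I))‖ * Real.exp (-2 * Real.pi * ν₀ * (z.im - v₁)) := by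
  by_cases hc : c i = 0
  · simp [hc]
  rw [norm_mul, norm_mul, mul_assoc]
  refine mul_le_mul_of_nonneg_left ?_ (norm_nonneg _)
  rw [norm_e_mul, norm_e_mul, ← Real.exp_add]
  apply Real.exp_le_exp.2
  have := mul_nonneg (mul_nonneg Real.pi_pos.le (sub_nonneg.2 (hν i hc))) (sub_nonneg.2 hz)
  simp
  nlinarith

theorem differentiableOn_tsum_mul_e (hν : ∀ i, c i ≠ 0 → ν₀ ≤ ν i)
    (hs : ∀ τ : ℍ, Summable fun i => c i * e (ν i * τ)) :
    DifferentiableOn ℂ (fun z => ∑' i, c i * e (ν i * z)) {z : ℂ | 0 < z.im} := by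
  intro z hz
  have hz' : 0 < z.im := hz
  set v₁ := z.im / 2
  have hv₁ : 0 < v₁ := by positivity
  set M := Real.exp (2 * Real.pi * |ν₀| * (z.im + 1))
  have hopen : IsOpen {w : ℂ | v₁ < w.im ∧ w.im < z.im + 1} :=
    (isOpen_lt continuous_const Complex.continuous_im).inter
      (isOpen_lt Complex.continuous_im continuous_const)
  have hsum := ((hs ⟨v₁ * Complex.I, by simpa using hv₁⟩).norm.mul_right M)
  have hd := Complex.differentiableOn_tsum_of_summable_norm (F := fun i w => c i * e (ν i * w))
    hsum (fun i => ((differentiable_e.comp (differentiable_id.const_mul _)).const_mul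
      _).differentiableOn) hopen (by
        rintro i w ⟨hw, hw2⟩
        refine (norm_mul_e_le_of_le hν hw.le i).trans ?_
        refine mul_le_mul_of_nonneg_left (Real.exp_le_exp.2 ?_) (norm_nonneg _)
        have h1 : -ν₀ * (w.im - v₁) ≤ |ν₀| * (z.im + 1) :=
          mul_le_mul (neg_le_abs _) (by linarith) (by linarith) (abs_nonneg _)
        nlinarith [Real.pi_pos])
  exact (hd.differentiableAt (hopen.mem_nhds ⟨by simp [v₁]; linarith,
    by linarith⟩)).differentiableWithinAt

theorem exists_norm_tsum_mul_e_le (hν : ∀ i, c i ≠ 0 → ν₀ ≤ ν i)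
    (hs : ∀ τ : ℍ, Summable fun i => c i * e (ν i * τ)) :
    ∃ C, ∀ τ : ℍ, 1 ≤ τ.im →
      ‖∑' i, c i * e (ν i * τ)‖ ≤ C * Real.exp (-2 * Real.pi * ν₀ * τ.im) := by
  have h1 := (hs ⟨(1 : ℝ) * Complex.I, by simp⟩).norm
  refine ⟨(∑' i, ‖c i * e (ν i * ((1 : ℝ) * Complex.I))‖) * Real.exp (2 * Real.pi * ν₀),
    fun τ hτ => ?_⟩
  rw [mul_assoc, ← Real.exp_add, ← tsum_mul_right]
  have hle := fun i => norm_mul_e_le_of_le (z := τ) hν hτ i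
  have hR : 2 * Real.pi * ν₀ + -2 * Real.pi * ν₀ * τ.im =
      -2 * Real.pi * ν₀ * ((τ : ℂ).im - 1) := by simp; ring
  rw [hR]
  have hsm := h1.mul_right (Real.exp (-2 * Real.pi * ν₀ * ((τ : ℂ).im - 1)))
  exact tsum_of_norm_bounded hsm.hasSum hle

end ExpSeries

/-! ### Summability over half-integers -/

/-- Half of the Gaussian absorbs the linear exponent: completing the square costs the constant
exp(S²/(2πT)), and a Gaussian of parameter T/2 remains. -/
theorem summable_int_abs_pow_mul_exp (k : ℕ) {T : ℝ} (hT : 0 < T) (S : ℝ) :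
    Summable fun n : ℤ => |(n : ℝ) + 1 / 2| ^ k *
      Real.exp (-Real.pi * T * ((n : ℝ) + 1 / 2) ^ 2 + S * |(n : ℝ) + 1 / 2|) := by
  have h1 := HurwitzKernelBounds.summable_f_int k (1 / 2) (t := T / 2) (by positivity)
  refine Summable.of_nonneg_of_le (fun n => by positivity) (fun n => ?_)
    (h1.mul_right (Real.exp (S ^ 2 / (2 * Real.pi * T))))
  rw [HurwitzKernelBounds.f_int, mul_assoc (_ ^ k), ← Real.exp_add]
  refine mul_le_mul_of_nonneg_left (Real.exp_le_exp.2 ?_) (by positivity)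
  set x := |(n : ℝ) + 1 / 2|
  have hx : ((n : ℝ) + 1 / 2) ^ 2 = x ^ 2 := (sq_abs _).symm
  rw [hx]
  have hp := Real.pi_pos
  have : S ^ 2 / (2 * Real.pi * T) - (-Real.pi * T * x ^ 2 + S * x - -Real.pi * x ^ 2 * (T / 2)) =
      (S - Real.pi * T * x) ^ 2 / (2 * Real.pi * T) := by field_simp; ring
  have h2 : 0 ≤ (S - Real.pi * T * x) ^ 2 / (2 * Real.pi * T) := by positivity
  linarith

/-! ### The odd Jacobi theta function and its derivative at the origin -/

/-- `𝐞(m²τ/2 + m/2)` for `m = n + 1/2`. -/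
noncomputable def thetaCoeff (τ : ℂ) (n : ℤ) : ℂ :=
  e (((n : ℂ) + 1 / 2) ^ 2 / 2 * τ + ((n : ℂ) + 1 / 2) / 2)

theorem norm_thetaCoeff (τ : ℂ) (n : ℤ) :
    ‖thetaCoeff τ n‖ = Real.exp (-Real.pi * τ.im * ((n : ℝ) + 1 / 2) ^ 2) := by
  rw [thetaCoeff, e_add, norm_mul]
  have h1 : (((n : ℂ) + 1 / 2) ^ 2 / 2) = ((((n : ℝ) + 1 / 2) ^ 2 / 2 : ℝ) : ℂ) := by push_cast; ring
  have h2 : (((n : ℂ) + 1 / 2) / 2) = ((((n : ℝ) + 1 / 2) / 2 : ℝ) : ℂ) := by push_cast; ring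
  rw [h1, h2, norm_e_mul, norm_e_ofReal, mul_one]
  ring_nf

/-- The odd Jacobi theta function `∑_{m ∈ ℤ + 1/2} 𝐞(m²τ/2 + m/2 + mz)`. -/
noncomputable def oddTheta (τ z : ℂ) : ℂ := ∑' n : ℤ, thetaCoeff τ n * e (((n : ℂ) + 1 / 2) * z)

theorem thetaCoeff_mul_e (τ z : ℂ) (n : ℤ) : thetaCoeff τ n * e (((n : ℂ) + 1 / 2) * z) =
    e (τ / 8 + 1 / 4 + z / 2) * jacobiTheta₂_term n (z + 1 / 2 + τ / 2) τ := by
  rw [jacobiTheta₂_term, thetaCoeff, ← e_add, e, e, ← Complex.exp_add]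
  congr 1; ring

theorem oddTheta_eq (τ z : ℂ) : oddTheta τ z =
    e (τ / 8 + 1 / 4 + z / 2) * jacobiTheta₂ (z + 1 / 2 + τ / 2) τ := by
  rw [oddTheta, jacobiTheta₂, ← tsum_mul_left]
  exact tsum_congr fun n => thetaCoeff_mul_e τ z n

theorem summable_oddTheta {τ : ℂ} (hτ : 0 < τ.im) (z : ℂ) :
    Summable fun n : ℤ => thetaCoeff τ n * e (((n : ℂ) + 1 / 2) * z) := by
  simp only [thetaCoeff_mul_e]
  exact ((summable_jacobiTheta₂_term_iff _ _).2 hτ).mul_left _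

/-- The theta constant `∑_{m ∈ ℤ + 1/2} m 𝐞(m²τ/2 + m/2)`. -/
noncomputable def thetaConst (τ : ℂ) : ℂ := ∑' n : ℤ, ((n : ℂ) + 1 / 2) * thetaCoeff τ n

theorem summable_thetaConst {τ : ℂ} (hτ : 0 < τ.im) :
    Summable fun n : ℤ => ((n : ℂ) + 1 / 2) * thetaCoeff τ n := by
  apply Summable.of_norm
  have := summable_int_abs_pow_mul_exp 1 hτ 0
  refine this.congr fun n => ?_
  rw [norm_mul, norm_thetaCoeff]
  congr 1
  · rw [pow_one, ← Real.norm_eq_abs, ← Complex.norm_real]; push_cast; rfl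
  · ring_nf

/-- Termwise differentiation is inherited from `jacobiTheta₂`; the prefactor 𝐞(z/2) contributes the
1/2 that turns the index n into m = n + 1/2. -/
theorem hasDerivAt_oddTheta_zero {τ : ℂ} (hτ : 0 < τ.im) :
    HasDerivAt (oddTheta τ) (2 * Real.pi * Complex.I * thetaConst τ) 0 := by
  have h1 : HasDerivAt (fun z : ℂ => e (τ / 8 + 1 / 4 + z / 2))
      (2 * Real.pi * Complex.I * e (τ / 8 + 1 / 4 + 0 / 2) * (1 / 2)) 0 := by
    refine (hasDerivAt_e _).comp (0 : ℂ) ?_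
    exact ((hasDerivAt_id (0 : ℂ)).div_const 2).const_add _
  have h2 : HasDerivAt (fun z : ℂ => jacobiTheta₂ (z + 1 / 2 + τ / 2) τ)
      (jacobiTheta₂' (0 + 1 / 2 + τ / 2) τ * 1) 0 := by
    refine HasDerivAt.comp (0 : ℂ) (h₂ := (jacobiTheta₂ · τ)) (h := fun z : ℂ => z + 1 / 2 + τ / 2)
      (hasDerivAt_jacobiTheta₂_fst (0 + 1 / 2 + τ / 2) hτ) ?_
    exact ((hasDerivAt_id (0 : ℂ)).add_const _).add_const _
  have h3 := h1.mul h2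
  have h4 : (fun z : ℂ => e (τ / 8 + 1 / 4 + z / 2)) *
      (fun z : ℂ => jacobiTheta₂ (z + 1 / 2 + τ / 2) τ) = oddTheta τ := by
    funext z
    rw [oddTheta_eq]; rfl
  rw [h4] at h3
  convert! h3 using 1
  have hs1 := ((summable_jacobiTheta₂_term_iff (0 + 1 / 2 + τ / 2) τ).2 hτ)
  have hs2 := ((summable_jacobiTheta₂'_term_iff (0 + 1 / 2 + τ / 2) τ).2 hτ)
  rw [thetaConst, jacobiTheta₂, jacobiTheta₂', mul_one, ← tsum_mul_left, ← tsum_mul_left,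
    ← tsum_mul_left, ← (hs1.mul_left _).tsum_add (hs2.mul_left _)]
  refine tsum_congr fun n => ?_
  have := thetaCoeff_mul_e τ 0 n
  rw [mul_zero, e_zero, mul_one] at this
  rw [this, jacobiTheta₂'_term]
  ring

/-- No branch jump occurs: arg(-i) = -π/2 and arg τ lies in [0, π], so the principal logarithms add.
-/
theorem neg_I_mul_cpow_half {τ : ℂ} (hτ : 0 < τ.im) :
    (-Complex.I * τ) ^ (1 / 2 : ℂ) = e (-1 / 8) * τ ^ (1 / 2 : ℂ) := by
  have hτ0 : τ ≠ 0 := by rintro rfl; simp at hτ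
  have hI : (-Complex.I) ≠ 0 := by simp
  have hlogI : Complex.log (-Complex.I * τ) = Complex.log (-Complex.I) + Complex.log τ := by
    rw [Complex.log_mul_eq_add_log_iff hI hτ0, Complex.arg_neg_I]
    have ha := Complex.arg_nonneg_iff.2 hτ.le
    have hb := Complex.arg_le_pi τ
    constructor <;> linarith [Real.pi_pos]
  rw [Complex.cpow_def_of_ne_zero (by simp [hτ0]), Complex.cpow_def_of_ne_zero hτ0,
    hlogI, Complex.log_neg_I, add_mul, Complex.exp_add, e]
  congr 2
  ring

theorem cpow_half_sq (z : ℂ) : (z ^ (1 / 2 : ℂ)) ^ 2 = z := by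
  rw [← Complex.cpow_nat_mul]; simp

theorem neg_I_mul_cpow_half_ne_zero {τ : ℂ} (hτ : 0 < τ.im) :
    (-Complex.I * τ) ^ (1 / 2 : ℂ) ≠ 0 := by
  intro h
  have := cpow_half_sq (-Complex.I * τ)
  rw [h] at this
  have hτ0 : τ ≠ 0 := by rintro rfl; simp at hτ
  simp [hτ0] at this

/-- In terms of `jacobiTheta₂` the argument is shifted by the half-period 1/2 + τ/2. Dividing the
shift by τ gives the half-period for -1/τ up to one full period, so the functional equation is
combined with one quasi-periodicity step. -/
theorem oddTheta_S {τ : ℂ} (hτ : 0 < τ.im) (z : ℂ) : oddTheta (-1 / τ) (z / τ) =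
    -Complex.I * (-Complex.I * τ) ^ (1 / 2 : ℂ) * e (z ^ 2 / (2 * τ)) * oddTheta τ z := by
  have hτ0 : τ ≠ 0 := by rintro rfl; simp at hτ
  have hA := neg_I_mul_cpow_half_ne_zero hτ
  have h1 := jacobiTheta₂_functional_equation (z + 1 / 2 + τ / 2) τ
  have h2 := jacobiTheta₂_add_left' ((z + 1 / 2 + τ / 2) / τ) (-1 / τ)
  have h3 : (z + 1 / 2 + τ / 2) / τ + -1 / τ = z / τ + 1 / 2 + -1 / τ / 2 := by
    field_simp; ring
  rw [h3] at h2
  rw [oddTheta_eq, oddTheta_eq, h1, h2]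
  set J := jacobiTheta₂ ((z + 1 / 2 + τ / 2) / τ) (-1 / τ)
  set A := (-Complex.I * τ) ^ (1 / 2 : ℂ)
  have h4 : e (-1 / τ / 8 + 1 / 4 + z / τ / 2) *
      Complex.exp (-Real.pi * Complex.I * (-1 / τ + 2 * ((z + 1 / 2 + τ / 2) / τ))) =
      e (-1 / 4) * e (z ^ 2 / (2 * τ)) * e (τ / 8 + 1 / 4 + z / 2) *
        Complex.exp (-Real.pi * Complex.I * (z + 1 / 2 + τ / 2) ^ 2 / τ) := by
    simp only [e, ← Complex.exp_add]
    congr 1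
    field_simp
    ring
  have h5 : e (-1 / 4) = -Complex.I := by
    rw [neg_div, e_neg, e_quarter]; simp
  rw [← mul_assoc, h4, h5]
  field_simp

/-- This is the derivative of `oddTheta_S` at z = 0. The Gaussian factor contributes nothing, as ϑ
vanishes at 0. -/
theorem thetaConst_S {τ : ℂ} (hτ : 0 < τ.im) : thetaConst (-1 / τ) =
    -Complex.I * τ * (-Complex.I * τ) ^ (1 / 2 : ℂ) * thetaConst τ := by
  have hτ0 : τ ≠ 0 := by rintro rfl; simp at hτ
  have hτ' : 0 < (-1 / τ).im := by
    have := UpperHalfPlane.im_inv_neg_coe_pos ⟨τ, hτ⟩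
    rw [neg_div, one_div, ← inv_neg]; exact this
  have h1 : HasDerivAt (fun z => oddTheta (-1 / τ) (z / τ))
      (2 * Real.pi * Complex.I * thetaConst (-1 / τ) * (1 / τ)) 0 := by
    have hd := hasDerivAt_oddTheta_zero hτ'
    rw [← zero_div τ] at hd
    exact hd.comp (0 : ℂ) ((hasDerivAt_id (0 : ℂ)).div_const τ)
  have h0 : oddTheta τ 0 = 0 := by
    have hneg : oddTheta τ 0 = -oddTheta τ 0 := by
      rw [oddTheta, ← tsum_neg, ← ((Equiv.neg ℤ).trans (Equiv.subRight 1)).tsum_eq]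
      refine tsum_congr fun n => ?_
      simp only [mul_zero, e_zero, mul_one, Equiv.trans_apply, Equiv.neg_apply,
        Equiv.subRight_apply, thetaCoeff]
      push_cast
      rw [← neg_one_mul (e _), ← e_half, ← e_add, ← e_add_int (1 / 2 + _) (-n - 1)]
      congr 1
      push_cast
      ring
    exact self_eq_neg.1 hneg
  have h2 : HasDerivAt (fun z => -Complex.I * (-Complex.I * τ) ^ (1 / 2 : ℂ) *
      e (z ^ 2 / (2 * τ)) * oddTheta τ z)
      (-Complex.I * (-Complex.I * τ) ^ (1 / 2 : ℂ) *
        (2 * Real.pi * Complex.I * thetaConst τ)) 0 := by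
    have he : HasDerivAt (fun z : ℂ => -Complex.I * (-Complex.I * τ) ^ (1 / 2 : ℂ) *
        e (z ^ 2 / (2 * τ))) (-Complex.I * (-Complex.I * τ) ^ (1 / 2 : ℂ) *
          (2 * Real.pi * Complex.I * e (0 ^ 2 / (2 * τ)) * ((2 : ℕ) * 0 ^ (2 - 1) * 1 / (2 * τ)))) 0 := by
      refine HasDerivAt.const_mul _ ((hasDerivAt_e _).comp (0 : ℂ) ?_)
      exact ((hasDerivAt_id (0 : ℂ)).pow 2).div_const _
    have := he.mul (hasDerivAt_oddTheta_zero hτ)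
    convert! this using 1
    simp [h0, e_zero]
  have h3 := h1.unique (by
    convert! h2 using 1
    funext z
    exact oddTheta_S hτ z)
  have hpi : (2 * Real.pi * Complex.I : ℂ) ≠ 0 := Complex.two_pi_I_ne_zero
  apply mul_left_cancel₀ hpi
  apply mul_right_cancel₀ (one_div_ne_zero hτ0)
  rw [h3]
  field_simp

/-- With m = n + 1/2, m²/2 = 1/8 + n(n+1)/2, and n(n+1)/2 is an integer. -/
theorem thetaConst_T (τ : ℂ) : thetaConst (τ + 1) = e (1 / 8) * thetaConst τ := by
  rw [thetaConst, thetaConst, ← tsum_mul_left]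
  refine tsum_congr fun n => ?_
  obtain ⟨k, hk⟩ := Int.even_mul_succ_self n
  have hk' : (n : ℂ) * (n + 1) = k + k := by exact_mod_cast hk
  rw [mul_left_comm, thetaCoeff, thetaCoeff, ← e_add, ← e_add_int (1 / 8 + _) k]
  congr 2
  linear_combination (1 / 2) * hk'

/-! ### Jacobi's identity: the theta constant is iη³ -/

open Filter Topology UpperHalfPlane in
theorem tendsto_tprod_one_sub_eta_q :
    Tendsto (fun τ : ℍ => ∏' n : ℕ, (1 - ModularForm.eta_q n τ)) atImInfty (𝓝 1) := by
  have htprod : Tendsto (fun q : ℂ => ∏' n : ℕ, (1 - q ^ (n + 1))) (𝓝 0) (𝓝 1) := by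
    have := tendsto_tprod_one_add_of_dominated_convergence (𝓕 := 𝓝 0) (g := 0)
      (f := fun (q : ℂ) (n : ℕ) => -q ^ (n + 1)) (bound := fun n => (1 / 2 : ℝ) ^ (n + 1))
    simp only [Pi.zero_apply, norm_neg, norm_pow, add_zero, tprod_one] at this
    simp_rw [sub_eq_add_neg]
    refine this
      (by simpa only [pow_succ'] using (summable_geometric_of_abs_lt_one (by norm_num)).mul_left _)
      (fun k => by simpa using ((continuous_pow (M := ℂ) (k + 1)).tendsto 0).neg) ?_
    filter_upwards [Metric.ball_mem_nhds (0 : ℂ) (by norm_num : (0 : ℝ) < 1 / 2)] with q hq k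
    exact pow_le_pow_left₀ (norm_nonneg _) (mem_ball_zero_iff.mp hq).le _
  exact htprod.comp (qParam_tendsto_atImInfty zero_lt_one)

theorem etaCubed_eq (τ : ℍ) : etaCubed τ =
    e (τ / 8) * (∏' n : ℕ, (1 - ModularForm.eta_q n τ)) ^ 3 := by
  rw [etaCubed, ModularForm.eta, mul_pow]
  congr 1
  rw [Function.Periodic.qParam, ← Complex.exp_nat_mul, e]
  congr 1
  push_cast
  ring

theorem etaCubed_ne_zero (τ : ℍ) : etaCubed τ ≠ 0 :=
  pow_ne_zero _ (ModularForm.eta_ne_zero τ.2)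

theorem etaCubed_T (τ : ℍ) : etaCubed (ModularGroup.T • τ) = e (1 / 8) * etaCubed τ := by
  have hsm : ((ModularGroup.T • τ : ℍ) : ℂ) = τ + 1 := by
    rw [coe_smul_eq]
    simp [autFactor, ModularGroup.T]
  rw [etaCubed_eq, etaCubed_eq, hsm, ← mul_assoc, ← e_add]
  congr 1
  · congr 1; ring
  · congr 2
    funext n
    rw [ModularForm.eta_q_eq_cexp, ModularForm.eta_q_eq_cexp]
    congr 1
    have h := Complex.exp_int_mul_two_pi_mul_I (n + 1)
    push_cast at h
    rw [mul_add, Complex.exp_add, mul_one, show (2 * Real.pi * Complex.I * (n + 1) : ℂ) =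
      (n + 1) * (2 * Real.pi * Complex.I) by ring, h, mul_one]

theorem coe_S_smul (τ : ℍ) : ((ModularGroup.S • τ : ℍ) : ℂ) = -1 / τ := by
  rw [coe_smul_eq]
  simp [autFactor, ModularGroup.S]

theorem etaCubed_S (τ : ℍ) : etaCubed (ModularGroup.S • τ) =
    -Complex.I * τ * (-Complex.I * τ) ^ (1 / 2 : ℂ) * etaCubed τ := by
  have h1 := ModularForm.eta_comp_eq_csqrt_I_inv τ.2
  simp only [Function.comp_apply, Pi.smul_apply, Pi.mul_apply, smul_eq_mul] at h1
  have h2 : (Complex.sqrt Complex.I)⁻¹ * Complex.sqrt τ = (-Complex.I * τ) ^ (1 / 2 : ℂ) := by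
    have hI := neg_I_mul_cpow_half (τ := Complex.I) (by simp)
    have h3 : (-Complex.I * Complex.I) = 1 := by simp
    rw [h3, Complex.one_cpow] at hI
    have h0 : Complex.I ^ (1 / 2 : ℂ) ≠ 0 := by
      intro h; rw [h, mul_zero] at hI; exact one_ne_zero hI
    rw [neg_I_mul_cpow_half τ.2, Complex.sqrt, Complex.sqrt, ← one_div 2]
    congr 1
    exact inv_eq_of_mul_eq_one_left hI.symm
  rw [etaCubed, coe_S_smul, h1, ← mul_assoc, h2, mul_pow, ← etaCubed]
  congr 1
  rw [pow_succ, cpow_half_sq]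

theorem thetaConst_eq_sum (τ : ℂ) : thetaConst τ =
    ∑' n : ℤ, (((n : ℂ) + 1 / 2) * e (((n : ℂ) + 1 / 2) / 2)) *
      e (((((n : ℝ) + 1 / 2) ^ 2 / 2 : ℝ) : ℂ) * τ) := by
  rw [thetaConst]
  refine tsum_congr fun n => ?_
  rw [thetaCoeff, e_add]
  push_cast
  ring

theorem int_add_half_sq_ge (n : ℤ) : (1 : ℝ) / 8 ≤ ((n : ℝ) + 1 / 2) ^ 2 / 2 := by
  have h : (0 : ℤ) ≤ n * (n + 1) := by
    rcases le_or_gt 0 n with h | h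
    · positivity
    · nlinarith
  have : (0 : ℝ) ≤ n * (n + 1) := by exact_mod_cast h
  nlinarith

theorem int_add_half_sq_ge' (n : ℤ) (h0 : n ≠ 0) (h1 : n ≠ -1) :
    (9 : ℝ) / 8 ≤ ((n : ℝ) + 1 / 2) ^ 2 / 2 := by
  have h : (2 : ℤ) ≤ n * (n + 1) := by
    rcases lt_or_gt_of_ne h0 with h | h
    · have : n ≤ -2 := by omega
      nlinarith
    · nlinarith
  have : (2 : ℝ) ≤ n * (n + 1) := by exact_mod_cast h
  nlinarith

theorem summable_thetaConst' (τ : ℍ) : Summable fun n : ℤ =>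
    (((n : ℂ) + 1 / 2) * e (((n : ℂ) + 1 / 2) / 2)) *
      e (((((n : ℝ) + 1 / 2) ^ 2 / 2 : ℝ) : ℂ) * τ) := by
  refine (summable_thetaConst τ.2).congr fun n => ?_
  rw [thetaCoeff, e_add]
  push_cast
  ring

theorem differentiableOn_thetaConst : DifferentiableOn ℂ thetaConst {z : ℂ | 0 < z.im} := by
  have : thetaConst = fun τ => _ := funext thetaConst_eq_sum
  rw [this]
  exact differentiableOn_tsum_mul_e (ν₀ := 1 / 8) (fun n _ => int_add_half_sq_ge n)
    summable_thetaConst'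

-- The indices n = 0 and n = -1, that is m = ±1/2, together give i·q^{1/8}; every other term has
-- exponent at least 9/8, so the remainder is O(q) after division by q^{1/8}.
open Filter Topology UpperHalfPlane in
theorem tendsto_thetaConst_mul : Tendsto (fun τ : ℍ => thetaConst τ * e (-(τ / 8))) atImInfty
    (𝓝 Complex.I) := by
  classical
  set d : ℤ → ℂ := fun n => if n = 0 ∨ n = -1 then 0 else
    ((n : ℂ) + 1 / 2) * e (((n : ℂ) + 1 / 2) / 2) with hd
  have hs : ∀ τ : ℍ, Summable fun n : ℤ => d n * e (((((n : ℝ) + 1 / 2) ^ 2 / 2 : ℝ) : ℂ) * τ) := by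
    intro τ
    refine Summable.of_norm_bounded (summable_thetaConst' τ).norm fun n => ?_
    rw [norm_mul, norm_mul]
    refine mul_le_mul_of_nonneg_right ?_ (norm_nonneg _)
    simp only [hd]
    split_ifs with h
    · rw [norm_zero]; exact norm_nonneg _
    · exact le_rfl
  obtain ⟨C, hC⟩ := exists_norm_tsum_mul_e_le (ν₀ := 9 / 8) (c := d) (fun n hn => by
    simp only [hd] at hn
    split_ifs at hn with h
    · exact absurd rfl hn
    · push Not at h
      exact int_add_half_sq_ge' n h.1 h.2) hs
  have hmain : ∀ τ : ℍ, thetaConst τ * e (-(τ / 8)) =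
      Complex.I + (∑' n : ℤ, d n * e (((((n : ℝ) + 1 / 2) ^ 2 / 2 : ℝ) : ℂ) * τ)) *
        e (-(τ / 8)) := by
    intro τ
    have h1 := (summable_thetaConst' τ).hasSum
    have h2 := hasSum_sum_of_ne_finset_zero (L := SummationFilter.unconditional ℤ) (s := ({0, -1} : Finset ℤ)) (f := fun n : ℤ =>
      ((((n : ℂ) + 1 / 2) * e (((n : ℂ) + 1 / 2) / 2)) - d n) *
        e (((((n : ℝ) + 1 / 2) ^ 2 / 2 : ℝ) : ℂ) * τ)) (fun n hn => by
          simp only [Finset.mem_insert, Finset.mem_singleton] at hn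
          simp [hd, hn])
    have h3 := (h2.add (hs τ).hasSum).tsum_eq
    have h4 : thetaConst τ = ∑' n : ℤ, (((((n : ℂ) + 1 / 2) * e (((n : ℂ) + 1 / 2) / 2)) - d n) *
        e (((((n : ℝ) + 1 / 2) ^ 2 / 2 : ℝ) : ℂ) * τ) +
          d n * e (((((n : ℝ) + 1 / 2) ^ 2 / 2 : ℝ) : ℂ) * τ)) := by
      rw [thetaConst_eq_sum]
      exact tsum_congr fun n => by ring
    rw [h4, h3, add_mul]
    congr 1
    rw [Finset.sum_pair (by norm_num)]
    have e1 : e ((((0 : ℤ) : ℂ) + 1 / 2) / 2) = Complex.I := by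
      rw [← e_quarter]; congr 1; norm_num
    have e2 : e ((((-1 : ℤ) : ℂ) + 1 / 2) / 2) = -Complex.I := by
      rw [show (((-1 : ℤ) : ℂ) + 1 / 2) / 2 = -(1 / 4) by norm_num, e_neg, e_quarter]; simp
    have e3 : e (((((((0 : ℤ) : ℝ) + 1 / 2) ^ 2 / 2 : ℝ) : ℂ)) * τ) * e (-(τ / 8)) = 1 := by
      rw [← e_add, ← e_zero]; congr 1; push_cast; ring
    have e4 : e (((((((-1 : ℤ) : ℝ) + 1 / 2) ^ 2 / 2 : ℝ) : ℂ)) * τ) * e (-(τ / 8)) = 1 := by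
      rw [← e_add, ← e_zero]; congr 1; push_cast; ring
    have hd0 : d 0 = 0 := by simp [hd]
    have hd1 : d (-1) = 0 := by simp [hd]
    rw [add_mul, mul_assoc, mul_assoc, e3, e4, hd0, hd1, e1, e2]
    push_cast
    ring
  have hlim : Tendsto (fun τ : ℍ => (∑' n : ℤ, d n * e (((((n : ℝ) + 1 / 2) ^ 2 / 2 : ℝ) : ℂ) * τ))
      * e (-(τ / 8))) atImInfty (𝓝 0) := by
    rw [tendsto_zero_iff_norm_tendsto_zero]
    have hx : Tendsto (fun τ : ℍ => C * Real.exp (-(2 * Real.pi * τ.im))) atImInfty (𝓝 (C * 0)) := by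
      refine Tendsto.const_mul _ (Real.tendsto_exp_neg_atTop_nhds_zero.comp ?_)
      exact tendsto_comap.const_mul_atTop (by positivity)
    rw [mul_zero] at hx
    refine squeeze_zero' (Eventually.of_forall fun _ => norm_nonneg _) ?_ hx
    have : ∀ᶠ τ : ℍ in atImInfty, 1 ≤ τ.im := tendsto_comap.eventually (eventually_ge_atTop 1)
    filter_upwards [this] with τ hτ
    rw [norm_mul, norm_e]
    calc _ ≤ (C * Real.exp (-2 * Real.pi * (9 / 8) * τ.im)) *
          Real.exp (-2 * Real.pi * (-((τ : ℂ) / 8)).im) :=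
          mul_le_mul_of_nonneg_right (hC τ hτ) (Real.exp_pos _).le
      _ = _ := by
        rw [mul_assoc, ← Real.exp_add]
        congr 2
        have : (-((τ : ℂ) / 8)).im = -(τ.im / 8) := by
          rw [Complex.neg_im, show (8 : ℂ) = ((8 : ℝ) : ℂ) by norm_num, Complex.div_ofReal_im]; rfl
        rw [this]; ring
  have := (tendsto_const_nhds (x := Complex.I)).add hlim
  rw [add_zero] at this
  exact this.congr fun τ => (hmain τ).symm

open Filter Topology UpperHalfPlane in
theorem tendsto_thetaConst_div_etaCubed :
    Tendsto (fun τ : ℍ => thetaConst τ / etaCubed τ) atImInfty (𝓝 Complex.I) := by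
  have h := tendsto_thetaConst_mul.div (tendsto_tprod_one_sub_eta_q.pow 3) (by simp)
  rw [one_pow, div_one] at h
  refine h.congr fun τ => ?_
  rw [etaCubed_eq, Pi.div_apply, e_neg, div_mul_eq_div_div, div_eq_mul_inv (thetaConst _)]

theorem differentiableOn_etaCubed :
    DifferentiableOn ℂ (fun z => ModularForm.eta z ^ 3) {z : ℂ | 0 < z.im} := fun _ hz =>
  ((ModularForm.differentiableAt_eta_of_mem_upperHalfPlaneSet hz).pow 3).differentiableWithinAt

-- Numerator and denominator acquire the same multiplier under S and under T, and these generate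
-- SL₂(ℤ).
open UpperHalfPlane in
theorem slash_thetaConst_div_etaCubed (γ : SL(2, ℤ)) :
    SlashAction.map (0 : ℤ) γ (fun τ : ℍ => thetaConst τ / etaCubed τ) =
      fun τ : ℍ => thetaConst τ / etaCubed τ := by
  refine SlashInvariantForm.slash_action_generators_SL2Z ?_ ?_ γ
  · funext τ
    rw [ModularForm.SL_slash_apply, etaCubed_S, coe_S_smul, thetaConst_S τ.2, neg_zero, zpow_zero,
      mul_one]
    have h1 := neg_I_mul_cpow_half_ne_zero τ.2
    have h2 := UpperHalfPlane.ne_zero τ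
    have h3 := etaCubed_ne_zero τ
    refine mul_div_mul_left _ _ (mul_ne_zero (mul_ne_zero ?_ h2) h1)
    simp
  · funext τ
    have hsm : ((ModularGroup.T • τ : ℍ) : ℂ) = τ + 1 := by
      rw [coe_smul_eq]
      simp [autFactor, ModularGroup.T]
    rw [ModularForm.SL_slash_apply, etaCubed_T, hsm, thetaConst_T, neg_zero, zpow_zero, mul_one]
    exact mul_div_mul_left _ _ (e_ne_zero _)

open UpperHalfPlane in
/-- `θ/η³` as a modular form of weight `0` and level one. -/
noncomputable def thetaConstDivEtaCubed : ModularForm 𝒮ℒ 0 where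
  toFun τ := thetaConst τ / etaCubed τ
  slash_action_eq' := fun _ ⟨γ, hγ⟩ => hγ ▸ slash_thetaConst_div_etaCubed γ
  holo' := by
    rw [UpperHalfPlane.mdifferentiable_iff]
    refine (differentiableOn_thetaConst.div differentiableOn_etaCubed
      fun z hz => pow_ne_zero _ (ModularForm.eta_ne_zero hz)).congr fun z hz => ?_
    simp [ofComplex_apply_of_im_pos hz, etaCubed]
  bdd_at_cusps' {c} hc := by
    rw [Subgroup.IsArithmetic.isCusp_iff_isCusp_SL2Z] at hc
    rw [OnePoint.isBoundedAt_iff_forall_SL2Z hc]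
    intro γ _
    rw [slash_thetaConst_div_etaCubed γ, IsBoundedAtImInfty, Filter.BoundedAtFilter]
    exact tendsto_thetaConst_div_etaCubed.isBigO_one ℝ

/-- Jacobi's identity for `η³`. -/
theorem thetaConst_eq (τ : ℍ) : thetaConst τ = Complex.I * etaCubed τ := by
  -- A level one form of weight 0 is constant, and its limit at the cusp identifies the constant as
  -- i.
  obtain ⟨c, hc⟩ := ModularFormClass.levelOne_weight_zero_const thetaConstDivEtaCubed
  have hc' : ∀ τ : ℍ, thetaConst τ / etaCubed τ = c := fun τ => congrFun hc τ
  have : c = Complex.I := by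
    have h := tendsto_thetaConst_div_etaCubed
    simp only [hc'] at h
    exact tendsto_nhds_unique tendsto_const_nhds h
  rw [← this, ← hc' τ, div_mul_cancel₀ _ (etaCubed_ne_zero τ)]

/-! ### The complementary error function -/

section Erfc

open MeasureTheory Filter Topology Set

theorem integrable_exp_neg_sq : Integrable fun t : ℝ => Real.exp (-t ^ 2) := by
  simpa using integrable_exp_neg_mul_sq (b := 1) one_pos

theorem hasDerivAt_erfc (x : ℝ) :
    HasDerivAt erfc (-(2 / Real.sqrt Real.pi * Real.exp (-x ^ 2))) x := by
  have hcont : Continuous fun t : ℝ => Real.exp (-t ^ 2) := by fun_prop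
  have h1 : erfc = fun x => 2 / Real.sqrt Real.pi *
      ((∫ t in Ioi (0 : ℝ), Real.exp (-t ^ 2)) - ∫ t in (0 : ℝ)..x, Real.exp (-t ^ 2)) := by
    funext y
    have := intervalIntegral.integral_interval_add_Ioi' (f := fun t : ℝ => Real.exp (-t ^ 2))
      (μ := volume) (a := 0) (b := y) (hcont.intervalIntegrable _ _)
      integrable_exp_neg_sq.integrableOn
    rw [← this, add_sub_cancel_left, erfc]
  rw [h1, neg_mul_eq_mul_neg]
  refine HasDerivAt.const_mul _ (HasDerivAt.const_sub _ ?_)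
  exact intervalIntegral.integral_hasDerivAt_right (hcont.intervalIntegrable _ _)
    hcont.stronglyMeasurable.stronglyMeasurableAtFilter hcont.continuousAt

theorem continuous_erfc : Continuous erfc :=
  continuous_iff_continuousAt.2 fun x => (hasDerivAt_erfc x).continuousAt

theorem erfc_zero : erfc 0 = 1 := by
  have := integral_gaussian_Ioi 1
  simp only [neg_mul, one_mul, div_one] at this
  rw [erfc, this]
  have : Real.sqrt Real.pi ≠ 0 := by positivity
  field_simp

theorem erfc_nonneg (x : ℝ) : 0 ≤ erfc x := by
  rw [erfc]
  have : 0 ≤ ∫ t in Ioi x, Real.exp (-t ^ 2) := integral_nonneg fun t => (Real.exp_pos _).le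
  positivity

/-- Translate the integral to the origin and use (t + x)² ≥ t² + x² for t, x ≥ 0; the remaining
integral is the one in `erfc_zero`. -/
theorem erfc_le {x : ℝ} (hx : 0 ≤ x) : erfc x ≤ Real.exp (-x ^ 2) := by
  have h1 : ∫ t in Ioi x, Real.exp (-t ^ 2) ≤
      Real.exp (-x ^ 2) * ∫ t in Ioi (0 : ℝ), Real.exp (-t ^ 2) := by
    have h2 := (measurePreserving_add_right volume x).setIntegral_preimage_emb
      (measurableEmbedding_addRight x) (fun t : ℝ => Real.exp (-t ^ 2)) (Ioi x)
    rw [preimage_add_const_Ioi, sub_self] at h2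
    rw [← h2, ← integral_const_mul]
    refine setIntegral_mono_on ?_ ?_ measurableSet_Ioi fun t ht => ?_
    · exact (integrable_exp_neg_sq.comp_add_right x).integrableOn
    · exact (integrable_exp_neg_sq.const_mul _).integrableOn
    · rw [← Real.exp_add]
      apply Real.exp_le_exp.2
      have : 0 ≤ t * x := mul_nonneg (le_of_lt ht) hx
      nlinarith
  have h0 := erfc_zero
  rw [erfc] at h0 ⊢
  have hc : 0 ≤ 2 / Real.sqrt Real.pi := by positivity
  calc _ ≤ 2 / Real.sqrt Real.pi *
        (Real.exp (-x ^ 2) * ∫ t in Ioi (0 : ℝ), Real.exp (-t ^ 2)) :=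
        mul_le_mul_of_nonneg_left h1 hc
    _ = Real.exp (-x ^ 2) *
        (2 / Real.sqrt Real.pi * ∫ t in Ioi (0 : ℝ), Real.exp (-t ^ 2)) := by ring
    _ = _ := by rw [h0, mul_one]

theorem tendsto_erfc : Tendsto erfc atTop (𝓝 0) := by
  have h : Tendsto (fun x : ℝ => Real.exp (-x ^ 2)) atTop (𝓝 0) :=
    Real.tendsto_exp_neg_atTop_nhds_zero.comp (tendsto_pow_atTop two_ne_zero)
  exact squeeze_zero' (Eventually.of_forall erfc_nonneg)
    ((eventually_ge_atTop 0).mono fun x hx => erfc_le hx) h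

/-- `Γ(1/2, x) = √π erfc(√x)`. -/
theorem upperGamma_half {x : ℝ} (hx : 0 < x) :
    upperGamma (1 - 1 / 2) x = Real.sqrt Real.pi * erfc (Real.sqrt x) := by
  have hd : ∀ t ∈ Ici x, HasDerivAt (fun t => -(Real.sqrt Real.pi * erfc (Real.sqrt t)))
      (t ^ ((1 - 1 / 2 : ℝ) - 1) * Real.exp (-t)) t := by
    intro t ht
    have ht0 : 0 < t := lt_of_lt_of_le hx ht
    have h1 := (((hasDerivAt_erfc (Real.sqrt t)).comp t
      (Real.hasDerivAt_sqrt ht0.ne')).const_mul (Real.sqrt Real.pi)).neg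
    convert! h1 using 1
    have h2 : t ^ ((1 - 1 / 2 : ℝ) - 1) = (Real.sqrt t)⁻¹ := by
      rw [Real.sqrt_eq_rpow, ← Real.rpow_neg ht0.le]; norm_num
    have h3 : Real.sqrt Real.pi ≠ 0 := by positivity
    have h4 : Real.sqrt t ≠ 0 := by positivity
    rw [h2, Real.sq_sqrt ht0.le]
    field_simp
  have ht : Tendsto (fun t => -(Real.sqrt Real.pi * erfc (Real.sqrt t))) atTop (𝓝 0) := by
    have := ((tendsto_erfc.comp Real.tendsto_sqrt_atTop).const_mul (Real.sqrt Real.pi)).neg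
    simpa using this
  have hnn := integrableOn_Ioi_deriv_of_nonneg' hd (fun t ht => by
    have ht0 : 0 < t := lt_trans hx ht
    positivity) ht
  have := integral_Ioi_of_hasDerivAt_of_tendsto' hd hnn ht
  rw [upperGamma, this]
  ring

end Erfc

/-! ### Integrals of odd functions against exponentials -/

section OddFunctions

open MeasureTheory Filter Topology Set

theorem integrable_comp_abs_of_integrableOn_Ioi {f : ℝ → ℝ} (hf : IntegrableOn f (Ioi 0)) :
    Integrable fun x => f |x| := by
  rw [← integrableOn_univ, ← Iic_union_Ioi (a := (0 : ℝ))]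
  refine IntegrableOn.union ?_ (hf.congr_fun (fun x hx => by
    simp only [abs_of_pos (show 0 < x from hx)]) measurableSet_Ioi)
  rw [integrableOn_Iic_iff_integrableOn_Iio]
  have h := ((Measure.measurePreserving_neg (volume : Measure ℝ)).integrableOn_comp_preimage
    (Homeomorph.neg ℝ).measurableEmbedding (f := f) (s := Ioi 0)).2 hf
  have h2 : (Neg.neg ⁻¹' Ioi (0 : ℝ)) = Iio 0 := by ext; simp
  rw [h2] at h
  exact h.congr_fun (fun x hx => by
    simp only [Function.comp_apply, abs_of_neg (show x < 0 from hx)]) measurableSet_Iio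

/-- Tonelli's theorem applied to the sum of the norms. -/
theorem integrable_of_norm_le_tsum {f : ℝ → ℂ} {ι : Type*} [Countable ι] {F : ι → ℝ → ℂ}
    (hf : AEStronglyMeasurable f) (hF : ∀ i, Integrable (F i))
    (hs : Summable fun i => ∫ x, ‖F i x‖) (hFs : ∀ x, Summable fun i => ‖F i x‖)
    (hle : ∀ x, ‖f x‖ ≤ ∑' i, ‖F i x‖) : Integrable f := by
  refine ⟨hf, ?_⟩
  have h1 : ∀ x, ‖f x‖ₑ ≤ ∑' i, ‖F i x‖ₑ := by
    intro x
    have h2 : ∑' i, ‖F i x‖ₑ = ENNReal.ofReal (∑' i, ‖F i x‖) := by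
      rw [ENNReal.ofReal_tsum_of_nonneg (fun i => norm_nonneg _) (hFs x)]
      exact tsum_congr fun i => (ofReal_norm _).symm
    rw [h2, ← ofReal_norm]
    exact ENNReal.ofReal_le_ofReal (hle x)
  have h3 : ∫⁻ x, ∑' i, ‖F i x‖ₑ = ENNReal.ofReal (∑' i, ∫ x, ‖F i x‖) := by
    rw [lintegral_tsum fun i => (hF i).1.enorm,
      ENNReal.ofReal_tsum_of_nonneg (fun i => integral_nonneg fun _ => norm_nonneg _) hs]
    exact tsum_congr fun i => (ofReal_integral_norm_eq_lintegral_enorm (hF i)).symm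
  exact (lintegral_mono h1).trans_lt (h3 ▸ ENNReal.ofReal_lt_top)

/-- The factor 𝐞(xz) costs at most exp(2π‖z‖|x|), so everything reduces to one half-line. -/
theorem integrable_sign_mul {φ : ℝ → ℂ} {z : ℂ} (hφ : Continuous φ)
    (h : IntegrableOn (fun x => φ x * (Real.exp (2 * Real.pi * ‖z‖ * x) : ℂ)) (Ioi 0)) :
    Integrable fun x : ℝ => (Real.sign x : ℂ) * φ |x| * e (x * z) := by
  have hmeas : AEStronglyMeasurable (fun x : ℝ => (Real.sign x : ℂ) * φ |x| * e (x * z)) := by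
    have h1 : Measurable fun x : ℝ => (Real.sign x : ℂ) := by
      refine Complex.measurable_ofReal.comp ?_
      unfold Real.sign
      exact Measurable.ite measurableSet_Iio measurable_const
        (Measurable.ite measurableSet_Ioi measurable_const measurable_const)
    refine ((h1.mul (hφ.comp continuous_abs).measurable).mul ?_).aestronglyMeasurable
    exact (continuous_e.comp (Complex.continuous_ofReal.mul continuous_const)).measurable
  have hn : ∀ x : ℝ, ‖(Real.sign x : ℂ) * φ |x| * e (x * z)‖ ≤
      ‖φ |x| * (Real.exp (2 * Real.pi * ‖z‖ * |x|) : ℂ)‖ := by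
    intro x
    rw [norm_mul, norm_mul, norm_mul, norm_e_mul, Complex.norm_real, Complex.norm_real,
      Real.norm_of_nonneg (Real.exp_pos _).le]
    have h1 : ‖Real.sign x‖ ≤ 1 := by
      rcases Real.sign_apply_eq x with h | h | h <;> simp [h]
    have h2 : Real.exp (-2 * Real.pi * x * z.im) ≤ Real.exp (2 * Real.pi * ‖z‖ * |x|) := by
      apply Real.exp_le_exp.2
      have h3 : -(x * z.im) ≤ |x| * ‖z‖ := by
        refine (neg_le_abs _).trans ?_
        rw [abs_mul]
        exact mul_le_mul_of_nonneg_left (Complex.abs_im_le_norm z) (abs_nonneg _)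
      nlinarith [Real.pi_pos]
    calc _ ≤ 1 * ‖φ |x|‖ * Real.exp (2 * Real.pi * ‖z‖ * |x|) := by gcongr
      _ = _ := by rw [one_mul]
  have habs : Integrable fun x : ℝ => ‖φ |x| * (Real.exp (2 * Real.pi * ‖z‖ * |x|) : ℂ)‖ :=
    integrable_comp_abs_of_integrableOn_Ioi (f := fun x : ℝ =>
      ‖φ x * (Real.exp (2 * Real.pi * ‖z‖ * x) : ℂ)‖) h.norm
  exact habs.mono' hmeas (Eventually.of_forall hn)

theorem integral_sign_mul {φ : ℝ → ℂ} {z : ℂ}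
    (h : Integrable fun x : ℝ => (Real.sign x : ℂ) * φ |x| * e (x * z)) :
    ∫ x : ℝ, (Real.sign x : ℂ) * φ |x| * e (x * z) =
      ∫ x in Ioi (0 : ℝ), φ x * (e (x * z) - e (-(x * z))) := by
  rw [← intervalIntegral.integral_Iic_add_Ioi (b := 0) h.integrableOn h.integrableOn]
  have h1 := integral_comp_neg_Ioi (0 : ℝ)
    (f := fun x : ℝ => (Real.sign x : ℂ) * φ |x| * e (x * z))
  rw [neg_zero] at h1
  have h3 : IntegrableOn (fun x : ℝ => (Real.sign (-x) : ℂ) * φ |-x| * e ((-x : ℝ) * z))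
      (Ioi 0) := h.comp_neg.integrableOn
  rw [← h1, ← integral_add h3 h.integrableOn]
  refine setIntegral_congr_fun measurableSet_Ioi fun x hx => ?_
  have hx' : 0 < x := hx
  simp only [Real.sign_neg, abs_neg, abs_of_pos hx', Real.sign_of_pos hx']
  push_cast
  rw [neg_mul (x : ℂ)]
  ring

end OddFunctions

/-! ### Fourier–Laplace transforms of erfc and of the tent functions -/

section Transforms

open MeasureTheory Filter Topology Set

theorem integrableOn_erfc_mul_exp {a : ℝ} (ha : 0 < a) (B : ℝ) :
    IntegrableOn (fun x => (erfc (a * x) : ℂ) * (Real.exp (B * x) : ℂ)) (Ioi 0) := by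
  have hG : Integrable fun x : ℝ =>
      Complex.exp (-((a ^ 2 : ℝ) : ℂ) * (x : ℂ) ^ 2 + (B : ℂ) * x + 0) :=
    integrable_cexp_quadratic (by rw [Complex.ofReal_re]; positivity) _ _
  refine (hG.norm.integrableOn (s := Ioi 0)).mono' ?_ ?_
  · refine Continuous.aestronglyMeasurable ?_
    exact (Complex.continuous_ofReal.comp (continuous_erfc.comp (continuous_const_mul a))).mul
      (by fun_prop)
  · refine (ae_restrict_mem measurableSet_Ioi).mono fun x hx => ?_
    have hx0 : 0 ≤ a * x := by have : 0 < x := hx; positivity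
    rw [← Complex.ofReal_mul, Complex.norm_real, Real.norm_of_nonneg
      (mul_nonneg (erfc_nonneg _) (Real.exp_pos _).le), Complex.norm_exp]
    have : (-((a ^ 2 : ℝ) : ℂ) * (x : ℂ) ^ 2 + (B : ℂ) * x + 0).re = -(a * x) ^ 2 + B * x := by
      have : (-((a ^ 2 : ℝ) : ℂ) * (x : ℂ) ^ 2 + (B : ℂ) * x + 0) =
        ((-(a * x) ^ 2 + B * x : ℝ) : ℂ) := by push_cast; ring
      rw [this, Complex.ofReal_re]
    rw [this, Real.exp_add]
    exact mul_le_mul_of_nonneg_right (erfc_le hx0) (Real.exp_pos _).le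

theorem norm_e_sub_le {z : ℂ} {x : ℝ} (hx : 0 ≤ x) :
    ‖e (x * z) - e (-(x * z))‖ ≤ 2 * Real.exp (2 * Real.pi * ‖z‖ * x) := by
  have key : ∀ y : ℝ, |y| = x → ‖e (y * z)‖ ≤ Real.exp (2 * Real.pi * ‖z‖ * x) := by
    intro y hy
    rw [norm_e_mul]
    apply Real.exp_le_exp.2
    have h3 : -(y * z.im) ≤ x * ‖z‖ := by
      refine (neg_le_abs _).trans ?_
      rw [abs_mul, hy]
      exact mul_le_mul_of_nonneg_left (Complex.abs_im_le_norm z) hx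
    nlinarith [Real.pi_pos]
  have h1 := key x (abs_of_nonneg hx)
  have h2 := key (-x) (by rw [abs_neg, abs_of_nonneg hx])
  push_cast at h2
  rw [neg_mul] at h2
  linarith [norm_sub_le (e (x * z)) (e (-(x * z)))]

theorem hasDerivAt_e_mul (z : ℂ) (x : ℝ) :
    HasDerivAt (fun x : ℝ => e (x * z)) (2 * Real.pi * Complex.I * z * e (x * z)) x := by
  have h := (hasDerivAt_e (x * z)).comp (x : ℂ) ((hasDerivAt_id (x : ℂ)).mul_const z)
  convert! h.comp_ofReal using 1
  ring

theorem hasDerivAt_e_neg_mul (z : ℂ) (x : ℝ) :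
    HasDerivAt (fun x : ℝ => e (-(x * z))) (-(2 * Real.pi * Complex.I * z) * e (-(x * z))) x := by
  have h := hasDerivAt_e_mul (-z) x
  convert! h using 1
  · funext y; rw [mul_neg]
  · rw [mul_neg (x : ℂ)]; ring

/-- Integration by parts turns erfc into a Gaussian. The new integrand is even, so the half-line
integral is half of a complete Gaussian integral. -/
theorem integral_erfc_mul {a : ℝ} (ha : 0 < a) {z : ℂ} (hz : z ≠ 0) :
    ∫ x in Ioi (0 : ℝ), (erfc (a * x) : ℂ) * (e (x * z) - e (-(x * z))) =
      2 / (2 * Real.pi * Complex.I * z) *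
        (Complex.exp ((2 * Real.pi * Complex.I * z) ^ 2 / (4 * a ^ 2)) - 1) := by
  set w : ℂ := 2 * Real.pi * Complex.I * z with hw
  have hw0 : w ≠ 0 := mul_ne_zero Complex.two_pi_I_ne_zero hz
  have haC : (a : ℂ) ≠ 0 := by exact_mod_cast ha.ne'
  have hsp : (Real.sqrt Real.pi : ℂ) ≠ 0 := by
    exact_mod_cast (Real.sqrt_pos.2 Real.pi_pos).ne'
  have hb : 0 < (((a ^ 2 : ℝ) : ℂ)).re := by rw [Complex.ofReal_re]; positivity
  have hG : ∀ c : ℂ, Integrable fun x : ℝ =>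
      Complex.exp (-((a ^ 2 : ℝ) : ℂ) * (x : ℂ) ^ 2 + c * x + 0) := fun c =>
    integrable_cexp_quadratic hb _ _
  -- The constant -2 makes the primitive vanish at 0, where erfc does not; the boundary term at
  -- infinity is killed by the Gaussian decay of erfc.
  set E : ℝ → ℂ := fun x => e (x * z) + e (-(x * z)) - 2 with hE
  set D : ℝ → ℂ := fun x => (2 * a / Real.sqrt Real.pi) * (E x * Complex.exp (-((a ^ 2 : ℝ) : ℂ) * (x : ℂ) ^ 2))
    with hD
  have hEx : ∀ x : ℝ, E x * Complex.exp (-((a ^ 2 : ℝ) : ℂ) * (x : ℂ) ^ 2) =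
      Complex.exp (-((a ^ 2 : ℝ) : ℂ) * (x : ℂ) ^ 2 + w * x + 0) +
      Complex.exp (-((a ^ 2 : ℝ) : ℂ) * (x : ℂ) ^ 2 + (-w) * x + 0) -
      2 * Complex.exp (-((a ^ 2 : ℝ) : ℂ) * (x : ℂ) ^ 2 + 0 * x + 0) := by
    intro x
    have h1 : e (x * z) = Complex.exp (w * x) := by rw [e, hw]; congr 1; ring
    have h2 : e (-(x * z)) = Complex.exp (-w * x) := by rw [e, hw]; congr 1; ring
    simp only [hE, h1, h2, add_zero, zero_mul, Complex.exp_add]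
    ring
  have hDint : Integrable D := by
    simp only [hD, hEx]
    exact ((((hG w).add (hG (-w))).sub ((hG 0).const_mul 2))).const_mul _
  have hder : ∀ x ∈ Ici (0 : ℝ), HasDerivAt (fun x : ℝ => E x / w * (erfc (a * x) : ℂ))
      ((erfc (a * x) : ℂ) * (e (x * z) - e (-(x * z))) - D x / w) x := by
    intro x _
    have h1 : HasDerivAt (fun x : ℝ => E x / w) (e (x * z) - e (-(x * z))) x := by
      have := (((hasDerivAt_e_mul z x).add (hasDerivAt_e_neg_mul z x)).sub_const 2).div_const w
      convert! this using 1
      rw [← hw]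
      field_simp
      ring
    have h2 : HasDerivAt (fun x : ℝ => (erfc (a * x) : ℂ))
        ((-(2 / Real.sqrt Real.pi * Real.exp (-(a * x) ^ 2)) * a : ℝ) : ℂ) x := by
      refine HasDerivAt.ofReal_comp ?_
      have := (hasDerivAt_erfc (a * x)).comp x ((hasDerivAt_id x).const_mul a)
      simpa using! this
    convert! h1.mul h2 using 1
    have h3 : (Real.exp (-(a * x) ^ 2) : ℂ) = Complex.exp (-((a ^ 2 : ℝ) : ℂ) * (x : ℂ) ^ 2) := by
      rw [Complex.ofReal_exp]; congr 1; push_cast; ring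
    simp only [hD]
    push_cast [← h3]
    field_simp
    ring
  have hint1 : IntegrableOn (fun x : ℝ => (erfc (a * x) : ℂ) * (e (x * z) - e (-(x * z)))) (Ioi 0) := by
    have h := (integrableOn_erfc_mul_exp ha (2 * Real.pi * ‖z‖)).norm.const_mul 2
    refine h.mono' ?_ ((ae_restrict_mem measurableSet_Ioi).mono fun x hx => ?_)
    · refine Continuous.aestronglyMeasurable ?_
      have := continuous_e
      exact (Complex.continuous_ofReal.comp (continuous_erfc.comp (continuous_const_mul a))).mul
        (by fun_prop)
    · have hx' : (0 : ℝ) ≤ x := le_of_lt hx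
      rw [norm_mul, norm_mul, Complex.norm_real (Real.exp _), Real.norm_of_nonneg (Real.exp_pos _).le]
      have := mul_le_mul_of_nonneg_left (norm_e_sub_le (z := z) hx')
        (norm_nonneg (erfc (a * x) : ℂ))
      linarith
  have hint : IntegrableOn (fun x : ℝ => (erfc (a * x) : ℂ) * (e (x * z) - e (-(x * z))) - D x / w)
      (Ioi 0) := hint1.sub (hDint.div_const w).integrableOn
  have hlim : Tendsto (fun x : ℝ => E x / w * (erfc (a * x) : ℂ)) atTop (𝓝 0) := by
    rw [tendsto_zero_iff_norm_tendsto_zero]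
    have hq : Tendsto (fun x : ℝ => 4 / ‖w‖ * Real.exp (-(a ^ 2 * x ^ 2 - 2 * Real.pi * ‖z‖ * x))) atTop
        (𝓝 (4 / ‖w‖ * 0)) := by
      refine Tendsto.const_mul _ (Real.tendsto_exp_neg_atTop_nhds_zero.comp ?_)
      have : (fun x : ℝ => a ^ 2 * x ^ 2 - 2 * Real.pi * ‖z‖ * x) =
          fun x => x * (a ^ 2 * x + -(2 * Real.pi * ‖z‖)) := by funext x; ring
      rw [this]
      exact tendsto_id.atTop_mul_atTop₀ (tendsto_atTop_add_const_right _ _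
        (tendsto_id.const_mul_atTop (by positivity)))
    rw [mul_zero] at hq
    refine squeeze_zero' (Eventually.of_forall fun _ => norm_nonneg _)
      ((eventually_ge_atTop 0).mono fun x hx => ?_) hq
    have hn : ‖E x‖ ≤ 4 * Real.exp (2 * Real.pi * ‖z‖ * x) := by
      have h1 : ‖e (x * z) + e (-(x * z))‖ ≤ 2 * Real.exp (2 * Real.pi * ‖z‖ * x) := by
        have hk : ∀ y : ℝ, |y| = x → ‖e (y * z)‖ ≤ Real.exp (2 * Real.pi * ‖z‖ * x) := by
          intro y hy
          rw [norm_e_mul]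
          apply Real.exp_le_exp.2
          have h3 : -(y * z.im) ≤ x * ‖z‖ := by
            refine (neg_le_abs _).trans ?_
            rw [abs_mul, hy]
            exact mul_le_mul_of_nonneg_left (Complex.abs_im_le_norm z) hx
          nlinarith [Real.pi_pos]
        have h1 := hk x (abs_of_nonneg hx)
        have h2 := hk (-x) (by rw [abs_neg, abs_of_nonneg hx])
        push_cast at h2
        rw [neg_mul] at h2
        linarith [norm_add_le (e (x * z)) (e (-(x * z)))]
      have h2 : (1 : ℝ) ≤ Real.exp (2 * Real.pi * ‖z‖ * x) := Real.one_le_exp (by positivity)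
      have h3 := norm_sub_le (e (x * z) + e (-(x * z))) 2
      simp only [hE]
      have : ‖(2 : ℂ)‖ = 2 := by simp
      linarith
    rw [norm_mul, norm_div, Complex.norm_real, Real.norm_of_nonneg (erfc_nonneg _)]
    have h4 := erfc_le (x := a * x) (by positivity)
    calc _ ≤ 4 * Real.exp (2 * Real.pi * ‖z‖ * x) / ‖w‖ * Real.exp (-(a * x) ^ 2) := by
          gcongr
          exact erfc_nonneg _
      _ = _ := by
          rw [div_mul_eq_mul_div, mul_assoc, ← Real.exp_add, mul_div_right_comm]
          congr 2; ring
  have hmain := integral_Ioi_of_hasDerivAt_of_tendsto' hder hint hlim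
  have hE0 : E 0 = 0 := by simp [hE, e_zero]; norm_num
  rw [integral_sub hint1 (hDint.div_const w).integrableOn, hE0, zero_div, zero_mul, sub_zero,
    sub_eq_zero] at hmain
  rw [hmain]
  have heven : ∫ x in Ioi (0 : ℝ), D x = (1 / 2) * ∫ x, D x := by
    have h1 := integral_comp_neg_Ioi (0 : ℝ) (f := D)
    rw [neg_zero] at h1
    have h2 : ∀ x, D (-x) = D x := by
      intro x; simp only [hD, hE]; push_cast; rw [neg_sq, neg_mul, neg_neg]; ring
    simp only [h2] at h1
    rw [← intervalIntegral.integral_Iic_add_Ioi (b := 0) hDint.integrableOn hDint.integrableOn,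
      ← h1]
    ring
  have hq : ∀ c : ℂ, ∫ x : ℝ, Complex.exp (-((a ^ 2 : ℝ) : ℂ) * (x : ℂ) ^ 2 + c * x + 0) =
      Real.sqrt Real.pi / a * Complex.exp (c ^ 2 / (4 * a ^ 2)) := by
    intro c
    have h := integral_cexp_quadratic (b := -((a ^ 2 : ℝ) : ℂ)) (by
      rw [Complex.neg_re]; linarith) c 0
    rw [h]
    congr 1
    · rw [neg_neg, ← Complex.ofReal_div, Real.sqrt_eq_rpow,
        show (1 / 2 : ℂ) = ((1 / 2 : ℝ) : ℂ) by push_cast; rfl,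
        ← Complex.ofReal_cpow (by positivity), ← Real.sqrt_eq_rpow, ← Real.sqrt_eq_rpow,
        Real.sqrt_div Real.pi_pos.le,
        Real.sqrt_sq ha.le, Complex.ofReal_div]
    · congr 1
      push_cast
      field_simp
      ring
  rw [integral_div, heven]
  simp only [hD, hEx]
  have hadd : Integrable fun x : ℝ =>
      Complex.exp (-((a ^ 2 : ℝ) : ℂ) * (x : ℂ) ^ 2 + w * x + 0) +
      Complex.exp (-((a ^ 2 : ℝ) : ℂ) * (x : ℂ) ^ 2 + (-w) * x + 0) := (hG w).add (hG (-w))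
  rw [integral_const_mul, integral_sub hadd ((hG 0).const_mul 2), integral_add (hG w) (hG (-w)),
    integral_const_mul, hq, hq, hq, neg_sq, zero_pow two_ne_zero, zero_div, Complex.exp_zero]
  field_simp
  ring

/-- The tent function `max(m - y, 0)` for `m = n + 1/2`. -/
noncomputable def cutoff (n : ℤ) (y : ℝ) : ℝ := max ((n : ℝ) + 1 / 2 - y) 0

theorem cutoff_nonneg (n : ℤ) (y : ℝ) : 0 ≤ cutoff n y := le_max_right _ _

theorem continuous_cutoff (n : ℤ) : Continuous (cutoff n) := by unfold cutoff; fun_prop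

theorem cutoff_le {n : ℤ} {y : ℝ} (hy : 0 ≤ y) : cutoff n y ≤ |(n : ℝ) + 1 / 2| :=
  max_le ((by linarith : _ ≤ (n : ℝ) + 1 / 2).trans (le_abs_self _)) (abs_nonneg _)

theorem cutoff_eq_zero {n : ℤ} {y : ℝ} (h : (n : ℝ) + 1 / 2 ≤ y) : cutoff n y = 0 :=
  max_eq_right (by linarith)

theorem cutoff_eq {n : ℤ} {y : ℝ} (h : y ≤ (n : ℝ) + 1 / 2) :
    cutoff n y = (n : ℝ) + 1 / 2 - y := max_eq_left (by linarith)

theorem cutoff_of_neg {n : ℤ} (hn : n < 0) {y : ℝ} (hy : 0 ≤ y) : cutoff n y = 0 := by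
  apply cutoff_eq_zero
  have : (n : ℝ) ≤ -1 := by exact_mod_cast (by omega : n ≤ -1)
  linarith

theorem integral_cutoff_mul (n : ℤ) {z : ℂ} (hz : z ≠ 0) :
    ∫ x in Ioi (0 : ℝ), (cutoff n x : ℂ) * (e (x * z) - e (-(x * z))) =
      if 0 ≤ n then (e (((n : ℂ) + 1 / 2) * z) - e (-(((n : ℂ) + 1 / 2) * z))) /
          (2 * Real.pi * Complex.I * z) ^ 2
        - 2 * ((n : ℂ) + 1 / 2) / (2 * Real.pi * Complex.I * z) else 0 := by
  split_ifs with hn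
  · set w : ℂ := 2 * Real.pi * Complex.I * z with hw
    have hw0 : w ≠ 0 := mul_ne_zero Complex.two_pi_I_ne_zero hz
    set m : ℝ := (n : ℝ) + 1 / 2 with hm
    have hm0 : 0 ≤ m := by have : (0 : ℝ) ≤ n := by exact_mod_cast hn
                           positivity
    have hcont : Continuous fun x : ℝ => (e (x * z) - e (-(x * z)) : ℂ) := by
      have := continuous_e; fun_prop
    rw [setIntegral_eq_of_subset_of_forall_sdiff_eq_zero measurableSet_Ioi
      (Ioc_subset_Ioi_self : Ioc 0 m ⊆ Ioi 0) (fun x hx => by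
        have : m < x := by
          by_contra h
          exact hx.2 ⟨hx.1, not_lt.1 h⟩
        rw [cutoff_eq_zero this.le, Complex.ofReal_zero, zero_mul]),
      ← intervalIntegral.integral_of_le hm0]
    have hcongr : ∫ x in (0 : ℝ)..m, (cutoff n x : ℂ) * (e (x * z) - e (-(x * z))) =
        ∫ x in (0 : ℝ)..m, ((m : ℂ) - x) * (e (x * z) - e (-(x * z))) := by
      refine intervalIntegral.integral_congr fun x hx => ?_
      rw [uIcc_of_le hm0] at hx
      simp only [cutoff_eq hx.2]
      push_cast [hm]
      ring
    rw [hcongr, intervalIntegral.integral_eq_sub_of_hasDerivAt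
      -- The primitive obtained by integrating by parts twice against the linear factor m - x.
      (f := fun x : ℝ => ((m : ℂ) - x) * ((e (x * z) + e (-(x * z))) / w) +
        (e (x * z) - e (-(x * z))) / w ^ 2)]
    · push_cast [hm]
      simp [e_zero]
      field_simp
      ring
    · intro x _
      have h1 := hasDerivAt_e_mul z x
      have h2 := hasDerivAt_e_neg_mul z x
      have h3 : HasDerivAt (fun x : ℝ => (m : ℂ) - x) (-1) x :=
        (hasDerivAt_id (x : ℂ)).comp_ofReal.const_sub _
      convert! (h3.mul ((h1.add h2).div_const w)).add ((h1.sub h2).div_const (w ^ 2)) using 1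
      rw [← hw]
      simp only [Pi.add_apply]
      field_simp
      ring
    · exact ((by fun_prop : Continuous fun x : ℝ => (m : ℂ) - x).mul hcont).intervalIntegrable _ _
  · rw [setIntegral_eq_zero_of_forall_eq_zero]
    intro x hx
    rw [cutoff_of_neg (not_le.1 hn) (le_of_lt hx), Complex.ofReal_zero, zero_mul]

end Transforms

/-! ### The Fourier–Laplace transform of sgn(x)W(|x|) -/

section Profile

open MeasureTheory Filter Topology Set

/-- The reflection n ↦ -1 - n is m ↦ -m. It preserves m² and changes 𝐞(m/2) by 𝐞(-m) = -1. -/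
theorem thetaCoeff_neg (τ : ℂ) (n : ℤ) : thetaCoeff τ (-1 - n) = -thetaCoeff τ n := by
  rw [thetaCoeff, thetaCoeff, ← neg_one_mul (e _), ← e_half, ← e_add,
    ← e_add_int (1 / 2 + _) (-n - 1)]
  congr 1
  push_cast
  ring

theorem oddTheta_neg (τ z : ℂ) : oddTheta τ (-z) = -oddTheta τ z := by
  rw [oddTheta, oddTheta, ← tsum_neg, ← (Equiv.subLeft (-1 : ℤ)).tsum_eq]
  refine tsum_congr fun n => ?_
  rw [Equiv.subLeft_apply, thetaCoeff_neg, neg_mul]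
  congr 3
  push_cast
  ring

/-- The reflection n ↦ -1 - n, that is m ↦ -m on half-integers, exchanges the two halves of the sum.
-/
theorem tsum_ite_nonneg {F : ℤ → ℂ} (hF : ∀ n, F (-1 - n) = F n) (hs : Summable F) :
    (∑' n : ℤ, if 0 ≤ n then F n else 0) = (1 / 2) * ∑' n, F n := by
  have h1 : Summable fun n : ℤ => if 0 ≤ n then F n else 0 :=
    (hs.indicator {n : ℤ | 0 ≤ n}).congr fun n => by simp [indicator]
  have h2 : Summable fun n : ℤ => if 0 ≤ n then 0 else F n :=
    (hs.indicator {n : ℤ | ¬ 0 ≤ n}).congr fun n => by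
      by_cases h : 0 ≤ n
      · simp [indicator, h]
      · simp [indicator, h]
  have h3 : (∑' n : ℤ, if 0 ≤ n then 0 else F n) = ∑' n : ℤ, if 0 ≤ n then F n else 0 := by
    rw [← (Equiv.subLeft (-1 : ℤ)).tsum_eq]
    refine tsum_congr fun n => ?_
    rw [Equiv.subLeft_apply, hF]
    by_cases h : 0 ≤ n
    · rw [if_neg (by omega), if_pos h]
    · rw [if_pos (by omega), if_neg h]
  have h4 := h1.tsum_add h2
  have h5 : ∀ n : ℤ, ((if 0 ≤ n then F n else 0) + if 0 ≤ n then 0 else F n) = F n := by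
    intro n; split_ifs <;> simp
  simp only [h5] at h4
  rw [h4, h3]
  ring

/-- `∑_{m > y} (m - y) 𝐞(m²τ/2 + m/2)` over half-integers `m`. -/
noncomputable def kernelSum (τ : ℂ) (y : ℝ) : ℂ := ∑' n : ℤ, (cutoff n y : ℂ) * thetaCoeff τ n

/-- The function `W` with `g_τ(x) = 𝐞(-x²τ/2) sgn(x) W(|x|)`. -/
noncomputable def profile (τ : ℍ) (y : ℝ) : ℂ :=
  kernelSum τ y / (Complex.I * etaCubed τ) -
    (erfc (Real.sqrt (2 * Real.pi * τ.im) * y) : ℂ) / 2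

theorem gPlus_eq (τ : ℍ) (x : ℝ) : gPlus τ x = e (-((x : ℂ) ^ 2 / 2 * τ)) *
    ((Real.sign x : ℂ) / (Complex.I * etaCubed τ)) * kernelSum τ |x| := by
  rw [gPlus, kernelSum]
  congr 1
  refine tsum_congr fun n => ?_
  rw [thetaCoeff]
  split_ifs with h
  · rw [cutoff_eq h.le]
  · rw [cutoff_eq_zero (not_lt.1 h), Complex.ofReal_zero, zero_mul]

theorem g_eq (τ : ℍ) (x : ℝ) :
    g τ x = e (-((x : ℂ) ^ 2 / 2 * τ)) * ((Real.sign x : ℂ) * profile τ |x|) := by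
  rw [g, gPlus_eq, gStar, profile]
  ring

theorem norm_int_add_half (n : ℤ) : ‖(n : ℂ) + 1 / 2‖ = |(n : ℝ) + 1 / 2| := by
  rw [← Real.norm_eq_abs, ← Complex.norm_real]; push_cast; rfl

theorem norm_cutoff_mul_thetaCoeff_le (τ : ℂ) (n : ℤ) {y : ℝ} (hy : 0 ≤ y) :
    ‖(cutoff n y : ℂ) * thetaCoeff τ n‖ ≤ ‖((n : ℂ) + 1 / 2) * thetaCoeff τ n‖ := by
  rw [norm_mul, norm_mul, norm_int_add_half, Complex.norm_real,
    Real.norm_of_nonneg (cutoff_nonneg n y)]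
  exact mul_le_mul_of_nonneg_right (cutoff_le hy) (norm_nonneg _)

theorem summable_kernelSum (τ : ℍ) {y : ℝ} (hy : 0 ≤ y) :
    Summable fun n : ℤ => (cutoff n y : ℂ) * thetaCoeff τ n :=
  Summable.of_norm_bounded (summable_thetaConst τ.2).norm fun n =>
    norm_cutoff_mul_thetaCoeff_le τ n hy

theorem continuous_kernelSum_abs (τ : ℍ) : Continuous fun x : ℝ => kernelSum τ |x| := by
  refine continuous_tsum (fun n => ?_) (summable_thetaConst τ.2).norm fun n x =>
    norm_cutoff_mul_thetaCoeff_le τ n (abs_nonneg x)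
  exact (Complex.continuous_ofReal.comp ((continuous_cutoff n).comp continuous_abs)).mul
    continuous_const

theorem continuous_profile_abs (τ : ℍ) : Continuous fun x : ℝ => profile τ |x| := by
  refine ((continuous_kernelSum_abs τ).div_const _).sub (Continuous.div_const ?_ _)
  exact Complex.continuous_ofReal.comp (continuous_erfc.comp (continuous_const.mul continuous_abs))

/-- At y = 0 the sum is the positive half of the theta constant, which is evaluated by Jacobi's
identity. -/
theorem kernelSum_zero (τ : ℍ) : kernelSum τ 0 = Complex.I * etaCubed τ / 2 := by
  rw [← thetaConst_eq, thetaConst, kernelSum]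
  have h := tsum_ite_nonneg (F := fun n : ℤ => ((n : ℂ) + 1 / 2) * thetaCoeff τ n) (fun n => by
    rw [thetaCoeff_neg]; push_cast; ring) (summable_thetaConst τ.2)
  rw [div_eq_inv_mul, ← one_div, ← h]
  refine tsum_congr fun n => ?_
  split_ifs with hn
  · rw [cutoff_eq (by have : (0 : ℝ) ≤ n := by exact_mod_cast hn
                      positivity)]
    push_cast
    ring
  · rw [cutoff_of_neg (not_le.1 hn) le_rfl, Complex.ofReal_zero, zero_mul]

/-- The holomorphic part contributes 1/2 and erfc(0)/2 = 1/2. This cancellation is what removes the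
jump of sgn at the origin and makes `g τ` continuous. -/
theorem profile_zero (τ : ℍ) : profile τ 0 = 0 := by
  have h := etaCubed_ne_zero τ
  rw [profile, kernelSum_zero, mul_zero, erfc_zero]
  field_simp
  simp

theorem continuous_sign_mul_profile (τ : ℍ) :
    Continuous fun x : ℝ => (Real.sign x : ℂ) * profile τ |x| := by
  rw [continuous_iff_continuousAt]
  intro x
  rcases lt_trichotomy x 0 with hx | rfl | hx
  · refine ((continuous_profile_abs τ).const_mul (-1)).continuousAt.congr ?_
    filter_upwards [Iio_mem_nhds hx] with y hy
    rw [Real.sign_of_neg hy]; push_cast; ring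
  · have h0 := (continuous_profile_abs τ).tendsto 0
    rw [abs_zero, profile_zero] at h0
    rw [ContinuousAt, abs_zero, profile_zero, mul_zero]
    rw [tendsto_zero_iff_norm_tendsto_zero] at h0 ⊢
    refine squeeze_zero (fun _ => norm_nonneg _) (fun y => ?_) h0
    rw [norm_mul]
    have h1 : ‖(Real.sign y : ℂ)‖ ≤ 1 := by
      rcases Real.sign_apply_eq y with h | h | h <;> simp [h]
    exact mul_le_of_le_one_left (norm_nonneg _) h1
  · refine ((continuous_profile_abs τ).const_mul 1).continuousAt.congr ?_
    filter_upwards [Ioi_mem_nhds hx] with y hy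
    rw [Real.sign_of_pos hy]; push_cast; ring

theorem continuous_g (τ : ℍ) : Continuous (g τ) := by
  have : g τ = fun x => _ := funext (g_eq τ)
  rw [this]
  refine Continuous.mul ?_ (continuous_sign_mul_profile τ)
  exact continuous_e.comp (by fun_prop)

theorem measurable_sign : Measurable fun x : ℝ => (Real.sign x : ℂ) := by
  refine Complex.measurable_ofReal.comp ?_
  unfold Real.sign
  exact Measurable.ite measurableSet_Iio measurable_const
    (Measurable.ite measurableSet_Ioi measurable_const measurable_const)

theorem norm_sign_le (x : ℝ) : ‖(Real.sign x : ℂ)‖ ≤ 1 := by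
  rcases Real.sign_apply_eq x with h | h | h <;> simp [h]

theorem norm_e_real_mul_le (x : ℝ) (z : ℂ) :
    ‖e (x * z)‖ ≤ Real.exp (2 * Real.pi * ‖z‖ * |x|) := by
  rw [norm_e_mul]
  apply Real.exp_le_exp.2
  have h3 : -(x * z.im) ≤ |x| * ‖z‖ := by
    refine (neg_le_abs _).trans ?_
    rw [abs_mul]
    exact mul_le_mul_of_nonneg_left (Complex.abs_im_le_norm z) (abs_nonneg _)
  nlinarith [Real.pi_pos]

/-- The `n`-th term of the Fourier–Laplace integrand of `sgn(x) kernelSum(|x|)`. -/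
noncomputable def kernelTerm (τ z : ℂ) (n : ℤ) (x : ℝ) : ℂ :=
  (Real.sign x : ℂ) * ((cutoff n |x| : ℂ) * thetaCoeff τ n) * e (x * z)

/-- The tent of index m is supported in |x| ≤ |m| and has height at most |m| there. -/
theorem norm_kernelTerm_le (τ z : ℂ) (n : ℤ) (x : ℝ) : ‖kernelTerm τ z n x‖ ≤
    (Icc (-|(n : ℝ) + 1 / 2|) |(n : ℝ) + 1 / 2|).indicator (fun _ => |(n : ℝ) + 1 / 2| *
      ‖thetaCoeff τ n‖ * Real.exp (2 * Real.pi * ‖z‖ * |(n : ℝ) + 1 / 2|)) x := by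
  by_cases hx : |x| ≤ |(n : ℝ) + 1 / 2|
  · rw [indicator_of_mem (mem_Icc.2 (abs_le.1 hx)), kernelTerm, norm_mul, norm_mul, norm_mul,
      Complex.norm_real (cutoff n |x|),
      Real.norm_of_nonneg (cutoff_nonneg _ _)]
    have h1 := (norm_e_real_mul_le x z).trans (Real.exp_le_exp.2
      (mul_le_mul_of_nonneg_left hx (by positivity : 0 ≤ 2 * Real.pi * ‖z‖)))
    have h2 := cutoff_le (n := n) (abs_nonneg x)
    calc _ ≤ 1 * (|(n : ℝ) + 1 / 2| * ‖thetaCoeff τ n‖) *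
          Real.exp (2 * Real.pi * ‖z‖ * |(n : ℝ) + 1 / 2|) := by
          gcongr
          · exact mul_nonneg (cutoff_nonneg _ _) (norm_nonneg _)
          · exact norm_sign_le x
      _ = _ := by rw [one_mul]
  · rw [indicator_of_notMem (fun h => hx (abs_le.2 (mem_Icc.1 h))), kernelTerm, cutoff_eq_zero
      ((le_abs_self _).trans (not_le.1 hx).le)]
    simp

theorem integrable_kernelTerm (τ z : ℂ) (n : ℤ) : Integrable (kernelTerm τ z n) := by
  refine Integrable.mono' (IntegrableOn.integrable_indicator (s := Icc (-|(n : ℝ) + 1 / 2|)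
    |(n : ℝ) + 1 / 2|) (f := fun _ : ℝ => |(n : ℝ) + 1 / 2| *
      ‖thetaCoeff τ n‖ * Real.exp (2 * Real.pi * ‖z‖ * |(n : ℝ) + 1 / 2|))
    (continuousOn_const.integrableOn_Icc) measurableSet_Icc) ?_
    (Eventually.of_forall (norm_kernelTerm_le τ z n))
  refine ((measurable_sign.mul ?_).mul ?_).aestronglyMeasurable
  · exact ((Complex.continuous_ofReal.comp ((continuous_cutoff n).comp continuous_abs)).mul
      continuous_const).measurable
  · exact (continuous_e.comp (Complex.continuous_ofReal.mul continuous_const)).measurable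

theorem summable_integral_norm_kernelTerm (τ : ℍ) (z : ℂ) :
    Summable fun n : ℤ => ∫ x, ‖kernelTerm τ z n x‖ := by
  -- One factor |m| is the height of the tent, and 2|m| is the length of its support; the Gaussian
  -- in m dominates exp(2π‖z‖|m|).
  have hs := (summable_int_abs_pow_mul_exp 2 τ.2 (2 * Real.pi * ‖z‖)).mul_left 2
  refine Summable.of_nonneg_of_le (fun n => integral_nonneg fun _ => norm_nonneg _) (fun n => ?_) hs
  have h := integral_mono_of_nonneg (μ := volume) (Eventually.of_forall fun x => norm_nonneg _)
    (IntegrableOn.integrable_indicator (s := Icc (-|(n : ℝ) + 1 / 2|)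
    |(n : ℝ) + 1 / 2|) (f := fun _ : ℝ => |(n : ℝ) + 1 / 2| *
      ‖thetaCoeff τ n‖ * Real.exp (2 * Real.pi * ‖z‖ * |(n : ℝ) + 1 / 2|))
    (continuousOn_const.integrableOn_Icc) measurableSet_Icc)
    (Eventually.of_forall (norm_kernelTerm_le τ z n))
  refine h.trans (le_of_eq ?_)
  rw [integral_indicator measurableSet_Icc, setIntegral_const, Measure.real, Real.volume_Icc,
    ENNReal.toReal_ofReal (by linarith [abs_nonneg ((n : ℝ) + 1 / 2)]), norm_thetaCoeff, smul_eq_mul,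
    Real.exp_add]
  ring

theorem tsum_kernelTerm (τ z : ℂ) (x : ℝ) :
    ∑' n, kernelTerm τ z n x = (Real.sign x : ℂ) * kernelSum τ |x| * e (x * z) := by
  simp only [kernelTerm]
  rw [tsum_mul_right, tsum_mul_left, kernelSum]

theorem summable_norm_kernelTerm (τ : ℍ) (z : ℂ) (x : ℝ) :
    Summable fun n => ‖kernelTerm τ z n x‖ := by
  simp only [kernelTerm]
  exact (((summable_kernelSum τ (abs_nonneg x)).mul_left _).mul_right _).norm

theorem integrable_kernelSum (τ : ℍ) (z : ℂ) :
    Integrable fun x : ℝ => (Real.sign x : ℂ) * kernelSum τ |x| * e (x * z) := by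
  refine integrable_of_norm_le_tsum (F := kernelTerm τ z) ?_ (integrable_kernelTerm τ z)
    (summable_integral_norm_kernelTerm τ z) (summable_norm_kernelTerm τ z) fun x => ?_
  · refine ((measurable_sign.mul (continuous_kernelSum_abs τ).measurable).mul
      ?_).aestronglyMeasurable
    exact (continuous_e.comp (Complex.continuous_ofReal.mul continuous_const)).measurable
  · rw [← tsum_kernelTerm]
    exact norm_tsum_le_tsum_norm (summable_norm_kernelTerm τ z x)

/-- Integrating tent by tent, the exponentials 𝐞(±mz)/w² recombine to ϑ(z)/w² by oddness, while the
linear terms -2m/w add up to the theta constant, which is iη³. -/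
theorem integral_kernelSum (τ : ℍ) {z : ℂ} (hz : z ≠ 0) :
    ∫ x : ℝ, (Real.sign x : ℂ) * kernelSum τ |x| * e (x * z) =
      oddTheta τ z / (2 * Real.pi * Complex.I * z) ^ 2 -
        Complex.I * etaCubed τ / (2 * Real.pi * Complex.I * z) := by
  have h1 := integral_tsum_of_summable_integral_norm (integrable_kernelTerm τ z)
    (summable_integral_norm_kernelTerm τ z)
  simp only [tsum_kernelTerm] at h1
  rw [← h1]
  set w : ℂ := 2 * Real.pi * Complex.I * z with hw
  have hw0 : w ≠ 0 := mul_ne_zero Complex.two_pi_I_ne_zero hz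
  set F : ℤ → ℂ := fun n => thetaCoeff τ n * ((e (((n : ℂ) + 1 / 2) * z) -
    e (-(((n : ℂ) + 1 / 2) * z))) / w ^ 2 - 2 * ((n : ℂ) + 1 / 2) / w) with hF
  have hterm : ∀ n : ℤ, ∫ x, kernelTerm τ z n x = if 0 ≤ n then F n else 0 := by
    intro n
    have h2 := integral_sign_mul (φ := fun x => (cutoff n x : ℂ) * thetaCoeff τ n) (z := z)
      (integrable_kernelTerm τ z n)
    have h3 : ∀ x : ℝ, (cutoff n x : ℂ) * thetaCoeff τ n * (e (x * z) - e (-(x * z))) =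
        thetaCoeff τ n * ((cutoff n x : ℂ) * (e (x * z) - e (-(x * z)))) := fun x => by ring
    simp only [h3] at h2
    simp only [kernelTerm]
    rw [h2, integral_const_mul, integral_cutoff_mul n hz]
    split_ifs
    · rfl
    · rw [mul_zero]
  have hs1 := summable_oddTheta τ.2 z
  have hs2 := summable_oddTheta τ.2 (-z)
  have hs3 := summable_thetaConst τ.2
  have hFeq : ∀ n, F n = thetaCoeff τ n * e (((n : ℂ) + 1 / 2) * z) * (1 / w ^ 2) -
      thetaCoeff τ n * e (((n : ℂ) + 1 / 2) * -z) * (1 / w ^ 2) -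
      ((n : ℂ) + 1 / 2) * thetaCoeff τ n * (2 / w) := by
    intro n
    simp only [hF, mul_neg]
    ring
  have hsF : Summable F := by
    refine Summable.congr ?_ fun n => (hFeq n).symm
    exact ((hs1.mul_right _).sub (hs2.mul_right _)).sub (hs3.mul_right _)
  simp only [hterm]
  rw [tsum_ite_nonneg (fun n => ?_) hsF]
  · simp only [hFeq]
    rw [((hs1.mul_right _).sub (hs2.mul_right _)).tsum_sub (hs3.mul_right _),
      (hs1.mul_right _).tsum_sub (hs2.mul_right _), tsum_mul_right, tsum_mul_right, tsum_mul_right,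
      ← oddTheta, ← oddTheta, ← thetaConst, oddTheta_neg, thetaConst_eq]
    field_simp
    ring
  · simp only [hF, thetaCoeff_neg]
    have h5 : (((-1 - n : ℤ) : ℂ) + 1 / 2) = -((n : ℂ) + 1 / 2) := by push_cast; ring
    rw [h5, neg_mul ((n : ℂ) + 1 / 2), neg_neg]
    ring

theorem sqrt_two_pi_im_pos (τ : ℍ) : 0 < Real.sqrt (2 * Real.pi * τ.im) :=
  Real.sqrt_pos.2 (mul_pos (mul_pos two_pos Real.pi_pos) τ.im_pos)

theorem integrable_sign_mul_erfc (τ : ℍ) (z : ℂ) : Integrable fun x : ℝ =>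
    (Real.sign x : ℂ) * (erfc (Real.sqrt (2 * Real.pi * τ.im) * |x|) : ℂ) * e (x * z) :=
  integrable_sign_mul (φ := fun x => (erfc (Real.sqrt (2 * Real.pi * τ.im) * x) : ℂ))
    (Complex.continuous_ofReal.comp (continuous_erfc.comp (continuous_const_mul _)))
    (integrableOn_erfc_mul_exp (sqrt_two_pi_im_pos τ) _)

theorem sign_mul_profile_mul_e (τ : ℍ) (z : ℂ) (x : ℝ) :
    (Real.sign x : ℂ) * profile τ |x| * e (x * z) =
      (Complex.I * etaCubed τ)⁻¹ * ((Real.sign x : ℂ) * kernelSum τ |x| * e (x * z)) -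
      (1 / 2) * ((Real.sign x : ℂ) * (erfc (Real.sqrt (2 * Real.pi * τ.im) * |x|) : ℂ)
        * e (x * z)) := by
  rw [profile]; ring

theorem integrable_profile (τ : ℍ) (z : ℂ) :
    Integrable fun x : ℝ => (Real.sign x : ℂ) * profile τ |x| * e (x * z) := by
  simp only [sign_mul_profile_mul_e]
  exact ((integrable_kernelSum τ z).const_mul _).sub ((integrable_sign_mul_erfc τ z).const_mul _)

/-- The theta part produces a term -1/w and the erfc part a term +1/w; they cancel, because the two
jumps at the origin are equal. -/
theorem integral_profile (τ : ℍ) {z : ℂ} (hz : z ≠ 0) :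
    ∫ x : ℝ, (Real.sign x : ℂ) * profile τ |x| * e (x * z) =
      oddTheta τ z / (Complex.I * etaCubed τ * (2 * Real.pi * Complex.I * z) ^ 2) -
        Complex.exp (-(Real.pi * z ^ 2 / (2 * τ.im))) / (2 * Real.pi * Complex.I * z) := by
  have hη := etaCubed_ne_zero τ
  have hw0 : 2 * Real.pi * Complex.I * z ≠ 0 := mul_ne_zero Complex.two_pi_I_ne_zero hz
  simp only [sign_mul_profile_mul_e]
  rw [integral_sub ((integrable_kernelSum τ z).const_mul _)
    ((integrable_sign_mul_erfc τ z).const_mul _), integral_const_mul, integral_const_mul,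
    integral_kernelSum τ hz, integral_sign_mul (φ := fun x =>
      (erfc (Real.sqrt (2 * Real.pi * τ.im) * x) : ℂ)) (integrable_sign_mul_erfc τ z),
    integral_erfc_mul (sqrt_two_pi_im_pos τ) hz]
  have hsq : (Real.sqrt (2 * Real.pi * τ.im) : ℂ) ^ 2 = 2 * Real.pi * τ.im := by
    rw [← Complex.ofReal_pow, Real.sq_sqrt (by have := τ.im_pos; positivity)]
    push_cast
    rfl
  have hexp : (2 * Real.pi * Complex.I * z) ^ 2 / (4 * (Real.sqrt (2 * Real.pi * τ.im) : ℂ) ^ 2) =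
      -(Real.pi * z ^ 2 / (2 * τ.im)) := by
    have hpi : (Real.pi : ℂ) ≠ 0 := by exact_mod_cast Real.pi_ne_zero
    have him : (τ.im : ℂ) ≠ 0 := by exact_mod_cast τ.im_ne_zero
    rw [hsq]
    field_simp
    linear_combination 4 * Complex.I_sq
  rw [hexp]
  field_simp
  ring

end Profile

/-! ### Integrability of `g τ` -/

section Fourier

open MeasureTheory Filter Topology Set
open scoped FourierTransform

theorem fourier_eq_integral_e (f : ℝ → ℂ) (w : ℝ) : 𝓕 f w = ∫ v : ℝ, e (-(v * w)) * f v := by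
  rw [Real.fourier_real_eq_integral_exp_smul]
  refine integral_congr_ae (Eventually.of_forall fun v => ?_)
  simp only [smul_eq_mul, e]
  congr 2
  push_cast
  ring

theorem continuous_fourier {f : ℝ → ℂ} (hf : Integrable f) : Continuous (𝓕 f) :=
  VectorFourier.fourierIntegral_continuous Real.continuous_fourierChar
    (innerSL ℝ).continuous₂ hf

theorem norm_fourier_le (f : ℝ → ℂ) (w : ℝ) : ‖𝓕 f w‖ ≤ ∫ v, ‖f v‖ :=
  VectorFourier.norm_fourierIntegral_le_integral_norm _ _ _ _ _

theorem integral_fourier_mul {f φ : ℝ → ℂ} (hf : Integrable f) (hφ : Integrable φ) :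
    ∫ ξ, 𝓕 f ξ * φ ξ = ∫ x, f x * 𝓕 φ x := by
  have h := VectorFourier.integral_fourierIntegral_smul_eq_flip (𝕜 := ℝ) (V := ℝ) (W := ℝ)
    (L := innerₗ ℝ) (μ := volume) (ν := volume) Real.continuous_fourierChar
    (innerSL ℝ).continuous₂ hf hφ
  simp only [flip_innerₗ, smul_eq_mul] at h
  exact h

theorem integral_Ioi_mul_exp {b : ℝ} (hb : 0 < b) :
    ∫ d in Ioi (0 : ℝ), d * Real.exp (-(b * d)) = 1 / b ^ 2 := by
  have h := Real.integral_rpow_mul_exp_neg_mul_Ioi (a := 2) two_pos hb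
  rw [Real.Gamma_two, mul_one] at h
  norm_num at h ⊢
  exact h

theorem integrableOn_Ioi_mul_exp {b : ℝ} (hb : 0 < b) :
    IntegrableOn (fun d : ℝ => d * Real.exp (-(b * d))) (Ioi 0) := by
  by_contra h
  have h1 := integral_Ioi_mul_exp hb
  -- The integral of a non-integrable function is 0 by convention, whereas the value just found is
  -- positive.
  rw [integral_undef h] at h1
  have : 0 < 1 / b ^ 2 := by positivity
  linarith

theorem norm_e_neg_sq_mul (τ : ℂ) (x : ℝ) :
    ‖e (-((x : ℂ) ^ 2 / 2 * τ))‖ = Real.exp (Real.pi * τ.im * x ^ 2) := by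
  have : -((x : ℂ) ^ 2 / 2 * τ) = ((-(x ^ 2 / 2) : ℝ) : ℂ) * τ := by push_cast; ring
  rw [this, norm_e_mul]
  congr 1
  ring

/-- The `n`-th term of the series for `g_τ^+`, up to the factor `1/(iη³)`. -/
noncomputable def gTerm (τ : ℂ) (n : ℤ) (x : ℝ) : ℂ :=
  e (-((x : ℂ) ^ 2 / 2 * τ)) * ((Real.sign x : ℂ) * ((cutoff n |x| : ℂ) * thetaCoeff τ n))

/-- The exponentials combine to exp(-πv(m² - x²)), and m² - x² ≥ m(m - |x|) when |x| < m. -/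
theorem norm_gTerm_le (τ : ℍ) (n : ℤ) (x : ℝ) (hx : |x| < n + 1 / 2) : ‖gTerm τ n x‖ ≤
    ((n + 1 / 2) - |x|) * Real.exp (-(Real.pi * τ.im * |(n : ℝ) + 1 / 2| * ((n + 1 / 2) - |x|))) := by
  have hm : 0 < (n : ℝ) + 1 / 2 := (abs_nonneg x).trans_lt hx
  rw [gTerm, norm_mul, norm_mul, norm_mul, norm_e_neg_sq_mul, norm_thetaCoeff, Complex.norm_real
    (cutoff n |x|), Real.norm_of_nonneg (cutoff_nonneg _ _), cutoff_eq hx.le, abs_of_pos hm,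
    UpperHalfPlane.coe_im]
  have h2 : Real.exp (Real.pi * τ.im * x ^ 2) *
      Real.exp (-Real.pi * τ.im * ((n : ℝ) + 1 / 2) ^ 2) ≤
      Real.exp (-(Real.pi * τ.im * ((n : ℝ) + 1 / 2) * ((n + 1 / 2) - |x|))) := by
    rw [← Real.exp_add]
    apply Real.exp_le_exp.2
    have hv : 0 ≤ Real.pi * τ.im := (mul_pos Real.pi_pos τ.im_pos).le
    rw [← sq_abs x]
    nlinarith [mul_nonneg hv (mul_nonneg (abs_nonneg x) (sub_pos.2 hx).le)]
  have h3 : 0 ≤ (n : ℝ) + 1 / 2 - |x| := (sub_pos.2 hx).le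
  calc _ ≤ Real.exp (Real.pi * τ.im * x ^ 2) * (1 * (((n : ℝ) + 1 / 2 - |x|) *
        Real.exp (-Real.pi * τ.im * ((n : ℝ) + 1 / 2) ^ 2))) := by
        gcongr
        exact norm_sign_le x
    _ = ((n : ℝ) + 1 / 2 - |x|) * (Real.exp (Real.pi * τ.im * x ^ 2) *
        Real.exp (-Real.pi * τ.im * ((n : ℝ) + 1 / 2) ^ 2)) := by ring
    _ ≤ _ := mul_le_mul_of_nonneg_left h2 h3

/-- The function `d ↦ d e^{-bd}` on the positive reals, extended by zero. -/
noncomputable def expTail (b d : ℝ) : ℝ := (Ioi (0 : ℝ)).indicator (fun d => d * Real.exp (-(b * d))) d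

theorem expTail_nonneg (b d : ℝ) : 0 ≤ expTail b d :=
  indicator_nonneg (fun d (hd : 0 < d) => mul_nonneg hd.le (Real.exp_pos _).le) d

/-- Adding the bounds for x = |x| and x = -|x| gives translates and reflections of one fixed
function, whose integrals are immediate. -/
theorem norm_gTerm_le_expTail (τ : ℍ) (n : ℤ) (x : ℝ) : ‖gTerm τ n x‖ ≤
    expTail (Real.pi * τ.im * |(n : ℝ) + 1 / 2|) ((n + 1 / 2) - x) +
    expTail (Real.pi * τ.im * |(n : ℝ) + 1 / 2|) ((n + 1 / 2) + x) := by
  by_cases hx : |x| < (n : ℝ) + 1 / 2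
  · have h1 := norm_gTerm_le τ n x hx
    have h2 : expTail (Real.pi * τ.im * |(n : ℝ) + 1 / 2|) ((n + 1 / 2) - |x|) =
      ((n + 1 / 2) - |x|) *
        Real.exp (-(Real.pi * τ.im * |(n : ℝ) + 1 / 2| * ((n + 1 / 2) - |x|))) := by
      rw [expTail, indicator_of_mem (mem_Ioi.2 (sub_pos.2 hx))]
    rw [← h2] at h1
    refine h1.trans ?_
    rcases abs_cases x with ⟨h, _⟩ | ⟨h, _⟩
    · rw [h]; linarith [expTail_nonneg (Real.pi * τ.im * |(n : ℝ) + 1 / 2|) ((n + 1 / 2) + x)]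
    · rw [h, sub_neg_eq_add]
      linarith [expTail_nonneg (Real.pi * τ.im * |(n : ℝ) + 1 / 2|) ((n + 1 / 2) - x)]
  · have h0 : gTerm τ n x = 0 := by
      rw [gTerm, cutoff_eq_zero (not_lt.1 hx)]; simp
    rw [h0, norm_zero]
    exact add_nonneg (expTail_nonneg _ _) (expTail_nonneg _ _)

theorem integrable_expTail {b : ℝ} (hb : 0 < b) : Integrable (expTail b) :=
  (integrableOn_Ioi_mul_exp hb).integrable_indicator measurableSet_Ioi

theorem integral_expTail {b : ℝ} (hb : 0 < b) : ∫ d, expTail b d = 1 / b ^ 2 := by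
  simp only [expTail]
  rw [integral_indicator measurableSet_Ioi, integral_Ioi_mul_exp hb]

theorem pi_mul_im_mul_abs_pos (τ : ℍ) (n : ℤ) : 0 < Real.pi * τ.im * |(n : ℝ) + 1 / 2| := by
  have h : (n : ℝ) + 1 / 2 ≠ 0 := by
    intro h
    have : (2 * n + 1 : ℝ) = 0 := by linarith
    have h2 : (2 * n + 1 : ℤ) = 0 := by exact_mod_cast this
    omega
  exact mul_pos (mul_pos Real.pi_pos τ.im_pos) (abs_pos.2 h)

theorem measurable_gTerm (τ : ℂ) (n : ℤ) : Measurable (gTerm τ n) := by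
  refine Measurable.mul ?_ (measurable_sign.mul ?_)
  · exact (continuous_e.comp (by fun_prop)).measurable
  · exact ((Complex.continuous_ofReal.comp ((continuous_cutoff n).comp continuous_abs)).mul
      continuous_const).measurable

theorem integrable_gTerm_bound (τ : ℍ) (n : ℤ) : Integrable fun x =>
    expTail (Real.pi * τ.im * |(n : ℝ) + 1 / 2|) ((n + 1 / 2) - x) +
    expTail (Real.pi * τ.im * |(n : ℝ) + 1 / 2|) ((n + 1 / 2) + x) :=
  ((integrable_expTail (pi_mul_im_mul_abs_pos τ n)).comp_sub_left _).add
    ((integrable_expTail (pi_mul_im_mul_abs_pos τ n)).comp_add_left _)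

theorem integrable_gTerm (τ : ℍ) (n : ℤ) : Integrable (gTerm τ n) :=
  (integrable_gTerm_bound τ n).mono' (measurable_gTerm τ n).aestronglyMeasurable
    (Eventually.of_forall (norm_gTerm_le_expTail τ n))

/-- The two tails integrate to 2/(πvm)², which is summable over half-integers m. -/
theorem summable_integral_norm_gTerm (τ : ℍ) : Summable fun n : ℤ => ∫ x, ‖gTerm τ n x‖ := by
  have hs := ((Real.summable_one_div_int_add_rpow (1 / 2) 2).2 one_lt_two).mul_left
    (2 / (Real.pi * τ.im) ^ 2)
  refine Summable.of_nonneg_of_le (fun n => integral_nonneg fun _ => norm_nonneg _) (fun n => ?_) hs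
  refine (integral_mono (integrable_gTerm τ n).norm (integrable_gTerm_bound τ n)
    (norm_gTerm_le_expTail τ n)).trans (le_of_eq ?_)
  have hb := pi_mul_im_mul_abs_pos τ n
  rw [integral_add ((integrable_expTail hb).comp_sub_left _)
    ((integrable_expTail hb).comp_add_left _), integral_sub_left_eq_self (expTail _),
    integral_add_left_eq_self (expTail _), integral_expTail hb, Real.rpow_two]
  rw [mul_pow]
  ring

theorem summable_norm_gTerm (τ : ℍ) (x : ℝ) : Summable fun n => ‖gTerm τ n x‖ := by
  simp only [gTerm]
  exact (((summable_kernelSum τ (abs_nonneg x)).mul_left _).mul_left _).norm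

theorem tsum_gTerm (τ : ℂ) (x : ℝ) : ∑' n, gTerm τ n x =
    e (-((x : ℂ) ^ 2 / 2 * τ)) * ((Real.sign x : ℂ) * kernelSum τ |x|) := by
  simp only [gTerm]
  rw [tsum_mul_left, tsum_mul_left, kernelSum]

theorem gPlus_eq_tsum (τ : ℍ) (x : ℝ) :
    gPlus τ x = (Complex.I * etaCubed τ)⁻¹ * ∑' n, gTerm τ n x := by
  rw [gPlus_eq, tsum_gTerm]; ring

theorem norm_gStar_le (τ : ℍ) (x : ℝ) : ‖gStar τ x‖ ≤ Real.exp (-(Real.pi * τ.im) * x ^ 2) := by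
  have hv := τ.im_pos
  rw [gStar, norm_mul, norm_mul, norm_e_neg_sq_mul, Complex.norm_real, norm_div,
    Real.norm_of_nonneg (erfc_nonneg _), UpperHalfPlane.coe_im]
  have h1 := erfc_le (x := Real.sqrt (2 * Real.pi * τ.im) * |x|) (by positivity)
  have h2 : (Real.sqrt (2 * Real.pi * τ.im) * |x|) ^ 2 = 2 * Real.pi * τ.im * x ^ 2 := by
    rw [mul_pow, Real.sq_sqrt (by positivity), sq_abs]
  rw [h2] at h1
  have h3 : ‖(Real.sign x : ℂ)‖ / ‖(2 : ℂ)‖ ≤ 1 := by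
    rw [Complex.norm_ofNat]
    linarith [norm_sign_le x]
  calc _ ≤ Real.exp (Real.pi * τ.im * x ^ 2) * 1 * Real.exp (-(2 * Real.pi * τ.im * x ^ 2)) := by
        gcongr
        exact erfc_nonneg _
    _ = _ := by rw [mul_one, ← Real.exp_add]; ring_nf

theorem measurable_gStar (τ : ℍ) : Measurable (gStar τ) := by
  unfold gStar
  refine Measurable.mul (Measurable.mul ?_ (measurable_sign.div_const _)) ?_
  · exact (continuous_e.comp (by fun_prop)).measurable
  · exact (Complex.continuous_ofReal.comp (continuous_erfc.comp
      (continuous_const.mul continuous_abs))).measurable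

theorem integrable_g (τ : ℍ) : Integrable (g τ) := by
  have h1 : Integrable (fun x => ∑' n, gTerm τ n x) := by
    refine integrable_of_norm_le_tsum (F := gTerm τ) ?_ (integrable_gTerm τ)
      (summable_integral_norm_gTerm τ) (summable_norm_gTerm τ) fun x =>
        norm_tsum_le_tsum_norm (summable_norm_gTerm τ x)
    simp only [tsum_gTerm]
    refine Measurable.aestronglyMeasurable (Measurable.mul ?_
      (measurable_sign.mul (continuous_kernelSum_abs τ).measurable))
    exact (continuous_e.comp (by fun_prop)).measurable
  have h2 : Integrable (gStar τ) :=
    (integrable_exp_neg_mul_sq (mul_pos Real.pi_pos τ.im_pos)).mono'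
      (measurable_gStar τ).aestronglyMeasurable (Eventually.of_forall (norm_gStar_le τ))
  refine ((h1.const_mul (Complex.I * etaCubed τ)⁻¹).sub h2).congr (Eventually.of_forall fun x => ?_)
  simp only [Pi.sub_apply, g, gPlus_eq_tsum]

end Fourier

/-! ### The Fourier transform of `g τ` -/

section FourierG

open MeasureTheory Filter Topology Set
open scoped FourierTransform

theorem norm_e_sq_mul (τ : ℂ) (x : ℝ) :
    ‖e ((x : ℂ) ^ 2 / 2 * τ)‖ = Real.exp (-(Real.pi * τ.im) * x ^ 2) := by
  have : (x : ℂ) ^ 2 / 2 * τ = ((x ^ 2 / 2 : ℝ) : ℂ) * τ := by push_cast; ring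
  rw [this, norm_e_mul]
  congr 1
  ring

theorem norm_e_mul_ofReal (x w : ℝ) : ‖e ((x : ℂ) * w)‖ = 1 := by
  rw [← Complex.ofReal_mul, norm_e_ofReal]

/-- The Gaussian `𝐞(x²τ/2 + xw)`. -/
noncomputable def gaussianPhase (τ : ℂ) (w x : ℝ) : ℂ := e ((x : ℂ) ^ 2 / 2 * τ) * e (x * w)

theorem continuous_gaussianPhase (τ : ℂ) (w : ℝ) : Continuous (gaussianPhase τ w) :=
  (continuous_e.comp (by fun_prop)).mul (continuous_e.comp (by fun_prop))

theorem norm_gaussianPhase (τ : ℂ) (w x : ℝ) :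
    ‖gaussianPhase τ w x‖ = Real.exp (-(Real.pi * τ.im) * x ^ 2) := by
  rw [gaussianPhase, norm_mul, norm_e_mul_ofReal, mul_one, norm_e_sq_mul]

theorem integrable_gaussianPhase {τ : ℂ} (hτ : 0 < τ.im) (w : ℝ) :
    Integrable (gaussianPhase τ w) :=
  (integrable_exp_neg_mul_sq (mul_pos Real.pi_pos hτ)).mono'
    (continuous_gaussianPhase τ w).aestronglyMeasurable
    (Eventually.of_forall fun x => (norm_gaussianPhase τ w x).le)

theorem fourier_gaussianPhase {τ : ℂ} (hτ : 0 < τ.im) (w x : ℝ) :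
    𝓕 (gaussianPhase (-1 / τ) w) x =
      (-Complex.I * τ) ^ (1 / 2 : ℂ) * e (((x : ℂ) - w) ^ 2 / 2 * τ) := by
  have hτ0 : τ ≠ 0 := by rintro rfl; simp at hτ
  have hI := Complex.I_ne_zero
  set b : ℂ := (-Complex.I * τ)⁻¹ with hb
  have hIτ : 0 < (-Complex.I * τ).re := by simpa using hτ
  have hbre : 0 < b.re := by
    rw [hb, Complex.inv_re]
    exact div_pos hIτ (Complex.normSq_pos.2 (mul_ne_zero (neg_ne_zero.2 hI) hτ0))
  have hfun : gaussianPhase (-1 / τ) w = fun x : ℝ =>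
      Complex.exp (-(Real.pi : ℂ) * b * (x : ℂ) ^ 2 + 2 * Real.pi * (Complex.I * w) * x) := by
    funext x
    rw [gaussianPhase, e, e, ← Complex.exp_add, hb]
    congr 1
    field_simp
    linear_combination -(x : ℂ) ^ 2 * Complex.I_sq
  rw [hfun, fourier_gaussian_pi' hbre]
  have hpow : 1 / b ^ (1 / 2 : ℂ) = (-Complex.I * τ) ^ (1 / 2 : ℂ) := by
    have harg : (-Complex.I * τ).arg ≠ Real.pi := by
      intro h
      rw [Complex.arg_eq_pi_iff] at h
      linarith [h.1]
    rw [hb, Complex.inv_cpow _ _ harg, one_div, inv_inv]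
  simp only [hpow]
  rw [e]
  congr 2
  rw [hb]
  have h1 : Complex.I * (Complex.I * w) = -w := by linear_combination (w : ℂ) * Complex.I_sq
  rw [h1, div_inv_eq_mul]
  ring

theorem g_mul_e (τ : ℍ) (x : ℝ) :
    g τ x * e ((x : ℂ) ^ 2 / 2 * τ) = (Real.sign x : ℂ) * profile τ |x| := by
  rw [g_eq, e_neg]
  field_simp [e_ne_zero]

theorem im_S_smul (τ : ℍ) : (ModularGroup.S • τ : ℍ).im = τ.im / Complex.normSq τ := by
  rw [← UpperHalfPlane.coe_im, coe_S_smul, neg_div, Complex.neg_im, one_div, Complex.inv_im]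
  rw [UpperHalfPlane.coe_im]
  ring

/-- Evaluate `integral_profile` at z = -wτ for τ and at z = w for -1/τ. The theta terms agree by
`oddTheta_S`, the Gaussian terms because Im(-1/τ) = v/|τ|². -/
theorem integral_profile_S (τ : ℍ) {w : ℝ} (hw : w ≠ 0) :
    (-Complex.I * τ) ^ (1 / 2 : ℂ) * e ((w : ℂ) ^ 2 / 2 * τ) *
        ∫ x : ℝ, (Real.sign x : ℂ) * profile τ |x| * e (x * (-(w * τ))) =
      Complex.I / (-Complex.I * τ) ^ (1 / 2 : ℂ) *
        ∫ x : ℝ, (Real.sign x : ℂ) * profile (ModularGroup.S • τ) |x| * e (x * w) := by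
  have hτ0 : (τ : ℂ) ≠ 0 := UpperHalfPlane.ne_zero τ
  have hwc : (w : ℂ) ≠ 0 := by exact_mod_cast hw
  have hη := etaCubed_ne_zero τ
  have hK := neg_I_mul_cpow_half_ne_zero τ.2
  have hK2 := cpow_half_sq (-Complex.I * (τ : ℂ))
  have hθ := oddTheta_S τ.2 (w * τ)
  rw [integral_profile τ (neg_ne_zero.2 (mul_ne_zero hwc hτ0)), integral_profile _ hwc,
    oddTheta_neg, etaCubed_S, coe_S_smul]
  have h1 : (w * τ : ℂ) / τ = w := by field_simp
  have h2 : (w * τ : ℂ) ^ 2 / (2 * τ) = (w : ℂ) ^ 2 / 2 * τ := by field_simp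
  rw [h1, h2] at hθ
  have hexp : e ((w : ℂ) ^ 2 / 2 * τ) * Complex.exp (-(Real.pi * (-(w * τ)) ^ 2 / (2 * τ.im))) =
      Complex.exp (-(Real.pi * (w : ℂ) ^ 2 / (2 * (ModularGroup.S • τ : ℍ).im))) := by
    have him : (τ.im : ℂ) ≠ 0 := by exact_mod_cast τ.im_ne_zero
    -- Writing the conjugate of τ as τ - 2iv makes the comparison of exponents a rational identity
    -- in τ and v.
    have hn : (Complex.normSq τ : ℂ) = ((τ : ℂ) - 2 * τ.im * Complex.I) * τ := by
      rw [Complex.normSq_eq_conj_mul_self]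
      congr 1
      apply Complex.ext <;> simp <;> ring
    have hc : (τ : ℂ) - 2 * τ.im * Complex.I ≠ 0 := by
      intro h
      rw [h, zero_mul] at hn
      exact hτ0 (Complex.normSq_eq_zero.1 (by exact_mod_cast hn))
    rw [e, ← Complex.exp_add, im_S_smul]
    congr 1
    push_cast
    rw [hn]
    field_simp
    ring
  rw [hθ, ← hexp]
  set K := (-Complex.I * (τ : ℂ)) ^ (1 / 2 : ℂ)
  set E := e ((w : ℂ) ^ 2 / 2 * τ)
  set θ := oddTheta τ (w * τ)
  set G := Complex.exp (-(Real.pi * (-(w * τ : ℂ)) ^ 2 / (2 * τ.im)))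
  have hpi : (Real.pi : ℂ) ≠ 0 := by exact_mod_cast Real.pi_ne_zero
  have hI := Complex.I_ne_zero
  -- With K the square root of -iτ, every quantity becomes rational in K.
  have hτK : (τ : ℂ) = Complex.I * K ^ 2 := by
    rw [hK2]; linear_combination (τ : ℂ) * Complex.I_sq
  clear_value K E θ G
  rw [hτK]
  field_simp
  have hI5 : Complex.I ^ 5 = Complex.I := by
    rw [show 5 = 4 + 1 from rfl, pow_add, Complex.I_pow_four]; simp
  ring_nf
  simp only [Complex.I_sq, Complex.I_pow_three]
  ring_nf
  rw [hI5]

/-- Continuity of the transform fills in the value at w = 0, which the transform formulas exclude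
because they divide by w; then Fourier inversion applies. -/
theorem eq_zero_of_fourier_eq_zero {U : ℝ → ℂ} (hc : Continuous U) (hi : Integrable U)
    (h : ∀ w : ℝ, w ≠ 0 → 𝓕 U w = 0) : U = 0 := by
  have h0 : 𝓕 U = fun _ => 0 := by
    refine (Continuous.ext_on (s := {0}ᶜ) (dense_compl_singleton 0) (continuous_fourier hi)
      continuous_const fun w hw => h w hw)
  have hinv := Continuous.fourierInv_fourier_eq hc hi (by rw [h0]; exact integrable_zero _ _ _)
  rw [← hinv, h0]
  funext x
  rw [Real.fourierInv_eq]
  simp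

/-- The unknown transform is tested against Gaussians. After multiplication by 𝐞(-ξ²/(2τ)), the
multiplication formula ∫ f̂φ = ∫ fφ̂ moves the transform onto the Gaussian, where it turns g into
sgn·W; `integral_profile_S` then shows that the difference `U` has vanishing transform off 0. -/
theorem fourier_g (τ : ℍ) (ξ : ℝ) :
    𝓕 (g τ) ξ = Complex.I / (-Complex.I * τ) ^ (1 / 2 : ℂ) * g (ModularGroup.S • τ) ξ := by
  set τ' : ℍ := ModularGroup.S • τ with hτ'
  have hτ'c : (τ' : ℂ) = -1 / τ := coe_S_smul τ
  set c : ℂ := Complex.I / (-Complex.I * τ) ^ (1 / 2 : ℂ)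
  set G : ℝ → ℂ := fun ξ => e ((ξ : ℂ) ^ 2 / 2 * τ')
  set U : ℝ → ℂ := fun ξ => 𝓕 (g τ) ξ * G ξ - c * ((Real.sign ξ : ℂ) * profile τ' |ξ|)
  have hcF := continuous_fourier (integrable_g τ)
  have hGc : Continuous G := continuous_e.comp (by fun_prop)
  have hcU : Continuous U :=
    (hcF.mul hGc).sub (continuous_const.mul (continuous_sign_mul_profile τ'))
  have hG : ∀ w, Integrable (gaussianPhase τ' w) := integrable_gaussianPhase τ'.2
  have hi1 : ∀ w, Integrable fun ξ => 𝓕 (g τ) ξ * gaussianPhase τ' w ξ := fun w =>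
    (hG w).bdd_mul hcF.aestronglyMeasurable (Eventually.of_forall (norm_fourier_le (g τ)))
  have hi2 : ∀ w : ℂ, Integrable fun ξ : ℝ =>
      c * ((Real.sign ξ : ℂ) * profile τ' |ξ| * e (ξ * w)) := fun w =>
    (integrable_profile τ' w).const_mul c
  have hUe : ∀ w ξ : ℝ, e (ξ * w) * U ξ = 𝓕 (g τ) ξ * gaussianPhase τ' w ξ -
      c * ((Real.sign ξ : ℂ) * profile τ' |ξ| * e (ξ * w)) := by
    intro w ξ
    simp only [U, G, gaussianPhase]
    ring
  have hiU : Integrable U := by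
    refine ((hi1 0).sub (hi2 ((0 : ℝ) : ℂ))).congr (Eventually.of_forall fun ξ => ?_)
    have := hUe 0 ξ
    simp only [Pi.sub_apply]
    rw [← this, Complex.ofReal_zero, mul_zero, e_zero, one_mul]
  have hU : U = 0 := by
    refine eq_zero_of_fourier_eq_zero hcU hiU fun w hw => ?_
    have hw' : -w ≠ 0 := neg_ne_zero.2 hw
    have h1 : 𝓕 U w = ∫ ξ : ℝ, e (ξ * (-w : ℝ)) * U ξ := by
      rw [fourier_eq_integral_e]
      refine integral_congr_ae (Eventually.of_forall fun ξ => ?_)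
      simp only
      congr 2
      push_cast
      ring
    rw [h1]
    simp only [hUe]
    rw [integral_sub (hi1 _) (hi2 _), integral_const_mul,
      integral_fourier_mul (integrable_g τ) (hG _), ← integral_profile_S τ hw', sub_eq_zero,
      ← integral_const_mul]
    refine integral_congr_ae (Eventually.of_forall fun x => ?_)
    simp only
    rw [hτ'c, fourier_gaussianPhase τ.2, ← g_mul_e τ x]
    have : (((x : ℂ) - ((-w : ℝ) : ℂ)) ^ 2 / 2 * τ) = ((-w : ℝ) : ℂ) ^ 2 / 2 * τ +
        ((x : ℂ) ^ 2 / 2 * τ + x * (-(((-w : ℝ) : ℂ) * τ))) := by ring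
    rw [this, e_add, e_add]
    ring
  have h := congrFun hU ξ
  simp only [U, Pi.zero_apply, sub_eq_zero, ← g_mul_e τ' ξ] at h
  exact mul_right_cancel₀ (e_ne_zero ((ξ : ℂ) ^ 2 / 2 * τ')) (by rw [h]; ring)

end FourierG

/-! ### Poisson summation with one-sided limits -/

section Poisson

open MeasureTheory Filter Topology Set
open scoped FourierTransform

/-- A window of length 2M splits into 2M unit intervals, and for each fixed position the unit
intervals tile the line. -/
theorem summable_integral_norm_int {f : ℝ → ℂ} (hf : Integrable f) (M : ℕ) :
    Summable fun n : ℤ => ∫ x in ((n : ℝ) - M)..((n : ℝ) + M), ‖f x‖ := by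
  have h : ∀ n : ℤ, ∑ k ∈ Finset.range (2 * M), ∫ x in ((-M + k : ℝ) + n)..((-M + k : ℝ) + n + 1), ‖f x‖
      = ∫ x in ((n : ℝ) - M)..((n : ℝ) + M), ‖f x‖ := by
    intro n
    have h1 := intervalIntegral.sum_integral_adjacent_intervals (f := fun x => ‖f x‖)
      (μ := volume) (a := fun k : ℕ => (-M + k : ℝ) + n) (n := 2 * M)
      fun k _ => hf.norm.intervalIntegrable
    push_cast at h1
    convert! h1 using 1
    · refine Finset.sum_congr rfl fun k _ => ?_
      congr 1
      ring
    · congr 1 <;> ring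
  simp only [← h]
  exact summable_sum fun k _ => (hf.norm.hasSum_intervalIntegral (-M + k : ℝ)).summable

theorem integrable_tsum_of_summable_integral_norm {μ : Measure ℝ} {F : ℤ → ℝ → ℂ}
    (hF : ∀ i, Integrable (F i) μ) (hs : Summable fun i => ∫ x, ‖F i x‖ ∂μ) :
    Integrable (fun x => ∑' i, F i x) μ := by
  have h3 : ∫⁻ x, ∑' i, ‖F i x‖ₑ ∂μ = ENNReal.ofReal (∑' i, ∫ x, ‖F i x‖ ∂μ) := by
    rw [lintegral_tsum fun i => (hF i).1.enorm,
      ENNReal.ofReal_tsum_of_nonneg (fun i => integral_nonneg fun _ => norm_nonneg _) hs]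
    exact tsum_congr fun i => (ofReal_integral_norm_eq_lintegral_enorm (hF i)).symm
  have hlt : ∫⁻ x, ∑' i, ‖F i x‖ₑ ∂μ < ⊤ := h3 ▸ ENNReal.ofReal_lt_top
  have hae : ∀ᵐ x ∂μ, Summable fun i => ‖F i x‖ := by
    filter_upwards [ae_lt_top' (AEMeasurable.tsum fun i => (hF i).1.enorm) hlt.ne] with x hx
    have := ENNReal.summable_toReal hx.ne
    simpa using this
  refine ⟨aestronglyMeasurable_of_tendsto_ae atTop
    (f := fun (s : Finset ℤ) x => ∑ i ∈ s, F i x) (fun s => ?_) ?_, ?_⟩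
  · exact Finset.aestronglyMeasurable_fun_sum s fun i _ => (hF i).1
  · filter_upwards [hae] with x hx
    exact hx.of_norm.hasSum
  · refine (lintegral_mono_ae ?_).trans_lt hlt
    filter_upwards [hae] with x hx
    have h2 : ∑' i, ‖F i x‖ₑ = ENNReal.ofReal (∑' i, ‖F i x‖) := by
      rw [ENNReal.ofReal_tsum_of_nonneg (fun i => norm_nonneg _) hx]
      exact tsum_congr fun i => (ofReal_norm _).symm
    rw [h2, ← ofReal_norm]
    exact ENNReal.ofReal_le_ofReal (norm_tsum_le_tsum_norm hx)

/-- The integral `∫₀ˢ f(x - t) dt`. -/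
noncomputable def leftIntegral (f : ℝ → ℂ) (s x : ℝ) : ℂ := ∫ t in (0 : ℝ)..s, f (x - t)

theorem leftIntegral_eq (f : ℝ → ℂ) (s x : ℝ) : leftIntegral f s x = ∫ u in (x - s)..x, f u := by
  rw [leftIntegral, intervalIntegral.integral_comp_sub_left, sub_zero]

theorem continuous_leftIntegral {f : ℝ → ℂ} (hf : Integrable f) (s : ℝ) :
    Continuous (leftIntegral f s) := by
  have hi : ∀ a b : ℝ, IntervalIntegrable f volume a b := fun _ _ => hf.intervalIntegrable
  have h : leftIntegral f s = fun x => (∫ u in (0 : ℝ)..x, f u) - ∫ u in (0 : ℝ)..(x - s), f u := by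
    funext x
    rw [leftIntegral_eq, intervalIntegral.integral_interval_sub_left (hi _ _) (hi _ _)]
  rw [h]
  have hc := intervalIntegral.continuous_primitive hi 0
  exact hc.sub (hc.comp (continuous_id.sub continuous_const))

/-- The averaged function is the convolution of f with the indicator of [0, s], so its transform is
a product; the proof is Fubini. -/
theorem fourier_leftIntegral {f : ℝ → ℂ} (hf : Integrable f) {s : ℝ} (hs : 0 ≤ s) (w : ℝ) :
    𝓕 (leftIntegral f s) w = (∫ t in (0 : ℝ)..s, e (-(t * w))) * 𝓕 f w := by
  have hfe : Integrable fun x : ℝ => e (-(x * w)) * f x :=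
    hf.bdd_mul (c := 1) (continuous_e.comp (by fun_prop)).aestronglyMeasurable
      (Eventually.of_forall fun x => by
        have := norm_e_mul_ofReal x (-w)
        push_cast at this
        rw [mul_neg] at this
        exact this.le)
  have hcs : Integrable (fun t : ℝ => e (-(t * w))) (volume.restrict (Ioc 0 s)) := by
    refine Continuous.integrableOn_Ioc ?_
    exact continuous_e.comp (by fun_prop)
  have hint := hcs.convolution_integrand (ContinuousLinearMap.mul ℂ ℂ) hfe
  rw [fourier_eq_integral_e]
  have h1 : ∀ x : ℝ, e (-(x * w)) * leftIntegral f s x =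
      ∫ t in Ioc 0 s, e (-(t * w)) * (e (-(((x - t : ℝ) : ℂ) * w)) * f (x - t)) := by
    intro x
    rw [leftIntegral, intervalIntegral.integral_of_le hs, ← integral_const_mul]
    refine integral_congr_ae (Eventually.of_forall fun t => ?_)
    simp only
    rw [← mul_assoc, ← e_add]
    congr 2
    push_cast
    ring
  simp only [h1]
  rw [integral_integral_swap hint, intervalIntegral.integral_of_le hs, ← integral_mul_const]
  refine integral_congr_ae (Eventually.of_forall fun t => ?_)
  simp only
  rw [integral_const_mul, integral_sub_right_eq_self fun x : ℝ => e (-(x * w)) * f x,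
    fourier_eq_integral_e]

/-- Integrating over [0, s] turns an integrable f into a continuous function whose suprema over
translates of a compact set are summable, so the classical Poisson formula applies. -/
theorem poisson_leftIntegral {f : ℝ → ℂ} (hf : Integrable f)
    (hsum : Summable fun n : ℤ => 𝓕 f n) {s : ℝ} (hs : 0 ≤ s) :
    ∑' n : ℤ, leftIntegral f s n =
      ∑' n : ℤ, (∫ t in (0 : ℝ)..s, e (-(t * ((n : ℝ) : ℂ)))) * 𝓕 f n := by
  have h := Real.tsum_eq_tsum_fourier (f := ⟨leftIntegral f s, continuous_leftIntegral hf s⟩)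
    (fun K => ?_) ?_ 0
  · simp only [ContinuousMap.coe_mk, zero_add, fourier_leftIntegral hf hs] at h
    rw [h]
    refine tsum_congr fun n => ?_
    simp
  · obtain ⟨R, hR⟩ := K.isCompact.isBounded.exists_norm_le
    obtain ⟨M, hM⟩ := exists_nat_ge (max R 0 + s)
    refine Summable.of_nonneg_of_le (fun n => norm_nonneg _) (fun n => ?_)
      (summable_integral_norm_int hf M)
    have hR0 := le_max_right R 0
    have hR1 := le_max_left R 0
    have hle : (n : ℝ) - M ≤ n + M := by linarith
    rw [ContinuousMap.norm_le _ (intervalIntegral.integral_nonneg hle fun _ _ => norm_nonneg _)]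
    rintro ⟨x, hx⟩
    have hx' := abs_le.1 (hR x hx)
    simp only [ContinuousMap.restrict_apply, ContinuousMap.comp_apply, ContinuousMap.coe_mk,
      ContinuousMap.coe_addRight, leftIntegral_eq]
    have hle2 : x + n - s ≤ x + n := by linarith
    refine (intervalIntegral.norm_integral_le_integral_norm hle2).trans ?_
    exact intervalIntegral.integral_mono_interval (by linarith [hx'.1]) hle2 (by linarith [hx'.2])
      (Eventually.of_forall fun _ => norm_nonneg _) hf.norm.intervalIntegrable
  · have hn : Summable fun n : ℤ => s * ‖𝓕 f n‖ := hsum.norm.mul_left s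
    refine hn.of_norm_bounded fun n => ?_
    simp only [ContinuousMap.coe_mk, fourier_leftIntegral hf hs, norm_mul]
    refine mul_le_mul_of_nonneg_right ?_ (norm_nonneg _)
    refine (intervalIntegral.norm_integral_le_of_norm_le_const (C := 1) fun t _ => ?_).trans ?_
    · have := norm_e_mul_ofReal t (-n)
      push_cast at this
      rw [mul_neg] at this
      simpa using this.le
    · rw [sub_zero, abs_of_nonneg hs, one_mul]

theorem tendsto_average {p : ℝ → ℂ} {L : ℂ} (hp : IntervalIntegrable p volume 0 1)
    (h : Tendsto p (𝓝[>] 0) (𝓝 L)) :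
    Tendsto (fun s : ℝ => (s : ℂ)⁻¹ * ∫ t in (0 : ℝ)..s, p t) (𝓝[>] 0) (𝓝 L) := by
  rw [Metric.tendsto_nhdsWithin_nhds] at h ⊢
  intro ε hε
  obtain ⟨δ, hδ, H⟩ := h (ε / 2) (half_pos hε)
  refine ⟨min δ 1, lt_min hδ one_pos, fun s hs hs1 => ?_⟩
  have hs0 : 0 < s := hs
  have hsc : (s : ℂ) ≠ 0 := by exact_mod_cast hs0.ne'
  rw [Real.dist_eq, sub_zero, abs_of_pos hs0] at hs1
  have hi : IntervalIntegrable p volume 0 s := hp.mono_set (by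
    rw [uIcc_of_le hs0.le, uIcc_of_le zero_le_one]
    exact Icc_subset_Icc_right (hs1.le.trans (min_le_right _ _)))
  have h1 : (s : ℂ)⁻¹ * (∫ t in (0 : ℝ)..s, p t) - L =
      (s : ℂ)⁻¹ * ∫ t in (0 : ℝ)..s, (p t - L) := by
    rw [intervalIntegral.integral_sub hi intervalIntegrable_const, intervalIntegral.integral_const,
      sub_zero, Complex.real_smul]
    field_simp
  rw [dist_eq_norm, h1, norm_mul, norm_inv, Complex.norm_real, Real.norm_of_nonneg hs0.le]
  have h2 : ‖∫ t in (0 : ℝ)..s, (p t - L)‖ ≤ ε / 2 * |s - 0| := by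
    refine intervalIntegral.norm_integral_le_of_norm_le_const fun t ht => ?_
    rw [uIoc_of_le hs0.le] at ht
    have := H (mem_Ioi.2 ht.1) (by
      rw [Real.dist_eq, sub_zero, abs_of_pos ht.1]
      exact ht.2.trans_lt (hs1.trans_le (min_le_left _ _)))
    rw [dist_eq_norm] at this
    exact this.le
  rw [sub_zero, abs_of_pos hs0] at h2
  calc _ ≤ s⁻¹ * (ε / 2 * s) := by gcongr
    _ = ε / 2 := by field_simp
    _ < ε := half_lt_self hε

/-- Poisson summation at a point where the periodization has a left limit. -/
theorem poisson_left {f : ℝ → ℂ} (hf : Integrable f)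
    (hsum : Summable fun n : ℤ => 𝓕 f n) {L : ℂ}
    (hL : Tendsto (fun t : ℝ => ∑' n : ℤ, f (n - t)) (𝓝[>] 0) (𝓝 L)) :
    L = ∑' n : ℤ, 𝓕 f n := by
  have hi : ∀ n : ℤ, Integrable (fun t => f (n - t)) (volume.restrict (Ioc (0 : ℝ) 1)) := fun n =>
    (hf.comp_sub_left n).integrableOn
  have hnorm : Summable fun n : ℤ => ∫ t in Ioc (0 : ℝ) 1, ‖f (n - t)‖ := by
    refine Summable.of_nonneg_of_le (fun n => integral_nonneg fun _ => norm_nonneg _) (fun n => ?_)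
      (summable_integral_norm_int hf 1)
    rw [← intervalIntegral.integral_of_le zero_le_one,
      intervalIntegral.integral_comp_sub_left (fun x => ‖f x‖), sub_zero]
    push_cast
    exact intervalIntegral.integral_mono_interval le_rfl (by linarith) (by linarith)
      (Eventually.of_forall fun _ => norm_nonneg _) hf.norm.intervalIntegrable
  have hp : IntervalIntegrable (fun t : ℝ => ∑' n : ℤ, f (n - t)) volume 0 1 := by
    rw [intervalIntegrable_iff_integrableOn_Ioc_of_le zero_le_one]
    exact integrable_tsum_of_summable_integral_norm hi hnorm
  have hav := tendsto_average hp hL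
  have hev : ∀ s ∈ Ioc (0 : ℝ) 1, ∫ t in (0 : ℝ)..s, ∑' n : ℤ, f (n - t) =
      ∑' n : ℤ, (∫ t in (0 : ℝ)..s, e (-(t * ((n : ℝ) : ℂ)))) * 𝓕 f n := by
    intro s hs
    rw [← poisson_leftIntegral hf hsum hs.1.le, intervalIntegral.integral_of_le hs.1.le]
    have hsub : Ioc (0 : ℝ) s ⊆ Ioc 0 1 := Ioc_subset_Ioc_right hs.2
    have h := hasSum_integral_of_summable_integral_norm (μ := volume.restrict (Ioc (0 : ℝ) s))
      (F := fun (n : ℤ) t => f (n - t))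
      (fun n => IntegrableOn.mono_set (hi n) hsub) (by
        refine Summable.of_nonneg_of_le (fun n => integral_nonneg fun _ => norm_nonneg _)
          (fun n => ?_) hnorm
        exact setIntegral_mono_set (hi n).norm (Eventually.of_forall fun _ => norm_nonneg _)
          hsub.eventuallyLE)
    rw [← h.tsum_eq]
    refine tsum_congr fun n => ?_
    rw [leftIntegral, intervalIntegral.integral_of_le hs.1.le]
  -- After division by s each multiplier has modulus at most 1 and tends to 1, so summability of the
  -- Fourier coefficients allows dominated convergence.
  have hF : Tendsto (fun s : ℝ => ∑' n : ℤ,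
      ((s : ℂ)⁻¹ * ∫ t in (0 : ℝ)..s, e (-(t * ((n : ℝ) : ℂ)))) * 𝓕 f n) (𝓝[>] 0)
      (𝓝 (∑' n : ℤ, 1 * 𝓕 f n)) := by
    refine tendsto_tsum_of_dominated_convergence hsum.norm (fun n => ?_) ?_
    · refine Tendsto.mul_const _ (tendsto_average ?_ ?_)
      · exact (continuous_e.comp (by fun_prop)).intervalIntegrable _ _
      · have hc : Continuous fun t : ℝ => e (-(t * ((n : ℝ) : ℂ))) :=
          continuous_e.comp (by fun_prop)
        have := hc.tendsto 0
        rw [Complex.ofReal_zero, zero_mul, neg_zero, e_zero] at this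
        exact this.mono_left nhdsWithin_le_nhds
    · filter_upwards [self_mem_nhdsWithin] with s hs n
      have hs0 : 0 < s := hs
      rw [norm_mul, norm_mul, norm_inv, Complex.norm_real, Real.norm_of_nonneg hs0.le]
      have h2 : ‖∫ t in (0 : ℝ)..s, e (-(t * ((n : ℝ) : ℂ)))‖ ≤ 1 * |s - 0| := by
        refine intervalIntegral.norm_integral_le_of_norm_le_const fun t _ => ?_
        have := norm_e_mul_ofReal t (-n)
        push_cast at this
        rw [mul_neg] at this
        simpa using this.le
      rw [sub_zero, abs_of_pos hs0, one_mul] at h2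
      have : s⁻¹ * ‖∫ t in (0 : ℝ)..s, e (-(t * ((n : ℝ) : ℂ)))‖ ≤ 1 := by
        calc _ ≤ s⁻¹ * s := by gcongr
          _ = 1 := inv_mul_cancel₀ hs0.ne'
      exact mul_le_of_le_one_left (norm_nonneg _) this
  simp only [one_mul] at hF
  refine tendsto_nhds_unique hav (hF.congr' ?_)
  filter_upwards [Ioc_mem_nhdsGT (zero_lt_one' ℝ)] with s hs
  rw [hev s hs, ← tsum_mul_left]
  refine tsum_congr fun n => ?_
  ring

end Poisson

/-! ### Sums of `g τ` over cosets and their left limits -/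

section Lattice

open Filter Topology Set

theorem summable_exp_neg_mul_abs {b : ℝ} (hb : 0 < b) (a : ℝ) :
    Summable fun n : ℤ => Real.exp (-(b * |n + a|)) := by
  have h0 : Summable fun n : ℕ => Real.exp (n * -b) := Real.summable_exp_nat_mul_iff.2 (by linarith)
  have h1 : Summable fun n : ℤ => Real.exp (-(b * |(n : ℝ)|)) := by
    refine Summable.of_nat_of_neg (h0.congr fun n => ?_) (h0.congr fun n => ?_)
    · simp; ring_nf
    · simp; ring_nf
  refine (h1.mul_left (Real.exp (b * |a|))).of_nonneg_of_le (fun n => (Real.exp_pos _).le)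
    fun n => ?_
  rw [← Real.exp_add]
  apply Real.exp_le_exp.2
  have h2 : |(n : ℝ)| ≤ |n + a| + |a| := by
    have := abs_sub (n + a) a
    rwa [add_sub_cancel_right] at this
  nlinarith

theorem summable_abs_mul_exp_neg_mul_abs {b : ℝ} (hb : 0 < b) (a : ℝ) :
    Summable fun n : ℤ => |n + a| * Real.exp (-(b * |n + a|)) := by
  refine ((summable_exp_neg_mul_abs (half_pos hb) a).mul_left (2 / b)).of_nonneg_of_le
    (fun n => by positivity) fun n => ?_
  set y := |(n : ℝ) + a|
  have h1 : b / 2 * y ≤ Real.exp (b / 2 * y) := by linarith [Real.add_one_le_exp (b / 2 * y)]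
  have h2 : Real.exp (-(b * y)) = Real.exp (-(b / 2 * y)) * Real.exp (-(b / 2 * y)) := by
    rw [← Real.exp_add]; ring_nf
  have h3 : Real.exp (b / 2 * y) * Real.exp (-(b / 2 * y)) = 1 := by
    rw [← Real.exp_add]; simp
  have h4 : y ≤ 2 / b * Real.exp (b / 2 * y) := by
    rw [div_mul_eq_mul_div, le_div_iff₀ hb]
    linarith
  calc _ ≤ 2 / b * Real.exp (b / 2 * y) * Real.exp (-(b * y)) := by gcongr
    _ = 2 / b * (Real.exp (b / 2 * y) * Real.exp (-(b / 2 * y))) * Real.exp (-(b / 2 * y)) := by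
      rw [h2]; ring
    _ = _ := by rw [h3, mul_one]

theorem summable_exp_neg_coset (N : ℕ) [NeZero N] {b : ℝ} (hb : 0 < b) (a : ℝ) :
    Summable fun n : ℤ => Real.exp (-(b * |(N : ℝ) * n + a|)) := by
  have hN : (0 : ℝ) < N := by exact_mod_cast NeZero.pos N
  refine (summable_exp_neg_mul_abs (mul_pos hb hN) (a / N)).congr fun n => ?_
  have : (N : ℝ) * n + a = N * (n + a / N) := by field_simp
  rw [this, abs_mul, abs_of_pos hN, mul_assoc]

/-- A constant in the estimate of the tails of the series for `g_τ^+`. -/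
noncomputable def tailConst (τ : ℍ) (δ : ℝ) : ℝ :=
  ∑' n : ℤ, |(n : ℝ) + 1 / 2| * Real.exp (-(Real.pi * τ.im * δ * |(n : ℝ) + 1 / 2|))

/-- If m ≥ y + δ then m² - y² ≥ δ(m + y). A uniform gap δ therefore gives exponential decay in m and
in y at the same time. -/
theorem norm_e_mul_tsum_le (τ : ℍ) {δ y x : ℝ} (hδ : 0 < δ) (hy : 0 ≤ y) (hx : |x| = y) {k : ℤ → ℝ}
    (hk0 : ∀ n, 0 ≤ k n) (hk1 : ∀ n, k n ≤ |(n : ℝ) + 1 / 2|)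
    (hk : ∀ n, k n ≠ 0 → y + δ ≤ n + 1 / 2) :
    ‖e (-((x : ℂ) ^ 2 / 2 * τ)) * ∑' n : ℤ, (k n : ℂ) * thetaCoeff τ n‖ ≤
      tailConst τ δ * Real.exp (-(Real.pi * τ.im * δ * y)) := by
  have hv : 0 < Real.pi * τ.im := mul_pos Real.pi_pos τ.im_pos
  have hs := (summable_abs_mul_exp_neg_mul_abs (mul_pos hv hδ) (1 / 2)).mul_right
    (Real.exp (-(Real.pi * τ.im * δ * y)))
  rw [← tsum_mul_left, tailConst, ← tsum_mul_right]
  refine tsum_of_norm_bounded hs.hasSum fun n => ?_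
  rw [norm_mul, norm_mul, norm_e_neg_sq_mul, norm_thetaCoeff, Complex.norm_real,
    Real.norm_of_nonneg (hk0 n), UpperHalfPlane.coe_im, ← sq_abs x, hx]
  by_cases h0 : k n = 0
  · rw [h0]
    simp only [zero_mul, mul_zero]
    positivity
  · have hm := hk n h0
    have hm0 : 0 < (n : ℝ) + 1 / 2 := by linarith
    have h1 : Real.exp (Real.pi * τ.im * y ^ 2) *
        Real.exp (-Real.pi * τ.im * ((n : ℝ) + 1 / 2) ^ 2) ≤
        Real.exp (-(Real.pi * τ.im * δ * |(n : ℝ) + 1 / 2|)) *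
          Real.exp (-(Real.pi * τ.im * δ * y)) := by
      rw [← Real.exp_add, ← Real.exp_add, abs_of_pos hm0]
      apply Real.exp_le_exp.2
      have : 0 ≤ ((n : ℝ) + 1 / 2 - y - δ) * ((n : ℝ) + 1 / 2 + y) := by
        apply mul_nonneg <;> linarith
      nlinarith [mul_nonneg hv.le this]
    calc _ = k n * (Real.exp (Real.pi * τ.im * y ^ 2) *
          Real.exp (-Real.pi * τ.im * ((n : ℝ) + 1 / 2) ^ 2)) := by ring
      _ ≤ |(n : ℝ) + 1 / 2| * (Real.exp (-(Real.pi * τ.im * δ * |(n : ℝ) + 1 / 2|)) *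
          Real.exp (-(Real.pi * τ.im * δ * y))) := by
        gcongr
        exact hk1 n
      _ = _ := by ring

theorem tailConst_nonneg (τ : ℍ) (δ : ℝ) : 0 ≤ tailConst τ δ :=
  tsum_nonneg fun n => by positivity

open Classical in
/-- The part of the series `kernelSum τ |r - ε|` with index different from `r`. -/
noncomputable def kernelRest (τ : ℂ) (r ε : ℝ) : ℂ :=
  ∑' n : ℤ, ((if (n : ℝ) + 1 / 2 = r then 0 else cutoff n |r - ε| : ℝ) : ℂ) * thetaCoeff τ n

/-- The part of `g_τ(r - ε)` which is dominated uniformly for small `ε ≥ 0`. -/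
noncomputable def gMain (τ : ℍ) (r ε : ℝ) : ℂ :=
  (Real.sign (r - ε) : ℂ) / (Complex.I * etaCubed τ) *
    (e (-(((r - ε : ℝ) : ℂ) ^ 2 / 2 * τ)) * kernelRest τ r ε) - gStar τ (r - ε)

theorem kernelSum_eq_kernelRest (τ : ℂ) {r : ℝ} (hr : ∀ n : ℤ, 0 ≤ n → (n : ℝ) + 1 / 2 ≠ r) (ε : ℝ) :
    kernelSum τ |r - ε| = kernelRest τ r ε := by
  refine tsum_congr fun n => ?_
  split_ifs with h
  · rw [cutoff_of_neg (lt_of_not_ge fun hn => hr n hn h) (abs_nonneg _)]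
  · rfl

theorem kernelSum_eq_kernelRest_add (τ : ℍ) (l : ℤ) (ε : ℝ) :
    kernelSum τ |(l : ℝ) + 1 / 2 - ε| = kernelRest τ ((l : ℝ) + 1 / 2) ε +
      (cutoff l |(l : ℝ) + 1 / 2 - ε| : ℂ) * thetaCoeff τ l := by
  classical
  rw [kernelSum, (summable_kernelSum τ (abs_nonneg _)).tsum_eq_add_tsum_ite l, add_comm, kernelRest]
  congr 1
  refine tsum_congr fun n => ?_
  by_cases h : n = l
  · simp [h]
  · have h' : ¬ ((n : ℝ) + 1 / 2 = l + 1 / 2) := by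
      intro h'
      exact h (by exact_mod_cast add_right_cancel h')
    rw [if_neg h, if_neg h']

theorem g_eq_gMain (τ : ℍ) {r : ℝ} (hr : ∀ n : ℤ, 0 ≤ n → (n : ℝ) + 1 / 2 ≠ r) (ε : ℝ) :
    g τ (r - ε) = gMain τ r ε := by
  rw [g, gPlus_eq, kernelSum_eq_kernelRest _ hr, gMain]
  ring

/-- Just left of m = l + 1/2, the tent of index m has height ε. The resulting term decays in l only
like exp(-2πvεl), not uniformly as ε → 0; it is the source of the anomaly under S and is kept apart.
-/
theorem g_eq_gMain_add (τ : ℍ) {l : ℤ} (hl : 0 ≤ l) {ε : ℝ} (hε : 0 ≤ ε) (hε1 : ε < 1 / 2) :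
    g τ ((l : ℝ) + 1 / 2 - ε) = gMain τ ((l : ℝ) + 1 / 2) ε +
      ε * e (-((ε : ℂ) ^ 2 / 2 * τ)) * e (((l : ℂ) + 1 / 2) * (ε * τ) + ((l : ℂ) + 1 / 2) / 2) /
        (Complex.I * etaCubed τ) := by
  have hl' : (0 : ℝ) ≤ l := by exact_mod_cast hl
  have hpos : 0 < (l : ℝ) + 1 / 2 - ε := by linarith
  have hc : cutoff l |(l : ℝ) + 1 / 2 - ε| = ε := by
    rw [abs_of_pos hpos, cutoff_eq (by linarith)]
    ring
  rw [g, gPlus_eq, kernelSum_eq_kernelRest_add, gMain, hc, Real.sign_of_pos hpos, thetaCoeff]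
  have h : e (-((((l : ℝ) + 1 / 2 - ε : ℝ) : ℂ) ^ 2 / 2 * τ)) *
      e (((l : ℂ) + 1 / 2) ^ 2 / 2 * τ + ((l : ℂ) + 1 / 2) / 2) =
      e (-((ε : ℂ) ^ 2 / 2 * τ)) * e (((l : ℂ) + 1 / 2) * (ε * τ) + ((l : ℂ) + 1 / 2) / 2) := by
    rw [← e_add, ← e_add]
    congr 1
    push_cast
    ring
  push_cast at h ⊢
  rw [mul_add (e _ * _), mul_assoc (ε : ℂ), ← h]
  ring

/-- Since N is even, half-integers lie in N⁻¹ℤ. For ε = 0 a contributing m therefore exceeds |r| by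
at least 1/N, and moving r by at most 1/(2N) leaves half of this gap. -/
theorem add_le_of_cutoff_ne_zero {N : ℕ} [NeZero N] (hN : Even N) {r ε : ℝ} (k : ℤ) (hr : r = k / N)
    (hε : 0 ≤ ε) (hε1 : ε ≤ 1 / (2 * N)) {n : ℤ} (hn : (n : ℝ) + 1 / 2 ≠ r)
    (hc : cutoff n |r - ε| ≠ 0) : |r - ε| + 1 / (2 * N) ≤ n + 1 / 2 := by
  have hN0 : (0 : ℝ) < N := by exact_mod_cast NeZero.pos N
  obtain ⟨M, hM⟩ := hN
  have hMr : (N : ℝ) = M + M := by exact_mod_cast hM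
  have hlt : |r - ε| < n + 1 / 2 := by
    by_contra h
    exact hc (cutoff_eq_zero (not_lt.1 h))
  set p : ℤ := (2 * n + 1) * M with hp
  have hm : (n : ℝ) + 1 / 2 = p / N := by
    rw [hp]; push_cast; rw [hMr]
    have : (M : ℝ) ≠ 0 := by intro h; rw [hMr, h] at hN0; norm_num at hN0
    field_simp
    ring
  have hδ : (1 : ℝ) / (2 * N) = (1 / 2) / N := by field_simp
  set t := ε * N with ht
  have hεt : ε = t / N := by rw [ht]; field_simp
  have ht0 : 0 ≤ t := by positivity
  have ht1 : t ≤ 1 / 2 := by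
    rw [hεt, hδ, div_le_div_iff_of_pos_right hN0] at hε1
    exact hε1
  rw [hm, hr] at hn
  have hpk : p ≠ k := fun h => hn (by rw [h])
  have habs : |r - ε| = |k - t| / N := by
    rw [hr, hεt, ← sub_div, abs_div, abs_of_pos hN0]
  rw [hm, habs] at hlt
  rw [hm, habs, hδ, ← add_div]
  rw [div_lt_div_iff_of_pos_right hN0] at hlt
  rw [div_le_div_iff_of_pos_right hN0]
  rcases lt_or_ge 0 k with hk | hk
  · have hk1 : (1 : ℝ) ≤ k := by exact_mod_cast hk
    rw [abs_of_pos (by linarith)] at hlt ⊢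
    have h1 : (k : ℝ) < p + 1 := by linarith
    have h2 : k < p + 1 := by exact_mod_cast h1
    have h3 : k + 1 ≤ p := by omega
    have h4 : (k : ℝ) + 1 ≤ p := by exact_mod_cast h3
    linarith
  · have hk1 : (k : ℝ) ≤ 0 := by exact_mod_cast hk
    rw [abs_of_nonpos (by linarith)] at hlt ⊢
    have h1 : -(k : ℝ) < p := by linarith
    have h2 : -k < p := by exact_mod_cast h1
    have h4 : -(k : ℝ) + 1 ≤ p := by exact_mod_cast h2
    linarith

theorem norm_gMain_le {N : ℕ} [NeZero N] (hN : Even N) (τ : ℍ) : ∃ C c : ℝ, 0 < c ∧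
    ∀ (r ε : ℝ) (k : ℤ), r = k / N → 0 ≤ ε → ε ≤ 1 / (2 * N) →
      ‖gMain τ r ε‖ ≤ C * Real.exp (-(c * |r|)) := by
  classical
  have hN1 : (1 : ℝ) ≤ N := by exact_mod_cast NeZero.one_le
  set δ : ℝ := 1 / (2 * N) with hδ
  have hδ0 : 0 < δ := by positivity
  have hδ1 : δ ≤ 1 := by
    rw [hδ, div_le_one (by positivity)]
    linarith
  have hv : 0 < Real.pi * τ.im := mul_pos Real.pi_pos τ.im_pos
  set c := Real.pi * τ.im * δ with hc
  have hc0 : 0 < c := mul_pos hv hδ0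
  set A := ‖Complex.I * etaCubed τ‖⁻¹ * tailConst τ δ + Real.exp (Real.pi * τ.im) with hA
  have hA0 : 0 ≤ A := by
    have := tailConst_nonneg τ δ
    positivity
  -- The factor e^c pays for replacing |r - ε| by |r|, as ε ≤ 1.
  refine ⟨A * Real.exp c, c, hc0, fun r ε k hr hε hε1 => ?_⟩
  have h1 := norm_e_mul_tsum_le τ (x := r - ε) (y := |r - ε|) hδ0 (abs_nonneg _) rfl
    (k := fun n : ℤ => if (n : ℝ) + 1 / 2 = r then 0 else cutoff n |r - ε|)
    (fun n => by split_ifs; exacts [le_rfl, cutoff_nonneg _ _])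
    (fun n => by split_ifs; exacts [abs_nonneg _, cutoff_le (abs_nonneg _)])
    (fun n hn => by
      have hne : (n : ℝ) + 1 / 2 ≠ r := fun h => hn (if_pos h)
      rw [if_neg hne] at hn
      exact add_le_of_cutoff_ne_zero hN k hr hε hε1 hne hn)
  have h2 : ‖gStar τ (r - ε)‖ ≤ Real.exp (Real.pi * τ.im) * Real.exp (-(c * |r - ε|)) := by
    refine (norm_gStar_le τ _).trans ?_
    rw [← Real.exp_add]
    apply Real.exp_le_exp.2
    rw [← sq_abs, hc]
    -- With y = |r - ε|, the bracket is y² + 1 - δy written as a sum of nonnegative terms, so the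
    -- Gaussian is at most e^{πv}·e^{-cy}.
    have h3 : 0 ≤ Real.pi * τ.im * ((|r - ε| - 1) ^ 2 + |r - ε| + (1 - δ) * |r - ε|) := by
      have := sub_nonneg.2 hδ1
      positivity
    nlinarith
  have h3 : ‖gMain τ r ε‖ ≤ A * Real.exp (-(c * |r - ε|)) := by
    rw [gMain]
    refine (norm_sub_le _ _).trans ?_
    rw [norm_mul, norm_div, hA, add_mul]
    refine add_le_add ?_ h2
    rw [div_eq_mul_inv, mul_assoc ‖Complex.I * etaCubed τ‖⁻¹]
    refine mul_le_mul ?_ h1 (norm_nonneg _) (by positivity)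
    exact mul_le_of_le_one_left (by positivity) (norm_sign_le _)
  refine h3.trans ?_
  rw [mul_assoc A, ← Real.exp_add]
  refine mul_le_mul_of_nonneg_left (Real.exp_le_exp.2 ?_) hA0
  have h4 : |r| ≤ |r - ε| + 1 := by
    have := abs_sub_abs_le_abs_sub r (r - ε)
    rw [sub_sub_cancel, abs_of_nonneg hε] at this
    linarith
  nlinarith

theorem gMain_zero (τ : ℍ) (r : ℝ) : gMain τ r 0 = g τ r := by
  by_cases h : ∀ n : ℤ, 0 ≤ n → (n : ℝ) + 1 / 2 ≠ r
  · rw [← g_eq_gMain τ h, sub_zero]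
  · push Not at h
    obtain ⟨l, hl, rfl⟩ := h
    have := g_eq_gMain_add τ hl le_rfl (by norm_num)
    simpa using this.symm

theorem tendsto_gMain (τ : ℍ) (r : ℝ) : Tendsto (gMain τ r) (𝓝[>] 0) (𝓝 (g τ r)) := by
  have hg : Tendsto (fun ε => g τ (r - ε)) (𝓝[>] 0) (𝓝 (g τ r)) := by
    have := ((continuous_g τ).comp (continuous_const.sub continuous_id)).tendsto (0 : ℝ) (f := fun ε => g τ (r - ε))
    simp only [sub_zero] at this
    exact this.mono_left nhdsWithin_le_nhds
  by_cases h : ∀ n : ℤ, 0 ≤ n → (n : ℝ) + 1 / 2 ≠ r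
  · exact hg.congr fun ε => g_eq_gMain τ h ε
  · push Not at h
    obtain ⟨l, hl, rfl⟩ := h
    have hj : Tendsto (fun ε : ℝ => (ε : ℂ) * e (-((ε : ℂ) ^ 2 / 2 * τ)) *
        e (((l : ℂ) + 1 / 2) * (ε * τ) + ((l : ℂ) + 1 / 2) / 2) / (Complex.I * etaCubed τ))
        (𝓝[>] 0) (𝓝 0) := by
      have hc : Continuous fun ε : ℝ => (ε : ℂ) * e (-((ε : ℂ) ^ 2 / 2 * τ)) *
          e (((l : ℂ) + 1 / 2) * (ε * τ) + ((l : ℂ) + 1 / 2) / 2) / (Complex.I * etaCubed τ) :=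
        ((Complex.continuous_ofReal.mul (continuous_e.comp (by fun_prop))).mul
          (continuous_e.comp (by fun_prop))).div_const _
      have := hc.tendsto 0
      simp only [Complex.ofReal_zero, zero_mul, zero_div] at this
      exact this.mono_left nhdsWithin_le_nhds
    have := hg.sub hj
    rw [sub_zero] at this
    refine this.congr' ?_
    filter_upwards [Ioo_mem_nhdsGT (by norm_num : (0 : ℝ) < 1 / 2)] with ε hε
    rw [g_eq_gMain_add τ hl hε.1.le hε.2]
    ring

theorem coset_eq_div (N : ℕ) [NeZero N] (h : Disc N) (n : ℤ) :
    (N : ℝ) * n + rep N h = ((N ^ 2 * n + h.val : ℤ) : ℝ) / N := by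
  have : (N : ℝ) ≠ 0 := Nat.cast_ne_zero.2 (NeZero.ne N)
  rw [rep]; push_cast; field_simp

theorem summable_g {N : ℕ} [NeZero N] (hN : Even N) (τ : ℍ) (h : Disc N) :
    Summable fun n : ℤ => g τ ((N : ℝ) * n + rep N h) := by
  obtain ⟨C, c, hc, H⟩ := norm_gMain_le hN τ
  refine ((summable_exp_neg_coset N hc (rep N h)).mul_left C).of_norm_bounded fun n => ?_
  rw [← gMain_zero]
  exact H _ 0 _ (coset_eq_div N h n) le_rfl (by positivity)

theorem tendsto_tsum_gMain {N : ℕ} [NeZero N] (hN : Even N) (τ : ℍ) (h : Disc N) :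
    Tendsto (fun ε => ∑' n : ℤ, gMain τ ((N : ℝ) * n + rep N h) ε) (𝓝[>] 0)
      (𝓝 (∑' n : ℤ, g τ ((N : ℝ) * n + rep N h))) := by
  obtain ⟨C, c, hc, H⟩ := norm_gMain_le hN τ
  have hN0 : (0 : ℝ) < N := by exact_mod_cast NeZero.pos N
  refine tendsto_tsum_of_dominated_convergence
    ((summable_exp_neg_coset N hc (rep N h)).mul_left C) (fun n => tendsto_gMain τ _) ?_
  filter_upwards [Ioo_mem_nhdsGT (by positivity : (0 : ℝ) < 1 / (2 * N))] with ε hε n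
  exact H _ ε _ (coset_eq_div N h n) hε.1.le hε.2.le

theorem summable_gMain {N : ℕ} [NeZero N] (hN : Even N) (τ : ℍ) (h : Disc N) {ε : ℝ} (hε : 0 ≤ ε)
    (hε1 : ε ≤ 1 / (2 * N)) : Summable fun n : ℤ => gMain τ ((N : ℝ) * n + rep N h) ε := by
  obtain ⟨C, c, hc, H⟩ := norm_gMain_le hN τ
  exact ((summable_exp_neg_coset N hc (rep N h)).mul_left C).of_norm_bounded fun n =>
    H _ ε _ (coset_eq_div N h n) hε hε1

theorem rep_nonneg (N : ℕ) (h : Disc N) : 0 ≤ rep N h := by rw [rep]; positivity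

theorem rep_lt (N : ℕ) [NeZero N] (h : Disc N) : rep N h < N := by
  have hN : (0 : ℝ) < N := by exact_mod_cast NeZero.pos N
  rw [rep, div_lt_iff₀ hN, ← sq]
  exact_mod_cast ZMod.val_lt h

-- On a half-integral coset the exceptional terms at the points with n ≥ 0 form a geometric
-- progression with sum εA(ε)/(1 - 𝐞(εNτ)). As ε → 0 this tends to -A(0)/(2πiNτ), although each term
-- tends to 0. The remaining part is dominated uniformly in ε.
open Classical in
theorem tendsto_tsum_g_left {N : ℕ} [NeZero N] (hN : Even N) (τ : ℍ) (h : Disc N) :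
    Tendsto (fun ε => ∑' n : ℤ, g τ ((N : ℝ) * n + rep N h - ε)) (𝓝[>] 0)
      (𝓝 ((∑' n : ℤ, g τ ((N : ℝ) * n + rep N h)) - if IsHalfIntegral N h then
        e ((rep N h : ℂ) / 2) / (Complex.I * etaCubed τ * (2 * Real.pi * Complex.I * N * τ))
          else 0)) := by
  have hN0 : (0 : ℝ) < N := by exact_mod_cast NeZero.pos N
  have hN0' : (0 : ℤ) < N := by exact_mod_cast NeZero.pos N
  split_ifs with hh
  · obtain ⟨l, hl⟩ := hh
    have hl0 : 0 ≤ l := by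
      have h1 := rep_nonneg N h
      rw [hl] at h1
      have : (-1 : ℝ) < l := by linarith
      have : -1 < l := by exact_mod_cast this
      omega
    -- This makes Nn + l negative for n < 0: negative half-integers carry no exceptional term, since
    -- moving left increases |x|.
    have hlN : l < N := by
      have h1 := rep_lt N h
      rw [hl] at h1
      have : (l : ℝ) < N := by linarith
      exact_mod_cast this
    set A : ℝ → ℂ := fun ε => e (-((ε : ℂ) ^ 2 / 2 * τ)) *
      e (((l : ℂ) + 1 / 2) * (ε * τ) + ((l : ℂ) + 1 / 2) / 2) / (Complex.I * etaCubed τ) with hA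
    have hterm : ∀ ε ∈ Ioo (0 : ℝ) (1 / 2), ∀ n : ℤ, g τ ((N : ℝ) * n + rep N h - ε) =
        gMain τ ((N : ℝ) * n + rep N h) ε +
          if 0 ≤ n then ε * A ε * e (ε * (N * τ)) ^ n.toNat else 0 := by
      intro ε hε n
      have hr : (N : ℝ) * n + rep N h = ((N * n + l : ℤ) : ℝ) + 1 / 2 := by
        rw [hl]; push_cast; ring
      rw [hr]
      split_ifs with hn
      · rw [g_eq_gMain_add τ (by positivity) hε.1.le hε.2]
        congr 1
        lift n to ℕ using hn
        -- Evenness of N gives 𝐞(Nn/2) = 1, so the phase is constant along the coset and the ratio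
        -- is 𝐞(εNτ).
        obtain ⟨M, hM⟩ := hN
        have h2 : e ((((N * n + l : ℤ) : ℂ) + 1 / 2) * (ε * τ) +
            (((N * n + l : ℤ) : ℂ) + 1 / 2) / 2) =
            e (((l : ℂ) + 1 / 2) * (ε * τ) + ((l : ℂ) + 1 / 2) / 2) * e (ε * (N * τ)) ^ n := by
          rw [← e_nat_mul, ← e_add, ← e_add_int _ (-(M * n))]
          congr 1
          have : (N : ℂ) = M + M := by exact_mod_cast hM
          push_cast
          rw [this]
          ring
        simp only [Int.toNat_natCast] at h2 ⊢
        rw [h2, hA]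
        ring
      · rw [add_zero]
        refine g_eq_gMain τ (fun k hk hk' => ?_) ε
        have h3 : k = N * n + l := by
          have := add_right_cancel hk'
          exact_mod_cast this
        have : n ≤ -1 := by omega
        nlinarith
    have hq : ∀ ε ∈ Ioo (0 : ℝ) (1 / 2), ‖e (ε * (N * τ))‖ < 1 := by
      intro ε hε
      rw [norm_e_mul, Real.exp_lt_one_iff]
      have : ((N : ℂ) * τ).im = N * τ.im := by
        rw [← Complex.ofReal_natCast, Complex.im_ofReal_mul]; rfl
      rw [this]
      have := τ.im_pos
      have := Real.pi_pos
      have := hε.1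
      have : 0 < 2 * Real.pi * ε * (N * τ.im) := by positivity
      linarith
    have hjump : ∀ ε ∈ Ioo (0 : ℝ) (1 / 2), HasSum (fun n : ℤ =>
        if 0 ≤ n then ε * A ε * e (ε * (N * τ)) ^ n.toNat else 0)
        (ε * A ε * (1 - e (ε * (N * τ)))⁻¹) := by
      intro ε hε
      have h1 := (hasSum_geometric_of_norm_lt_one (hq ε hε)).mul_left (ε * A ε)
      refine (Function.Injective.hasSum_iff (Nat.cast_injective (R := ℤ)) fun n hn => ?_).1
        (h1.congr_fun fun n => ?_)
      · rw [if_neg]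
        rintro h0
        lift n to ℕ using h0
        exact hn (mem_range_self n)
      · simp
    have hlim : Tendsto (fun ε : ℝ => ε * A ε * (1 - e (ε * (N * τ)))⁻¹) (𝓝[>] 0)
        (𝓝 (-(A 0 * (2 * Real.pi * Complex.I * (N * τ))⁻¹))) := by
      -- The quotient ε/(𝐞(εNτ) - 1) tends to the reciprocal of the derivative of 𝐞(εNτ) at ε = 0.
      have hd := hasDerivAt_e_mul ((N : ℂ) * τ) 0
      rw [hasDerivAt_iff_tendsto_slope_zero] at hd
      simp only [zero_add, Complex.ofReal_zero, zero_mul, e_zero, mul_one] at hd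
      have hne : 2 * Real.pi * Complex.I * (N * τ) ≠ 0 := by
        refine mul_ne_zero Complex.two_pi_I_ne_zero (mul_ne_zero ?_ (UpperHalfPlane.ne_zero τ))
        exact_mod_cast hN0.ne'
      have hd2 := (hd.mono_left (nhdsWithin_mono 0 (fun x (hx : 0 < x) => hx.ne'))).inv₀ hne
      have hAc : Tendsto A (𝓝[>] 0) (𝓝 (A 0)) := by
        have : Continuous A := (((continuous_e.comp (by fun_prop))).mul
          (continuous_e.comp (by fun_prop))).div_const _
        exact (this.tendsto 0).mono_left nhdsWithin_le_nhds
      refine ((hAc.mul hd2).neg).congr fun ε => ?_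
      rw [Complex.real_smul, mul_inv, Complex.ofReal_inv, inv_inv, ← neg_sub (e (ε * (N * τ))),
        inv_neg]
      ring
    have hA0 : A 0 * (2 * Real.pi * Complex.I * (N * τ))⁻¹ = e ((rep N h : ℂ) / 2) /
        (Complex.I * etaCubed τ * (2 * Real.pi * Complex.I * N * τ)) := by
      rw [hA, hl]
      simp only [Complex.ofReal_zero]
      push_cast
      simp only [ne_eq, OfNat.ofNat_ne_zero, not_false_eq_true, zero_pow, zero_div, zero_mul,
        neg_zero, e_zero, mul_zero, zero_add, one_mul]
      rw [← mul_assoc (2 * (Real.pi : ℂ) * Complex.I), div_eq_mul_inv, div_eq_mul_inv,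
        div_eq_mul_inv (e _)]
      simp only [mul_inv]
      ring
    rw [← hA0, sub_eq_add_neg]
    refine ((tendsto_tsum_gMain hN τ h).add hlim).congr' ?_
    have hpos : 0 < min (1 / 2 : ℝ) (1 / (2 * N)) := by positivity
    filter_upwards [Ioo_mem_nhdsGT hpos] with ε hε
    have hε1 : ε ∈ Ioo (0 : ℝ) (1 / 2) := ⟨hε.1, hε.2.trans_le (min_le_left _ _)⟩
    simp only [hterm ε hε1]
    rw [(summable_gMain hN τ h hε.1.le (hε.2.le.trans (min_le_right _ _))).tsum_add
      (hjump ε hε1).summable, (hjump ε hε1).tsum_eq]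
  · rw [sub_zero]
    refine (tendsto_tsum_gMain hN τ h).congr fun ε => tsum_congr fun n => ?_
    refine (g_eq_gMain τ (fun k _ hk => hh ⟨k - N * n, ?_⟩) ε).symm
    push_cast
    linarith

end Lattice

/-! ### Transformation of the completed theta function under `Mp2Z` -/

section Modularity

open MeasureTheory Filter Topology Set
open scoped FourierTransform

theorem coe_T_smul (τ : ℍ) : ((ModularGroup.T • τ : ℍ) : ℂ) = τ + 1 := by
  rw [coe_smul_eq]
  simp [autFactor, ModularGroup.T]

theorem E2_S (τ : ℍ) : EisensteinSeries.E2 (ModularGroup.S • τ) =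
    τ ^ 2 * EisensteinSeries.E2 τ + 6 * τ / (Real.pi * Complex.I) := by
  have h := congrFun (EisensteinSeries.E2_slash_action ModularGroup.S) τ
  have hτ := UpperHalfPlane.ne_zero τ
  have hpi : (Real.pi : ℂ) ≠ 0 := by exact_mod_cast Real.pi_ne_zero
  rw [ModularForm.SL_slash_apply, Pi.sub_apply, Pi.smul_apply, EisensteinSeries.D2_S,
    riemannZeta_two, ModularGroup.denom_S, zpow_neg, ← div_eq_mul_inv,
    div_eq_iff (zpow_ne_zero _ hτ)] at h
  rw [h, smul_eq_mul]
  have hI := Complex.I_ne_zero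
  rw [show ((2 : ℤ)) = ((2 : ℕ) : ℤ) from rfl, zpow_natCast]
  field_simp
  linear_combination (-6 : ℂ) * Complex.I_sq

theorem E2_T (τ : ℍ) : EisensteinSeries.E2 (ModularGroup.T • τ) = EisensteinSeries.E2 τ := by
  have h := congrFun (EisensteinSeries.E2_slash_action ModularGroup.T) τ
  rw [ModularForm.SL_slash_apply, Pi.sub_apply, Pi.smul_apply, EisensteinSeries.D2_T] at h
  have hd : UpperHalfPlane.denom (ModularGroup.T : GL (Fin 2) ℝ) τ = 1 := by
    rw [ModularGroup.denom_apply]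
    simp [ModularGroup.T]
  rwa [hd, one_zpow, mul_one, Pi.zero_apply, smul_zero, sub_zero] at h

theorem g_T (τ : ℍ) (x : ℝ) : g (ModularGroup.T • τ) x = e (-((x : ℂ) ^ 2 / 2)) * g τ x := by
  have him : (ModularGroup.T • τ : ℍ).im = τ.im := by
    rw [← UpperHalfPlane.coe_im, coe_T_smul]; simp
  have hk : kernelSum ((ModularGroup.T • τ : ℍ) : ℂ) |x| = e (1 / 8) * kernelSum τ |x| := by
    rw [coe_T_smul, kernelSum, kernelSum, ← tsum_mul_left]
    refine tsum_congr fun n => ?_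
    have : thetaCoeff ((τ : ℂ) + 1) n = e (1 / 8) * thetaCoeff τ n := by
      obtain ⟨k, hk⟩ := Int.even_mul_succ_self n
      rw [thetaCoeff, thetaCoeff, ← e_add, ← e_add_int (1 / 8 + _) k]
      congr 1
      have : (n : ℂ) * (n + 1) = k + k := by exact_mod_cast hk
      linear_combination (1 / 2 : ℂ) * this
    rw [this]
    ring
  have hη := etaCubed_ne_zero τ
  have h8 := e_ne_zero (1 / 8)
  have hp : profile (ModularGroup.T • τ) |x| = profile τ |x| := by
    rw [profile, profile, hk, him, etaCubed_T]
    congr 1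
    field_simp
  rw [g_eq, g_eq, hp, coe_T_smul, ← mul_assoc, ← mul_assoc, ← mul_assoc, ← e_add]
  congr 3
  ring

theorem thetaTilde_T {N : ℕ} [NeZero N] (hN : Even N) (τ : ℍ) (h : Disc N) :
    thetaTilde N (ModularGroup.T • τ) h = e (-((rep N h : ℂ) ^ 2 / 2)) * thetaTilde N τ h := by
  rw [thetaTilde, thetaTilde, mul_add, ← tsum_mul_left]
  congr 1
  · split_ifs with hh
    · obtain ⟨l, hl⟩ := hh
      -- For h = l + 1/2, h²/2 = 1/8 + l(l+1)/2, so the multiplier of 1/η³ is the required one.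
      have h8 : e (1 / 8) * e (-((rep N h : ℂ) ^ 2 / 2)) = 1 := by
        obtain ⟨k, hk⟩ := Int.even_mul_succ_self l
        have : (l : ℂ) * (l + 1) = k + k := by exact_mod_cast hk
        rw [← e_add, hl]
        refine Eq.trans ?_ (e_int (-k))
        congr 1
        push_cast
        linear_combination (-1 / 2 : ℂ) * this
      rw [E2_T, etaCubed_T]
      have hη := etaCubed_ne_zero τ
      have h8' := e_ne_zero (1 / 8)
      have hN0 : (N : ℂ) ≠ 0 := Nat.cast_ne_zero.2 (NeZero.ne N)
      have hI := Complex.I_ne_zero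
      field_simp
      linear_combination -(e ((rep N h : ℂ) / 2) * EisensteinSeries.E2 τ) * h8
    · rw [mul_zero]
  · refine tsum_congr fun n => ?_
    rw [g_T]
    congr 1
    obtain ⟨M, hM⟩ := hN
    have hMc : (N : ℂ) = M + M := by exact_mod_cast hM
    have hN0 : (N : ℂ) ≠ 0 := Nat.cast_ne_zero.2 (NeZero.ne N)
    have hr : (N : ℂ) * rep N h = h.val := by
      rw [rep]; push_cast; field_simp
    rw [← e_add_int (-((rep N h : ℂ) ^ 2 / 2)) (-(M * N * n ^ 2 + n * h.val))]
    congr 1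
    push_cast
    rw [← hr]
    have : (N : ℂ) ^ 2 = 2 * M * N := by rw [sq]; nth_rewrite 1 [hMc]; ring
    linear_combination -(n : ℂ) ^ 2 / 2 * this

theorem fourier_g_coset (N : ℕ) [NeZero N] (τ : ℍ) (r : ℝ) (n : ℤ) :
    𝓕 (fun x => g τ (N * x + r)) n = Complex.I / (N * (-Complex.I * τ) ^ (1 / 2 : ℂ)) *
      (e ((n / N : ℝ) * r) * g (ModularGroup.S • τ) (n / N)) := by
  have hN0 : (0 : ℝ) < N := by exact_mod_cast NeZero.pos N
  have hNc : (N : ℂ) ≠ 0 := Nat.cast_ne_zero.2 (NeZero.ne N)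
  have h1 : ∀ x : ℝ, e (-(x * ((n : ℝ) : ℂ))) * g τ (N * x + r) =
      e ((n / N : ℝ) * r) *
        (fun y : ℝ => e (-(((y + r : ℝ) : ℂ) * ((n / N : ℝ) : ℂ))) * g τ (y + r)) (N * x) := by
    intro x
    simp only
    rw [← mul_assoc, ← e_add]
    congr 2
    push_cast
    field_simp
    ring
  rw [fourier_eq_integral_e]
  rw [integral_congr_ae (Eventually.of_forall h1), integral_const_mul,
    Measure.integral_comp_mul_left
      (fun y : ℝ => e (-(((y + r : ℝ) : ℂ) * ((n / N : ℝ) : ℂ))) * g τ (y + r)),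
    integral_add_right_eq_self fun y : ℝ => e (-((y : ℂ) * ((n / N : ℝ) : ℂ))) * g τ y,
    ← fourier_eq_integral_e, fourier_g, abs_of_pos (inv_pos.2 hN0), Complex.real_smul]
  have hK := neg_I_mul_cpow_half_ne_zero τ.2
  push_cast
  field_simp

theorem summable_g_lattice {N : ℕ} [NeZero N] (hN : Even N) (τ : ℍ) (r : ℝ) :
    Summable fun n : ℤ => e ((n / N : ℝ) * r) * g τ (n / N) := by
  obtain ⟨C, c, hc, H⟩ := norm_gMain_le hN τ
  have hN0 : (0 : ℝ) < N := by exact_mod_cast NeZero.pos N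
  refine ((summable_exp_neg_mul_abs (div_pos hc hN0) 0).mul_left C).of_norm_bounded fun n => ?_
  rw [norm_mul, norm_e_mul_ofReal, one_mul, ← gMain_zero]
  refine (H _ 0 n rfl le_rfl (by positivity)).trans (le_of_eq ?_)
  rw [add_zero, abs_div, abs_of_pos hN0]
  congr 3
  ring

/-- N⁻¹ℤ is the disjoint union of the cosets of Nℤ, and 𝐞(rh) depends only on the coset of r because
Nh is an integer. -/
theorem tsum_g_lattice {N : ℕ} [NeZero N] (hN : Even N) (τ : ℍ) (h : Disc N) :
    ∑' n : ℤ, e ((n / N : ℝ) * rep N h) * g τ (n / N) =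
      ∑ j : Disc N, e (rep N h * rep N j) * ∑' n : ℤ, g τ (N * n + rep N j) := by
  have hN0 : (N : ℝ) ≠ 0 := Nat.cast_ne_zero.2 (NeZero.ne N)
  have hNc : (N : ℂ) ≠ 0 := Nat.cast_ne_zero.2 (NeZero.ne N)
  have hs := summable_g_lattice hN τ (rep N h)
  obtain ⟨E, hE⟩ : ∃ E : Disc N × ℤ ≃ ℤ, ∀ j n, E (j, n) = n * ((N ^ 2 : ℕ) : ℤ) + (j.val : ℤ) :=
    ⟨(Equiv.prodComm (Disc N) ℤ).trans (discEquiv N).symm, fun _ _ => rfl⟩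
  have hterm : ∀ (j : Disc N) (n : ℤ), e (((E (j, n) : ℤ) / N : ℝ) * rep N h) *
      g τ ((E (j, n) : ℤ) / N) = e (rep N h * rep N j) * g τ (N * n + rep N j) := by
    intro j n
    have h1 : ((E (j, n) : ℤ) : ℝ) / N = N * n + rep N j := by
      rw [hE, rep]; push_cast; field_simp
    rw [h1]
    congr 1
    have hr : (N : ℂ) * rep N h = h.val := by
      rw [rep]; push_cast; field_simp
    rw [← e_add_int (rep N h * rep N j) (n * h.val)]
    congr 1
    push_cast
    linear_combination (n : ℂ) * hr
  have hs' : Summable fun p : Disc N × ℤ => e (((E p : ℤ) / N : ℝ) * rep N h) *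
      g τ ((E p : ℤ) / N) := E.summable_iff.2 hs
  rw [← E.tsum_eq, hs'.tsum_prod', tsum_fintype]
  · refine Finset.sum_congr rfl fun j _ => ?_
    simp only [hterm]
    rw [tsum_mul_left]
  · intro j
    simp only [hterm]
    exact (summable_g hN τ j).mul_left _

-- Poisson summation for x ↦ g(Nx + h): the left side is the left limit of the periodization, and
-- the Fourier coefficients are values of g at -1/τ on N⁻¹ℤ.
open Classical in
theorem tsum_g_S {N : ℕ} [NeZero N] (hN : Even N) (τ : ℍ) (h : Disc N) :
    (∑' n : ℤ, g τ ((N : ℝ) * n + rep N h)) - (if IsHalfIntegral N h then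
        e ((rep N h : ℂ) / 2) / (Complex.I * etaCubed τ * (2 * Real.pi * Complex.I * N * τ))
          else 0) = Complex.I / (N * (-Complex.I * τ) ^ (1 / 2 : ℂ)) *
      ∑ j : Disc N, e (rep N h * rep N j) *
        ∑' n : ℤ, g (ModularGroup.S • τ) (N * n + rep N j) := by
  have hN0 : (0 : ℝ) < N := by exact_mod_cast NeZero.pos N
  have hi : Integrable fun x => g τ (N * x + rep N h) :=
    ((integrable_g τ).comp_add_right (rep N h)).comp_mul_left' hN0.ne'
  have hlim : Tendsto (fun t : ℝ => ∑' n : ℤ, g τ (N * ((n : ℝ) - t) + rep N h)) (𝓝[>] 0)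
      (𝓝 ((∑' n : ℤ, g τ ((N : ℝ) * n + rep N h)) - (if IsHalfIntegral N h then
        e ((rep N h : ℂ) / 2) / (Complex.I * etaCubed τ * (2 * Real.pi * Complex.I * N * τ))
          else 0))) := by
    have h1 : Tendsto (fun t : ℝ => N * t) (𝓝[>] 0) (𝓝[>] 0) := by
      refine tendsto_nhdsWithin_iff.2 ⟨?_, ?_⟩
      · have : Continuous fun t : ℝ => N * t := by fun_prop
        have := this.tendsto 0
        rw [mul_zero] at this
        exact this.mono_left nhdsWithin_le_nhds
      · filter_upwards [self_mem_nhdsWithin] with t ht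
        exact mul_pos hN0 ht
    refine ((tendsto_tsum_g_left hN τ h).comp h1).congr fun t => tsum_congr fun n => ?_
    congr 1
    ring
  have hs : Summable fun n : ℤ => 𝓕 (fun x => g τ (N * x + rep N h)) n := by
    simp only [fourier_g_coset]
    exact (summable_g_lattice hN _ _).mul_left _
  rw [poisson_left hi hs hlim]
  simp only [fourier_g_coset]
  rw [tsum_mul_left, tsum_g_lattice hN]

theorem S_smul_S_smul (τ : ℍ) : (ModularGroup.S • (ModularGroup.S • τ) : ℍ) = τ := by
  apply UpperHalfPlane.ext
  have := UpperHalfPlane.ne_zero τ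
  rw [coe_S_smul, coe_S_smul]
  field_simp

theorem neg_I_mul_S_cpow_half (τ : ℍ) :
    (-Complex.I * ((ModularGroup.S • τ : ℍ) : ℂ)) ^ (1 / 2 : ℂ) =
      ((-Complex.I * τ) ^ (1 / 2 : ℂ))⁻¹ := by
  have hτ := UpperHalfPlane.ne_zero τ
  have harg : (-Complex.I * (τ : ℂ)).arg ≠ Real.pi := by
    intro h
    rw [Complex.arg_eq_pi_iff] at h
    have h1 : (-Complex.I * (τ : ℂ)).re = τ.im := by simp
    linarith [h.1, τ.im_pos]
  rw [← Complex.inv_cpow _ _ harg, coe_S_smul]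
  congr 1
  have hI := Complex.I_ne_zero
  field_simp
  rw [Complex.I_sq]

theorem sum_pow_root_of_unity {ζ : ℂ} {n : ℕ} (h : ζ ^ n = 1) (h1 : ζ ≠ 1) :
    ∑ l ∈ Finset.range n, ζ ^ l = 0 := by
  rw [geom_sum_eq h1, h, sub_self, zero_div]

-- The half-integral classes are k = Nl + N/2 with 0 ≤ l < N; this uses that N is even.
open Classical in
theorem sum_isHalfIntegral {N : ℕ} [NeZero N] (hN : Even N) (F : ℂ → ℂ) :
    (∑ j : Disc N, if IsHalfIntegral N j then F (rep N j) else 0) =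
      ∑ l ∈ Finset.range N, F (l + 1 / 2) := by
  obtain ⟨M, hM⟩ := hN
  have hN0 : (0 : ℝ) < N := by exact_mod_cast NeZero.pos N
  have hMr : (N : ℝ) = M + M := by exact_mod_cast hM
  have hMpos : 0 < M := by have := NeZero.pos N; omega
  have hlt : ∀ l < N, N * l + M < N ^ 2 := by
    intro l hl
    have : N * (l + 1) ≤ N * N := Nat.mul_le_mul_left _ hl
    have : M < N := by omega
    nlinarith
  have hval : ∀ l < N, ((N * l + M : ℕ) : Disc N).val = N * l + M := fun l hl =>
    ZMod.val_cast_of_lt (hlt l hl)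
  have hrep : ∀ l < N, rep N ((N * l + M : ℕ) : Disc N) = l + 1 / 2 := by
    intro l hl
    rw [rep, hval l hl]
    push_cast
    field_simp
    linarith
  rw [← Finset.sum_filter]
  symm
  refine Finset.sum_bij (fun l _ => ((N * l + M : ℕ) : Disc N)) (fun l hl => ?_)
    (fun l hl l' hl' h => ?_) (fun j hj => ?_) fun l hl => ?_
  · rw [Finset.mem_filter]
    exact ⟨Finset.mem_univ _, l, by rw [hrep l (Finset.mem_range.1 hl)]; push_cast; rfl⟩
  · have h1 := congrArg ZMod.val h
    rw [hval l (Finset.mem_range.1 hl), hval l' (Finset.mem_range.1 hl')] at h1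
    exact Nat.eq_of_mul_eq_mul_left (NeZero.pos N) (by omega)
  · obtain ⟨l, hl⟩ := (Finset.mem_filter.1 hj).2
    have h0 := rep_nonneg N j
    have h1 := rep_lt N j
    rw [hl] at h0 h1
    have h2 : (-1 : ℝ) < l := by linarith
    have h3 : (l : ℝ) < N := by linarith
    have h4 : -1 < l := by exact_mod_cast h2
    lift l to ℕ using by omega
    have h5 : l < N := by exact_mod_cast h3
    refine ⟨l, Finset.mem_range.2 h5, ?_⟩
    apply ZMod.val_injective
    rw [hval l h5]
    rw [rep, div_eq_iff hN0.ne'] at hl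
    have h6 : (j.val : ℝ) = ((N * l + M : ℕ) : ℝ) := by
      rw [hl]; push_cast; rw [hMr]; ring
    exact (by exact_mod_cast h6.symm)
  · rw [← Complex.ofReal_natCast, hrep l (Finset.mem_range.1 hl)] 
    push_cast
    rfl

-- The sum is geometric with ratio ζ = 𝐞(h + 1/2), and ζ^N = 1. It vanishes unless ζ = 1, that is
-- unless h is half-integral, so the vector of E₂ terms is carried to a multiple of itself.
open Classical in
theorem sum_isHalfIntegral_e {N : ℕ} [NeZero N] (hN : Even N) (h : Disc N) :
    (∑ j : Disc N, if IsHalfIntegral N j then e (rep N h * rep N j) * e ((rep N j : ℂ) / 2) else 0) =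
      if IsHalfIntegral N h then N * Complex.I * e ((rep N h : ℂ) / 2) else 0 := by
  have hNc : (N : ℂ) ≠ 0 := Nat.cast_ne_zero.2 (NeZero.ne N)
  rw [sum_isHalfIntegral hN fun z => e (rep N h * z) * e (z / 2)]
  set ζ := e ((rep N h : ℂ) + 1 / 2) with hζ
  have hterm : ∀ l : ℕ, e (rep N h * ((l : ℂ) + 1 / 2)) * e (((l : ℂ) + 1 / 2) / 2) =
      e ((rep N h : ℂ) / 2) * Complex.I * ζ ^ l := by
    intro l
    rw [← e_quarter, hζ, ← e_nat_mul, ← e_add, ← e_add, ← e_add]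
    congr 1
    ring
  simp only [hterm]
  rw [← Finset.mul_sum]
  have h1 : ζ ^ N = 1 := by
    obtain ⟨M, hM⟩ := hN
    have hMc : (N : ℂ) = M + M := by exact_mod_cast hM
    have hr : (N : ℂ) * rep N h = h.val := by
      rw [rep]; push_cast; field_simp
    rw [hζ, ← e_nat_mul]
    refine Eq.trans ?_ (e_int (h.val + M))
    congr 1
    push_cast
    rw [mul_add, hr, hMc]
    ring
  by_cases hζ1 : ζ = 1
  · rw [if_pos, hζ1]
    · simp only [one_pow, Finset.sum_const, Finset.card_range, nsmul_eq_mul, mul_one]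
      ring
    · rw [hζ, e, Complex.exp_eq_one_iff] at hζ1
      obtain ⟨n, hn⟩ := hζ1
      rw [mul_comm (n : ℂ)] at hn
      have h2 := mul_left_cancel₀ Complex.two_pi_I_ne_zero hn
      refine ⟨n - 1, ?_⟩
      have h3 : rep N h + 1 / 2 = n := by
        have : ((rep N h + 1 / 2 : ℝ) : ℂ) = ((n : ℝ) : ℂ) := by push_cast; exact h2
        exact_mod_cast this
      push_cast
      linarith
  · rw [sum_pow_root_of_unity h1 hζ1, mul_zero, if_neg]
    rintro ⟨m, hm⟩
    apply hζ1
    rw [hζ, hm]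
    refine Eq.trans ?_ (e_int (m + 1))
    congr 1
    push_cast
    ring

/-- Apply `tsum_g_S` at -1/τ. Its defect is the negative of what the term 6τ/(πi) in E₂(-1/τ)
contributes, so both disappear and only the linear transformation remains. -/
theorem thetaTilde_S {N : ℕ} [NeZero N] (hN : Even N) (τ : ℍ) (h : Disc N) :
    thetaTilde N (ModularGroup.S • τ) h = (τ : ℂ) ^ (1 / 2 : ℂ) *
      ∑ j, e (1 / 8) / N * e (rep N h * rep N j) * thetaTilde N τ j := by
  classical
  have hNc : (N : ℂ) ≠ 0 := Nat.cast_ne_zero.2 (NeZero.ne N)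
  have hτ0 := UpperHalfPlane.ne_zero τ
  have hη := etaCubed_ne_zero τ
  have hI := Complex.I_ne_zero
  have hpi : (Real.pi : ℂ) ≠ 0 := by exact_mod_cast Real.pi_ne_zero
  have hK0 := neg_I_mul_cpow_half_ne_zero τ.2
  have hK2 := cpow_half_sq (-Complex.I * (τ : ℂ))
  have hS := tsum_g_S hN (ModularGroup.S • τ) h
  rw [S_smul_S_smul, neg_I_mul_S_cpow_half, etaCubed_S, coe_S_smul, sub_eq_iff_eq_add] at hS
  have hroot : Complex.I * (-Complex.I * (τ : ℂ)) ^ (1 / 2 : ℂ) = e (1 / 8) * (τ : ℂ) ^ (1 / 2 : ℂ) := by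
    rw [neg_I_mul_cpow_half τ.2, ← e_quarter, ← mul_assoc, ← e_add]
    norm_num
  have hsplit : ∑ j, e (1 / 8) / N * e (rep N h * rep N j) * thetaTilde N τ j =
      e (1 / 8) / N * (∑ j : Disc N, e (rep N h * rep N j) *
        ∑' n : ℤ, g τ (N * n + rep N j)) +
      e (1 / 8) / N * (EisensteinSeries.E2 τ / (12 * N * Complex.I * etaCubed τ)) *
        (∑ j : Disc N, if IsHalfIntegral N j then
          e (rep N h * rep N j) * e ((rep N j : ℂ) / 2) else 0) := by
    rw [Finset.mul_sum, Finset.mul_sum, ← Finset.sum_add_distrib]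
    refine Finset.sum_congr rfl fun j _ => ?_
    rw [thetaTilde]
    split_ifs <;> ring
  rw [hsplit, sum_isHalfIntegral_e hN, thetaTilde, hS, etaCubed_S, E2_S]
  set A := ∑ j : Disc N, e (rep N h * rep N j) * ∑' n : ℤ, g τ (N * n + rep N j)
  set K := (-Complex.I * (τ : ℂ)) ^ (1 / 2 : ℂ)
  set R := (τ : ℂ) ^ (1 / 2 : ℂ)
  set ε := e (1 / 8)
  have hτK : (τ : ℂ) = Complex.I * K ^ 2 := by
    rw [hK2]; linear_combination (τ : ℂ) * Complex.I_sq
  have hR : ∀ a b : ℂ, R * (ε / N * a + ε / N * b) = Complex.I * K / N * (a + b) := by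
    intro a b
    rw [hroot]; ring
  rw [mul_assoc (ε / N) (EisensteinSeries.E2 τ / _), hR]
  clear_value K A R ε
  split_ifs
  · rw [hτK]
    field_simp
    ring_nf
    simp only [Complex.I_sq]
    ring_nf
    simp only [Complex.I_pow_four, mul_one]
  · field_simp
    ring

theorem conj_weilS {N : ℕ} [NeZero N] (h j : Disc N) :
    (starRingEnd ℂ) (weilS N h j) = e (1 / 8) / N * e (rep N h * rep N j) := by
  have h8 : -(starRingEnd ℂ) (-1 / 8 : ℂ) = 1 / 8 := by
    rw [show (-1 / 8 : ℂ) = ((-1 / 8 : ℝ) : ℂ) by push_cast; rfl, Complex.conj_ofReal]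
    push_cast
    ring
  rw [weilS, Matrix.of_apply, map_mul, map_div₀, e_conj, e_conj, h8]
  simp

/-- Both sides are compatible with products and inverses in the group, so the generators suffice. -/
theorem thetaTilde_modular {N : ℕ} [NeZero N] (hN : Even N) (A : Mp2Z) (τ : ℍ) :
    thetaTilde N (A.mat • τ) = (A.root τ) •
      (conjRep (weilRep N hN) A : Matrix (Disc N) (Disc N) ℂ).mulVec (thetaTilde N τ) := by
  have hA : A ∈ Subgroup.closure ({Mp2Z.S, Mp2Z.T} : Set Mp2Z) := by
    rw [Mp2Z.closure_S_T]; trivial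
  induction hA using Subgroup.closure_induction generalizing τ with
  | mem x hx =>
    rcases hx with rfl | rfl
    · have hr : Mp2Z.S.root τ = (τ : ℂ) ^ (1 / 2 : ℂ) := rfl
      have hm : Mp2Z.S.mat = ModularGroup.S := rfl
      funext h
      rw [hr, hm, thetaTilde_S hN]
      simp only [conjRep, MonoidHom.comp_apply, Pi.smul_apply, Matrix.mulVec, dotProduct,
        Matrix.GeneralLinearGroup.map_apply, weilRep_S, conj_weilS, smul_eq_mul]
    · have hr : Mp2Z.T.root τ = 1 := rfl
      have hm : Mp2Z.T.mat = ModularGroup.T := rfl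
      funext h
      rw [hr, hm, thetaTilde_T hN, one_smul]
      have hmat : (conjRep (weilRep N hN) Mp2Z.T : Matrix (Disc N) (Disc N) ℂ) =
          Matrix.diagonal fun h => e (-((rep N h : ℂ) ^ 2 / 2)) := by
        ext i j
        simp only [conjRep, MonoidHom.comp_apply, Matrix.GeneralLinearGroup.map_apply, weilRep_T,
          weilT, Matrix.diagonal_apply]
        split_ifs
        · rw [e_conj, map_div₀, map_pow, Complex.conj_ofReal, map_ofNat]
        · simp
      rw [hmat, Matrix.mulVec_diagonal]
  | one => simp
  | mul x y _ _ hx hy =>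
    rw [Mp2Z.mat_mul, mul_smul, hx, hy, Mp2Z.root_mul, map_mul, Units.val_mul,
      Matrix.mulVec_smul, Matrix.mulVec_mulVec, smul_smul]
  | inv x _ hx =>
    have h1 := hx (x.mat⁻¹ • τ)
    rw [smul_inv_smul] at h1
    rw [Mp2Z.mat_inv, Mp2Z.root_inv, h1, map_inv, Matrix.mulVec_smul, Matrix.mulVec_mulVec,
      smul_smul, ← Units.val_mul, inv_mul_cancel, Units.val_one, Matrix.one_mulVec,
      inv_mul_cancel₀ (x.root_ne_zero _), one_smul]

end Modularity

/-! ### The holomorphic extension of e^{c²}erfc(c) -/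

section GaussLaplace

open MeasureTheory Filter Topology Set

/-- `∫₀^∞ e^{-t² - 2ct} dt`, which is `√π/2 · e^{c²} erfc(c)`. -/
noncomputable def gaussLaplace (c : ℂ) : ℂ :=
  ∫ t in Ioi (0 : ℝ), Complex.exp (-(t : ℂ) ^ 2 - 2 * c * t)

theorem norm_exp_neg_sq_sub (c : ℂ) (t : ℝ) : ‖Complex.exp (-(t : ℂ) ^ 2 - 2 * c * t)‖ =
    Real.exp (-t ^ 2 - 2 * c.re * t) := by
  rw [Complex.norm_exp]
  congr 1
  have : (-(t : ℂ) ^ 2 - 2 * c * t) = ((-t ^ 2 : ℝ) : ℂ) - ((2 * t : ℝ) : ℂ) * c := by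
    push_cast; ring
  rw [this, Complex.sub_re, Complex.ofReal_re, Complex.re_ofReal_mul]
  ring

theorem differentiableAt_gaussLaplace {c : ℂ} (hc : 0 < c.re) :
    DifferentiableAt ℂ gaussLaplace c := by
  have hopen : {w : ℂ | 0 < w.re} ∈ 𝓝 c := (isOpen_lt continuous_const Complex.continuous_re).mem_nhds hc
  have hmeas : ∀ w : ℂ, AEStronglyMeasurable (fun t : ℝ => Complex.exp (-(t : ℂ) ^ 2 - 2 * w * t))
      (volume.restrict (Ioi (0 : ℝ))) := fun w =>
    Continuous.aestronglyMeasurable (by fun_prop)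
  have hb : IntegrableOn (fun t : ℝ => 2 * (t * Real.exp (-1 * t ^ 2))) (Ioi 0) :=
    ((integrable_mul_exp_neg_mul_sq one_pos).const_mul 2).integrableOn
  have hle : ∀ w : ℂ, 0 < w.re → ∀ t : ℝ, 0 < t →
      Real.exp (-t ^ 2 - 2 * w.re * t) ≤ Real.exp (-1 * t ^ 2) := by
    intro w hw t ht
    apply Real.exp_le_exp.2
    nlinarith [mul_pos hw ht]
  refine (hasDerivAt_integral_of_dominated_loc_of_deriv_le
    (F := fun c (t : ℝ) => Complex.exp (-(t : ℂ) ^ 2 - 2 * c * t))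
    (F' := fun c (t : ℝ) => Complex.exp (-(t : ℂ) ^ 2 - 2 * c * t) * (-(2 * t)))
    (bound := fun t => 2 * (t * Real.exp (-1 * t ^ 2))) hopen (Eventually.of_forall hmeas) ?_ ?_ ?_
    hb ?_).2.differentiableAt
  · refine Integrable.mono' ((integrable_exp_neg_mul_sq one_pos).integrableOn (s := Ioi 0))
      (hmeas c) ?_
    filter_upwards [ae_restrict_mem measurableSet_Ioi] with t ht
    rw [norm_exp_neg_sq_sub]
    exact hle c hc t ht
  · exact Continuous.aestronglyMeasurable (by fun_prop)
  · filter_upwards [ae_restrict_mem measurableSet_Ioi] with t ht w hw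
    have ht0 : 0 < t := ht
    rw [norm_mul, norm_exp_neg_sq_sub, norm_neg, norm_mul, Complex.norm_real, Complex.norm_ofNat,
      Real.norm_of_nonneg ht0.le]
    have := hle w hw t ht0
    nlinarith
  · refine Eventually.of_forall fun t w _ => ?_
    have h1 : HasDerivAt (fun c : ℂ => -(t : ℂ) ^ 2 - 2 * c * t) (-(2 * (t : ℂ))) w := by
      have := (((hasDerivAt_id w).const_mul 2).mul_const (t : ℂ)).const_sub (-(t : ℂ) ^ 2)
      simpa using this
    exact h1.cexp

/-- Dropping the factor e^{-t²} leaves an elementary exponential integral. -/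
theorem norm_gaussLaplace_le {c : ℂ} (hc : 0 < c.re) : ‖gaussLaplace c‖ ≤ 1 / (2 * c.re) := by
  have h1 := integral_exp_mul_Ioi (a := -(2 * c.re)) (by linarith) 0
  have hi := integrableOn_exp_mul_Ioi (a := -(2 * c.re)) (by linarith) 0
  have h2 : ∫ t in Ioi (0 : ℝ), Real.exp (-(2 * c.re) * t) = 1 / (2 * c.re) := by
    rw [h1]; simp
  rw [← h2, gaussLaplace]
  refine norm_integral_le_of_norm_le hi (Eventually.of_forall fun t => ?_)
  rw [norm_exp_neg_sq_sub]
  apply Real.exp_le_exp.2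
  nlinarith [sq_nonneg t]

theorem erfc_eq_gaussLaplace (x : ℝ) :
    (erfc x : ℂ) = 2 / Real.sqrt Real.pi * Real.exp (-x ^ 2) * gaussLaplace x := by
  have h2 := (measurePreserving_add_right volume x).setIntegral_preimage_emb
      (measurableEmbedding_addRight x) (fun t : ℝ => Real.exp (-t ^ 2)) (Ioi x)
  rw [preimage_add_const_Ioi, sub_self] at h2
  have h3 : gaussLaplace x = ((∫ t in Ioi (0 : ℝ), Real.exp (-t ^ 2 - 2 * x * t) : ℝ) : ℂ) := by
    rw [gaussLaplace, ← integral_complex_ofReal]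
    refine integral_congr_ae (Eventually.of_forall fun t => ?_)
    simp only
    push_cast
    rfl
  have h4 : ∫ t in Ioi (0 : ℝ), Real.exp (-(t + x) ^ 2) =
      Real.exp (-x ^ 2) * ∫ t in Ioi (0 : ℝ), Real.exp (-t ^ 2 - 2 * x * t) := by
    rw [← integral_const_mul]
    refine integral_congr_ae (Eventually.of_forall fun t => ?_)
    simp only
    rw [← Real.exp_add]
    ring_nf
  rw [erfc, ← h2, h4, h3]
  push_cast
  ring

end GaussLaplace

/-! ### The non-holomorphic part as a pairing in ℓ²(ℤ) -/

section Nonholomorphic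

open Filter Topology Set
open scoped InnerProductSpace

variable {r : ℤ → ℝ}

/-- The Hilbert space `ℓ²(ℤ)`. -/
abbrev SeqSpace : Type := lp (fun _ : ℤ => ℂ) 2

/-- The sequence `r_n 𝐞(r_n² z/2)`. -/
noncomputable def thetaVec (r : ℤ → ℝ) (z : ℂ) : SeqSpace :=
  ∑' n : ℤ, lp.single 2 n ((r n : ℂ) * e ((r n : ℂ) ^ 2 / 2 * z))

/-- The sequence `e^{2π r_n² v} erfc(√(2πv) |r_n|) / (2 |r_n|)`, as a function of a complex `v`. -/
noncomputable def erfcVec (r : ℤ → ℝ) (v : ℂ) : SeqSpace :=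
  ∑' n : ℤ, lp.single 2 n (gaussLaplace (((Real.sqrt (2 * Real.pi) * |r n| : ℝ) : ℂ) *
    v ^ (1 / 2 : ℂ)) / ((Real.sqrt Real.pi * |r n| : ℝ) : ℂ))

theorem norm_lp_single (n : ℤ) (a : ℂ) : ‖(lp.single 2 n a : SeqSpace)‖ = ‖a‖ :=
  lp.norm_single (E := fun _ : ℤ => ℂ) (p := 2) two_pos n a

theorem differentiableAt_lp_single {f : ℂ → ℂ} {z : ℂ} (n : ℤ) (hf : DifferentiableAt ℂ f z) :
    DifferentiableAt ℂ (fun z => (lp.single 2 n (f z) : SeqSpace)) z := by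
  have h : (fun z => (lp.single 2 n (f z) : SeqSpace)) =
      fun z => f z • (lp.single 2 n (1 : ℂ) : SeqSpace) := by
    funext z
    rw [← lp.single_smul, smul_eq_mul, mul_one]
  rw [h]
  exact hf.smul_const _

theorem tsum_lp_single_apply {f : ℤ → ℂ} (hf : Summable fun n => ‖f n‖) (n : ℤ) :
    (∑' k : ℤ, lp.single 2 k (f k) : SeqSpace) n = f n := by
  have hs : Summable fun k : ℤ => (lp.single 2 k (f k) : SeqSpace) :=
    Summable.of_norm (by simpa only [norm_lp_single] using hf)
  have h := (lp.evalCLM ℂ (fun _ : ℤ => ℂ) 2 n).map_tsum hs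
  have h2 : ∀ x : SeqSpace, (lp.evalCLM ℂ (fun _ : ℤ => ℂ) 2 n) x = x n := fun _ => rfl
  rw [h2] at h
  rw [h, tsum_eq_single n]
  · rw [h2, lp.single_apply_self]
  · intro k hk
    rw [h2, lp.single_apply_ne _ _ _ hk.symm]

/-- The two summability properties of a coset which are used for its theta series. -/
structure IsLatticeLike (r : ℤ → ℝ) : Prop where
  inv_sq : Summable fun n => 1 / r n ^ 2
  gauss : ∀ b : ℝ, 0 < b → Summable fun n => |r n| * Real.exp (-b * r n ^ 2)

theorem norm_thetaVec_term (x : ℝ) (z : ℂ) :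
    ‖(x : ℂ) * e ((x : ℂ) ^ 2 / 2 * z)‖ = |x| * Real.exp (-(Real.pi * z.im) * x ^ 2) := by
  rw [norm_mul, norm_e_sq_mul, Complex.norm_real, Real.norm_eq_abs]

theorem summable_thetaVec (hr : IsLatticeLike r) {z : ℂ} (hz : 0 < z.im) :
    Summable fun n => ‖(r n : ℂ) * e ((r n : ℂ) ^ 2 / 2 * z)‖ := by
  simp only [norm_thetaVec_term]
  exact hr.gauss _ (mul_pos Real.pi_pos hz)

theorem thetaVec_apply (hr : IsLatticeLike r) {z : ℂ} (hz : 0 < z.im) (n : ℤ) :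
    thetaVec r z n = (r n : ℂ) * e ((r n : ℂ) ^ 2 / 2 * z) :=
  tsum_lp_single_apply (summable_thetaVec hr hz) n

theorem differentiableAt_thetaVec (hr : IsLatticeLike r) {z : ℂ} (hz : 0 < z.im) :
    DifferentiableAt ℂ (thetaVec r) z := by
  have hopen : IsOpen {w : ℂ | z.im / 2 < w.im} := isOpen_lt continuous_const Complex.continuous_im
  refine (Complex.differentiableOn_tsum_of_summable_norm
    (hr.gauss (Real.pi * (z.im / 2)) (by positivity)) (fun n w _ => ?_) hopen fun n w hw => ?_).differentiableAt
    (hopen.mem_nhds (show z.im / 2 < z.im by linarith))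
  · refine (differentiableAt_lp_single n ?_).differentiableWithinAt
    exact ((differentiable_e _).comp w (by fun_prop)).const_mul _
  · rw [norm_lp_single, norm_thetaVec_term]
    refine mul_le_mul_of_nonneg_left (Real.exp_le_exp.2 ?_) (abs_nonneg _)
    have : 0 ≤ Real.pi * (w.im - z.im / 2) * r n ^ 2 := by
      have hw' : z.im / 2 < w.im := hw
      have := sub_nonneg.2 hw'.le
      have := Real.pi_pos
      positivity
    nlinarith

theorem re_cpow_half_pos {v : ℂ} (hv : 0 < v.re) : 0 < (v ^ (1 / 2 : ℂ)).re := by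
  have hv0 : v ≠ 0 := by rintro rfl; simp at hv
  have harg := Complex.abs_arg_lt_pi_div_two_iff.2 (Or.inl hv)
  rw [Complex.cpow_def_of_ne_zero hv0, Complex.exp_re]
  refine mul_pos (Real.exp_pos _) (Real.cos_pos_of_mem_Ioo ?_)
  have him : (Complex.log v * (1 / 2)).im = v.arg / 2 := by
    have : Complex.log v * (1 / 2) = ((1 / 2 : ℝ) : ℂ) * Complex.log v := by push_cast; ring
    rw [this, Complex.im_ofReal_mul, Complex.log_im]; ring
  rw [him]
  have := abs_lt.1 harg
  constructor <;> linarith [Real.pi_pos]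

/-- One factor 1/|x| is explicit and the other comes from the 1/Re c decay of `gaussLaplace`;
together they give the summable majorant 1/x². -/
theorem norm_erfcVec_term_le (x : ℝ) {v : ℂ} (hv : 0 < v.re) {δ : ℝ} (hδ : 0 < δ)
    (h : δ ≤ (v ^ (1 / 2 : ℂ)).re) :
    ‖gaussLaplace (((Real.sqrt (2 * Real.pi) * |x| : ℝ) : ℂ) * v ^ (1 / 2 : ℂ)) /
      ((Real.sqrt Real.pi * |x| : ℝ) : ℂ)‖ ≤
    1 / (2 * (Real.sqrt (2 * Real.pi)) * δ * Real.sqrt Real.pi) * (1 / x ^ 2) := by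
  -- At x = 0 both sides are 0 because division by zero gives 0.
  rcases eq_or_ne x 0 with rfl | hx
  · simp
  have hx0 : 0 < |x| := abs_pos.2 hx
  have hre : (((Real.sqrt (2 * Real.pi) * |x| : ℝ) : ℂ) * v ^ (1 / 2 : ℂ)).re =
      Real.sqrt (2 * Real.pi) * |x| * (v ^ (1 / 2 : ℂ)).re := Complex.re_ofReal_mul _ _
  have hpos : 0 < Real.sqrt (2 * Real.pi) := Real.sqrt_pos.2 (by positivity)
  have hpos' : 0 < Real.sqrt Real.pi := Real.sqrt_pos.2 Real.pi_pos
  have h1 := norm_gaussLaplace_le (c := ((Real.sqrt (2 * Real.pi) * |x| : ℝ) : ℂ) *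
    v ^ (1 / 2 : ℂ)) (by rw [hre]; exact mul_pos (mul_pos hpos hx0) (re_cpow_half_pos hv))
  rw [norm_div, Complex.norm_real, Real.norm_of_nonneg (by positivity)]
  rw [hre] at h1
  calc _ ≤ 1 / (2 * (Real.sqrt (2 * Real.pi) * |x| * δ)) / (Real.sqrt Real.pi * |x|) := by
        gcongr
        exact h1.trans (by gcongr)
    _ = _ := by
      rw [← sq_abs x]
      field_simp

theorem differentiableAt_cpow_half {v : ℂ} (hv : 0 < v.re) :
    DifferentiableAt ℂ (fun v : ℂ => v ^ (1 / 2 : ℂ)) v :=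
  differentiableAt_id.cpow_const (Or.inl hv)

theorem summable_erfcVec (hr : IsLatticeLike r) {v : ℂ} (hv : 0 < v.re) :
    Summable fun n => ‖gaussLaplace (((Real.sqrt (2 * Real.pi) * |r n| : ℝ) : ℂ) *
      v ^ (1 / 2 : ℂ)) / ((Real.sqrt Real.pi * |r n| : ℝ) : ℂ)‖ :=
  (hr.inv_sq.mul_left _).of_nonneg_of_le (fun _ => norm_nonneg _)
    fun n => norm_erfcVec_term_le (r n) hv (re_cpow_half_pos hv) le_rfl

theorem erfcVec_apply (hr : IsLatticeLike r) {v : ℂ} (hv : 0 < v.re) (n : ℤ) :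
    erfcVec r v n = gaussLaplace (((Real.sqrt (2 * Real.pi) * |r n| : ℝ) : ℂ) *
      v ^ (1 / 2 : ℂ)) / ((Real.sqrt Real.pi * |r n| : ℝ) : ℂ) :=
  tsum_lp_single_apply (summable_erfcVec hr hv) n

theorem differentiableAt_erfcVec (hr : IsLatticeLike r) {v : ℂ} (hv : 0 < v.re) :
    DifferentiableAt ℂ (erfcVec r) v := by
  set δ := (v ^ (1 / 2 : ℂ)).re / 2 with hδ
  have hδ0 : 0 < δ := half_pos (re_cpow_half_pos hv)
  have hnhds : {w : ℂ | 0 < w.re ∧ δ < (w ^ (1 / 2 : ℂ)).re} ∈ 𝓝 v := by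
    refine Filter.inter_mem ((isOpen_lt continuous_const Complex.continuous_re).mem_nhds hv) ?_
    have hc := Complex.continuous_re.continuousAt.comp (differentiableAt_cpow_half hv).continuousAt
    exact hc.eventually_mem (Ioi_mem_nhds (by simp only [Function.comp_apply]; linarith))
  obtain ⟨U, hU, hopen, hvU⟩ := mem_nhds_iff.1 hnhds
  refine (Complex.differentiableOn_tsum_of_summable_norm
    (hr.inv_sq.mul_left (1 / (2 * (Real.sqrt (2 * Real.pi)) * δ * Real.sqrt Real.pi)))
    (fun n w hw => ?_) hopen fun n w hw => ?_).differentiableAt (hopen.mem_nhds hvU)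
  · refine (differentiableAt_lp_single n ?_).differentiableWithinAt
    have hw' := hU hw
    by_cases h0 : r n = 0
    · simp only [h0]
      simp
    · refine DifferentiableAt.div_const ?_ _
      refine DifferentiableAt.comp (g := gaussLaplace) w (differentiableAt_gaussLaplace ?_)
        ((differentiableAt_cpow_half hw'.1).const_mul _)
      rw [Complex.re_ofReal_mul]
      have : 0 < |r n| := abs_pos.2 h0
      have : 0 < Real.sqrt (2 * Real.pi) := Real.sqrt_pos.2 (by positivity)
      have := re_cpow_half_pos hw'.1
      positivity
  · rw [norm_lp_single]
    exact norm_erfcVec_term_le (r n) (hU hw).1 hδ0 (hU hw).2.le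

end Nonholomorphic

/-! ### Analyticity and the τ̄-derivative of the non-holomorphic part -/

section NonholomorphicDeriv

open Filter Topology Set
open scoped InnerProductSpace

variable {r : ℤ → ℝ}

theorem ofReal_cpow_half {v : ℝ} (hv : 0 ≤ v) : (v : ℂ) ^ (1 / 2 : ℂ) = (Real.sqrt v : ℂ) := by
  rw [Real.sqrt_eq_rpow, Complex.ofReal_cpow hv]
  push_cast
  rfl

theorem gaussLaplace_ofReal (x : ℝ) : gaussLaplace x =
    ((Real.sqrt Real.pi / 2 * (Real.exp (x ^ 2) * erfc x) : ℝ) : ℂ) := by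
  have h := erfc_eq_gaussLaplace x
  have hpi : (Real.sqrt Real.pi : ℂ) ≠ 0 := by
    exact_mod_cast (Real.sqrt_pos.2 Real.pi_pos).ne'
  have h2 : (Real.exp (x ^ 2) : ℂ) * Real.exp (-x ^ 2) = 1 := by
    rw [← Complex.ofReal_mul, ← Real.exp_add]; simp
  push_cast at h2 ⊢
  rw [h]
  push_cast
  field_simp
  linear_combination -gaussLaplace x * h2

theorem erfcTerm_eq (x : ℝ) {v : ℝ} (hv : 0 < v) :
    gaussLaplace (((Real.sqrt (2 * Real.pi) * |x| : ℝ) : ℂ) * (v : ℂ) ^ (1 / 2 : ℂ)) /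
      ((Real.sqrt Real.pi * |x| : ℝ) : ℂ) =
    ((Real.exp (2 * Real.pi * x ^ 2 * v) * erfc (Real.sqrt (2 * Real.pi) * |x| * Real.sqrt v) /
      (2 * |x|) : ℝ) : ℂ) := by
  have hpi := (Real.sqrt_pos.2 Real.pi_pos).ne'
  have hsq : (Real.sqrt (2 * Real.pi) * |x| * Real.sqrt v) ^ 2 = 2 * Real.pi * x ^ 2 * v := by
    rw [mul_pow, mul_pow, Real.sq_sqrt (by positivity), Real.sq_sqrt hv.le, sq_abs]
  rw [ofReal_cpow_half hv.le, ← Complex.ofReal_mul, gaussLaplace_ofReal, hsq,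
    ← Complex.ofReal_div]
  congr 1
  rcases eq_or_ne x 0 with rfl | hx
  · simp
  have hx0 := abs_ne_zero.2 hx
  field_simp

/-- The exponential prefactor cancels the Gaussian in the derivative of erfc, and the powers of |x|
cancel as well, so the inhomogeneous term does not depend on x. -/
theorem hasDerivAt_erfcTerm {x : ℝ} (hx : x ≠ 0) {v : ℝ} (hv : 0 < v) :
    HasDerivAt (fun v : ℝ => Real.exp (2 * Real.pi * x ^ 2 * v) *
      erfc (Real.sqrt (2 * Real.pi) * |x| * Real.sqrt v) / (2 * |x|))
      (2 * Real.pi * x ^ 2 * (Real.exp (2 * Real.pi * x ^ 2 * v) *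
        erfc (Real.sqrt (2 * Real.pi) * |x| * Real.sqrt v) / (2 * |x|)) -
          Real.sqrt 2 / (2 * Real.sqrt v)) v := by
  have hpi := (Real.sqrt_pos.2 Real.pi_pos).ne'
  have hx0 := abs_ne_zero.2 hx
  have hsq : (Real.sqrt (2 * Real.pi) * |x| * Real.sqrt v) ^ 2 = 2 * Real.pi * x ^ 2 * v := by
    rw [mul_pow, mul_pow, Real.sq_sqrt (by positivity), Real.sq_sqrt hv.le, sq_abs]
  have h1 : HasDerivAt (fun v : ℝ => Real.exp (2 * Real.pi * x ^ 2 * v))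
      (Real.exp (2 * Real.pi * x ^ 2 * v) * (2 * Real.pi * x ^ 2)) v := by
    simpa using ((hasDerivAt_id v).const_mul (2 * Real.pi * x ^ 2)).exp
  have h2 := (hasDerivAt_erfc (Real.sqrt (2 * Real.pi) * |x| * Real.sqrt v)).comp v
    ((Real.hasDerivAt_sqrt hv.ne').const_mul (Real.sqrt (2 * Real.pi) * |x|))
  have h3 := (h1.mul h2).div_const (2 * |x|)
  convert! h3 using 1
  rw [hsq, Real.sqrt_mul (by norm_num)]
  have h4 : Real.exp (2 * Real.pi * x ^ 2 * v) * Real.exp (-(2 * Real.pi * x ^ 2 * v)) = 1 := by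
    rw [← Real.exp_add]; simp
  have hv' : Real.sqrt v ≠ 0 := (Real.sqrt_pos.2 hv).ne'
  simp only [Function.comp_apply]
  field_simp
  linear_combination Real.sqrt 2 * |x| * h4

/-- The identity 𝐞(-r²τ/2) = conj(𝐞(r²τ/2))·e^{2πr²v} separates a conjugate-holomorphic factor from
a function of v, and sgn(r) = r/|r| distributes the sign. -/
theorem gStar_eq_inner (hr : IsLatticeLike r) (τ : ℍ) (n : ℤ) :
    gStar τ (r n) = ⟪thetaVec r τ n, erfcVec r (τ.im : ℂ) n⟫_ℂ := by
  have hv := τ.im_pos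
  rw [thetaVec_apply hr τ.2, erfcVec_apply hr (by simpa using hv), RCLike.inner_apply,
    erfcTerm_eq _ hv, gStar]
  have h1 : Real.sqrt (2 * Real.pi * τ.im) * |r n| =
      Real.sqrt (2 * Real.pi) * |r n| * Real.sqrt τ.im := by
    rw [Real.sqrt_mul (by positivity)]; ring
  have h2 : e (-((r n : ℂ) ^ 2 / 2 * τ)) = (starRingEnd ℂ) (e ((r n : ℂ) ^ 2 / 2 * τ)) *
      (Real.exp (2 * Real.pi * r n ^ 2 * τ.im) : ℂ) := by
    have h3 : (Real.exp (2 * Real.pi * r n ^ 2 * τ.im) : ℂ) =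
        e (-(Complex.I * (r n : ℂ) ^ 2 * τ.im)) := by
      rw [e]
      push_cast
      congr 1
      linear_combination (2 * Real.pi * (r n : ℂ) ^ 2 * τ.im) * Complex.I_sq
    have h4 : (starRingEnd ℂ) (τ : ℂ) = τ - 2 * τ.im * Complex.I := by
      apply Complex.ext
      · simp
      · simp; ring
    rw [h3, e_conj, ← e_add, map_mul, map_div₀, map_pow, Complex.conj_ofReal, map_ofNat, h4]
    congr 1
    ring
  rw [h1, h2, map_mul, Complex.conj_ofReal]
  rcases lt_trichotomy (r n) 0 with h | h | h
  · rw [Real.sign_of_neg h, abs_of_neg h]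
    have : (r n : ℂ) ≠ 0 := by exact_mod_cast h.ne
    push_cast
    field_simp
  · simp [h]
  · rw [Real.sign_of_pos h, abs_of_pos h]
    have : (r n : ℂ) ≠ 0 := by exact_mod_cast h.ne'
    push_cast
    field_simp

theorem hasSum_gStar (hr : IsLatticeLike r) (τ : ℍ) :
    HasSum (fun n => gStar τ (r n)) ⟪thetaVec r τ, erfcVec r (τ.im : ℂ)⟫_ℂ := by
  simp only [gStar_eq_inner hr]
  exact lp.hasSum_inner _ _

theorem hasDerivAt_apply {f : ℂ → SeqSpace} {f' : SeqSpace} {z : ℂ} (h : HasDerivAt f f' z) (n : ℤ) :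
    HasDerivAt (fun z => f z n) (f' n) z :=
  ((lp.evalCLM ℂ (fun _ : ℤ => ℂ) 2 n).hasFDerivAt.comp_hasDerivAt z h)

theorem deriv_thetaVec_apply (hr : IsLatticeLike r) {z : ℂ} (hz : 0 < z.im) (n : ℤ) :
    deriv (thetaVec r) z n = Real.pi * Complex.I * (r n : ℂ) ^ 2 * thetaVec r z n := by
  have h1 := hasDerivAt_apply (differentiableAt_thetaVec hr hz).hasDerivAt n
  have h2 : HasDerivAt (fun z => (r n : ℂ) * e ((r n : ℂ) ^ 2 / 2 * z))
      (Real.pi * Complex.I * (r n : ℂ) ^ 2 * thetaVec r z n) z := by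
    have h3 := (((hasDerivAt_e ((r n : ℂ) ^ 2 / 2 * z)).comp z
      ((hasDerivAt_id z).const_mul ((r n : ℂ) ^ 2 / 2))).const_mul (r n : ℂ))
    convert! h3 using 1
    rw [thetaVec_apply hr hz]
    ring
  refine h1.unique (h2.congr_of_eventuallyEq ?_)
  filter_upwards [(isOpen_lt continuous_const Complex.continuous_im).mem_nhds hz] with w hw
  exact thetaVec_apply hr hw n

theorem deriv_erfcVec_apply (hr : IsLatticeLike r) {v : ℝ} (hv : 0 < v) {n : ℤ} (hn : r n ≠ 0) :
    deriv (erfcVec r) v n = 2 * Real.pi * (r n : ℂ) ^ 2 * erfcVec r v n -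
      (Real.sqrt 2 : ℂ) / (2 * Real.sqrt v) := by
  have h1 := (hasDerivAt_apply (differentiableAt_erfcVec hr
    (v := v) (by simpa using hv)).hasDerivAt n).comp_ofReal
  have h2 := (hasDerivAt_erfcTerm hn hv).ofReal_comp
  rw [erfcVec_apply hr (by simpa using hv), erfcTerm_eq _ hv]
  push_cast at h2 ⊢
  refine h1.unique (h2.congr_of_eventuallyEq ?_)
  filter_upwards [Ioi_mem_nhds hv] with w hw
  have hw0 : 0 < w := hw
  rw [erfcVec_apply hr (by simpa using hw0), erfcTerm_eq _ hw0]
  push_cast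
  rfl

theorem comp_ofComplex_eventuallyEq {F : ℍ → ℂ} {P : ℂ → ℂ} (h : ∀ τ : ℍ, F τ = P τ) {z : ℂ}
    (hz : 0 < z.im) : F ∘ UpperHalfPlane.ofComplex =ᶠ[𝓝 z] P := by
  filter_upwards [(isOpen_lt continuous_const Complex.continuous_im).mem_nhds hz] with w hw
  rw [Function.comp_apply, h, UpperHalfPlane.ofComplex_apply_of_im_pos hw]

/-- Both ℓ²-valued maps are holomorphic, hence real-analytic, and the inner product is a bounded
real bilinear map. -/
theorem isRealAnalytic_tsum_gStar (hr : IsLatticeLike r) :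
    IsRealAnalytic fun τ => ∑' n, gStar τ (r n) := by
  intro z hz
  have hz' : 0 < z.im := hz
  refine AnalyticAt.congr ?_ (comp_ofComplex_eventuallyEq
    (P := fun z => ⟪thetaVec r z, erfcVec r (z.im : ℂ)⟫_ℂ)
    (fun τ => (hasSum_gStar hr τ).tsum_eq) hz).symm
  have hA : AnalyticAt ℝ (thetaVec r) z := by
    have hopen : IsOpen {w : ℂ | 0 < w.im} := isOpen_lt continuous_const Complex.continuous_im
    have hd : DifferentiableOn ℂ (thetaVec r) {w : ℂ | 0 < w.im} := fun w hw =>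
      (differentiableAt_thetaVec hr hw).differentiableWithinAt
    exact (hd.analyticAt (hopen.mem_nhds hz)).restrictScalars
  have hB : AnalyticAt ℝ (erfcVec r) (z.im : ℂ) := by
    have hopen : IsOpen {w : ℂ | 0 < w.re} := isOpen_lt continuous_const Complex.continuous_re
    have hd : DifferentiableOn ℂ (erfcVec r) {w : ℂ | 0 < w.re} := fun w hw =>
      (differentiableAt_erfcVec hr hw).differentiableWithinAt
    exact (hd.analyticAt (hopen.mem_nhds (by simpa using hz'))).restrictScalars
  have hB2 : AnalyticAt ℝ (fun z : ℂ => erfcVec r (z.im : ℂ)) z :=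
    AnalyticAt.comp (g := erfcVec r) (f := fun z : ℂ => (z.im : ℂ)) hB
      ((Complex.ofRealCLM.comp Complex.imCLM).analyticAt z)
  exact AnalyticAt.comp (g := fun p : SeqSpace × SeqSpace => ⟪p.1, p.2⟫_ℂ)
    (f := fun z : ℂ => (thetaVec r z, erfcVec r (z.im : ℂ))) (x := z)
    ((isBoundedBilinearMap_inner (𝕜 := ℂ) (E := SeqSpace)).toContinuousLinearMap.analyticAt_bilinear
      (thetaVec r z, erfcVec r (z.im : ℂ))) (hA.prod hB2)

/-- The product rule gives ⟪A', B⟫ + (i/2)⟪A, B'⟫. Coordinatewise the parts containing erfc are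
∓πir² times the same quantity and cancel; what survives is the x-independent term of
`hasDerivAt_erfcTerm` paired with A. -/
theorem dbar_tsum_gStar (hr : IsLatticeLike r) (τ : ℍ) :
    dbar (fun τ => ∑' n, gStar τ (r n)) τ = -(Complex.I * Real.sqrt 2 / (4 * Real.sqrt τ.im)) *
      (starRingEnd ℂ) (∑' n, (r n : ℂ) * e ((r n : ℂ) ^ 2 / 2 * τ)) := by
  have hz : 0 < (τ : ℂ).im := τ.2
  set A := thetaVec r τ with hA
  set B := erfcVec r (τ.im : ℂ) with hB
  set A' := deriv (thetaVec r) τ with hA'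
  set B' := deriv (erfcVec r) (τ.im : ℂ) with hB'
  have hdA : HasFDerivAt (thetaVec r) _ (τ : ℂ) :=
    (differentiableAt_thetaVec hr hz).hasDerivAt.hasFDerivAt.restrictScalars ℝ
  have hdB : HasFDerivAt (fun z : ℂ => erfcVec r (z.im : ℂ)) _ (τ : ℂ) :=
    HasFDerivAt.comp (g := erfcVec r) (f := fun z : ℂ => (z.im : ℂ)) (τ : ℂ)
      ((differentiableAt_erfcVec hr (v := ((τ : ℂ).im : ℂ)) (by simpa using
        hz)).hasDerivAt.hasFDerivAt.restrictScalars ℝ)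
      (Complex.ofRealCLM.comp Complex.imCLM).hasFDerivAt
  have hF := (hdA.inner ℂ hdB).congr_of_eventuallyEq (comp_ofComplex_eventuallyEq
    (P := fun z => ⟪thetaVec r z, erfcVec r (z.im : ℂ)⟫_ℂ)
    (fun τ => (hasSum_gStar hr τ).tsum_eq) hz)
  have happ : ∀ w : ℂ, fderiv ℝ ((fun τ => ∑' n, gStar τ (r n)) ∘ UpperHalfPlane.ofComplex) τ w =
      ⟪A, (w.im : ℂ) • B'⟫_ℂ + ⟪w • A', B⟫_ℂ := by
    intro w
    rw [hF.fderiv]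
    simp only [ContinuousLinearMap.comp_apply, ContinuousLinearMap.prod_apply,
      fderivInnerCLM_apply]
    rfl
  rw [dbar, happ, happ, Complex.one_im, Complex.I_im, Complex.ofReal_zero, zero_smul,
    inner_zero_right, Complex.ofReal_one, one_smul, one_smul, inner_smul_left, Complex.conj_I]
  have hs1 := (lp.hasSum_inner (𝕜 := ℂ) A' B)
  have hs2 := (lp.hasSum_inner (𝕜 := ℂ) A B').mul_left (Complex.I / 2)
  have hs := hs1.add hs2
  have hgoal : (0 + ⟪A', B⟫_ℂ + Complex.I * (⟪A, B'⟫_ℂ + -Complex.I * ⟪A', B⟫_ℂ)) / 2 =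
      ⟪A', B⟫_ℂ + Complex.I / 2 * ⟪A, B'⟫_ℂ := by
    linear_combination (-⟪A', B⟫_ℂ / 2) * Complex.I_sq
  rw [hgoal, ← hs.tsum_eq, Complex.conj_tsum, ← tsum_mul_left]
  refine tsum_congr fun n => ?_
  have hconj : (starRingEnd ℂ) (Real.pi * Complex.I * (r n : ℂ) ^ 2) =
      -(Real.pi * Complex.I * (r n : ℂ) ^ 2) := by
    rw [map_mul, map_mul, map_pow, Complex.conj_I, Complex.conj_ofReal, Complex.conj_ofReal]
    ring
  rw [← thetaVec_apply hr hz, RCLike.inner_apply, RCLike.inner_apply, hA',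
    deriv_thetaVec_apply hr hz, map_mul, hconj]
  by_cases hn : r n = 0
  · have : A n = 0 := by rw [hA, thetaVec_apply hr hz, hn]; simp
    rw [this]
    simp
  · rw [hB', deriv_erfcVec_apply hr τ.im_pos hn]
    have : (Real.sqrt τ.im : ℂ) ≠ 0 := by exact_mod_cast (Real.sqrt_pos.2 τ.im_pos).ne'
    field_simp
    ring

end NonholomorphicDeriv

/-! ### Integrality of the coefficients of 1/η³ -/

section EtaInverse

open Filter Topology Set

theorem exists_e_eq {q : ℂ} (hq0 : q ≠ 0) (hq : ‖q‖ < 1) : ∃ τ : ℍ, e τ = q := by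
  have hI := Complex.two_pi_I_ne_zero
  have he : e (Complex.log q / (2 * Real.pi * Complex.I)) = q := by
    rw [e, mul_div_cancel₀ _ hI, Complex.exp_log hq0]
  have him : 0 < (Complex.log q / (2 * Real.pi * Complex.I)).im := by
    have h1 := norm_e_mul 1 (Complex.log q / (2 * Real.pi * Complex.I))
    rw [Complex.ofReal_one, one_mul, he] at h1
    rw [h1, Real.exp_lt_one_iff] at hq
    nlinarith [Real.pi_pos]
  exact ⟨⟨_, him⟩, he⟩

/-- The triangular numbers. -/
def triangular (n : ℕ) : ℕ := n * (n + 1) / 2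

theorem triangular_mul_two (n : ℕ) : triangular n * 2 = n * (n + 1) :=
  Nat.div_mul_cancel (Nat.even_mul_succ_self n).two_dvd

theorem triangular_injective : Function.Injective triangular := by
  have : StrictMono triangular := strictMono_nat_of_lt_succ fun n => by
    have h1 := triangular_mul_two n
    have h2 := triangular_mul_two (n + 1)
    nlinarith
  exact this.injective

/-- The coefficients of `∏ (1 - q^n)³ = ∑ (-1)^n (2n+1) q^{n(n+1)/2}`. -/
noncomputable def jacobiCoeff : ℕ → ℤ :=
  Function.extend triangular (fun n => (-1) ^ n * (2 * n + 1)) 0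

theorem jacobiCoeff_zero : jacobiCoeff 0 = 1 := by
  have := triangular_injective.extend_apply (fun n : ℕ => (-1 : ℤ) ^ n * (2 * n + 1)) 0 0
  simpa [triangular, jacobiCoeff] using this

theorem hasSum_natCast_of_int {F : ℤ → ℂ} {S : ℂ} (h : HasSum (fun n : ℤ => if 0 ≤ n then F n else 0) S) :
    HasSum (fun n : ℕ => F n) S := by
  have h1 := (Function.Injective.hasSum_iff (Nat.cast_injective (R := ℤ))
    (f := fun n : ℤ => if 0 ≤ n then F n else 0) (a := S) fun n hn => ?_).2 h
  · refine h1.congr_fun fun n => ?_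
    simp
  · rw [if_neg]
    rintro h0
    lift n to ℕ using h0
    exact hn (mem_range_self n)

/-- The indices m and -m contribute equally to the theta constant, so Jacobi's identity becomes a
one-sided sum; m²/2 = 1/8 + n(n+1)/2 turns it into a power series in q. -/
theorem hasSum_jacobiCoeff_triangular (τ : ℍ) :
    HasSum (fun n : ℕ => ((-1) ^ n * (2 * n + 1) : ℂ) * e τ ^ triangular n)
      (etaCubed τ * e (-(τ / 8))) := by
  have hs := summable_thetaConst τ.2
  have h0 := tsum_ite_nonneg (F := fun n : ℤ => ((n : ℂ) + 1 / 2) * thetaCoeff τ n) (fun n => by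
    rw [thetaCoeff_neg]; push_cast; ring) hs
  rw [← thetaConst, thetaConst_eq] at h0
  have h1 : Summable fun n : ℤ => if 0 ≤ n then ((n : ℂ) + 1 / 2) * thetaCoeff τ n else 0 :=
    (hs.indicator {n : ℤ | 0 ≤ n}).congr fun n => by simp [indicator]
  have h2 := (hasSum_natCast_of_int (h0 ▸ h1.hasSum)).mul_left (2 * -Complex.I * e (-(τ / 8)))
  have hS : 2 * -Complex.I * e (-(τ / 8)) * (1 / 2 * (Complex.I * etaCubed τ)) =
      etaCubed τ * e (-(τ / 8)) := by
    linear_combination (-(etaCubed τ * e (-(τ / 8)))) * Complex.I_sq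
  rw [hS] at h2
  refine h2.congr_fun fun n => ?_
  have h3 : thetaCoeff τ (n : ℤ) = Complex.I * (-1) ^ n * e (τ / 8) * e τ ^ triangular n := by
    have ht : (triangular n : ℂ) * 2 = n * (n + 1) := by exact_mod_cast triangular_mul_two n
    rw [thetaCoeff, ← e_nat_mul, ← e_half, ← e_nat_mul, ← e_quarter, ← e_add, ← e_add, ← e_add]
    congr 1
    push_cast
    linear_combination (-(τ : ℂ) / 2) * ht
  rw [h3, e_neg]
  have := e_ne_zero (τ / 8)
  push_cast
  field_simp
  linear_combination (2 * n + 1) * e τ ^ triangular n * Complex.I_sq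

theorem hasSum_jacobiCoeff (τ : ℍ) :
    HasSum (fun k : ℕ => (jacobiCoeff k : ℂ) * e τ ^ k) (etaCubed τ * e (-(τ / 8))) := by
  refine (triangular_injective.hasSum_iff fun k hk => ?_).1
    ((hasSum_jacobiCoeff_triangular τ).congr_fun fun n => ?_)
  · rw [jacobiCoeff, Function.extend_apply' _ _ _ (by simpa using hk)]
    simp
  · simp only [Function.comp_apply, jacobiCoeff]
    rw [triangular_injective.extend_apply]
    push_cast
    rfl

theorem summable_jacobiCoeff {q : ℂ} (hq : ‖q‖ < 1) :
    Summable fun k : ℕ => ‖(jacobiCoeff k : ℂ) * q ^ k‖ := by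
  rcases eq_or_ne q 0 with rfl | hq0
  · refine summable_of_ne_finset_zero (s := {0}) fun k hk => ?_
    rw [zero_pow (by simpa using hk), mul_zero, norm_zero]
  · obtain ⟨τ, rfl⟩ := exists_e_eq hq0 hq
    exact (hasSum_jacobiCoeff τ).summable.norm

/-- The power series `∑ (-1)^n (2n+1) q^{n(n+1)/2}`. -/
noncomputable def jacobiSeries (q : ℂ) : ℂ := ∑' k : ℕ, (jacobiCoeff k : ℂ) * q ^ k

/-- Off the origin the value is η³ times an exponential, and η has no zeros; at the origin it is 1.
-/
theorem jacobiSeries_ne_zero {q : ℂ} (hq : ‖q‖ < 1) : jacobiSeries q ≠ 0 := by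
  rcases eq_or_ne q 0 with rfl | hq0
  · rw [jacobiSeries, tsum_eq_single 0 fun k hk => by rw [zero_pow hk, mul_zero], jacobiCoeff_zero]
    simp
  · obtain ⟨τ, rfl⟩ := exists_e_eq hq0 hq
    rw [jacobiSeries, (hasSum_jacobiCoeff τ).tsum_eq]
    exact mul_ne_zero (etaCubed_ne_zero τ) (e_ne_zero _)

theorem differentiableOn_jacobiSeries : DifferentiableOn ℂ jacobiSeries (Metric.ball 0 1) := by
  intro q hq
  rw [mem_ball_zero_iff] at hq
  obtain ⟨ρ, hqρ, hρ1⟩ := exists_between hq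
  have hρ0 : 0 ≤ ρ := (norm_nonneg q).trans hqρ.le
  have hs := summable_jacobiCoeff (q := (ρ : ℂ)) (by rwa [Complex.norm_real, Real.norm_of_nonneg hρ0])
  have hd := Complex.differentiableOn_tsum_of_summable_norm
    (F := fun (k : ℕ) (q : ℂ) => (jacobiCoeff k : ℂ) * q ^ k) hs
    (fun k => ((differentiable_id.pow k).const_mul _).differentiableOn)
    (Metric.isOpen_ball (x := (0 : ℂ)) (ε := ρ)) fun k w hw => by
      rw [norm_mul, norm_mul, norm_pow, norm_pow, Complex.norm_real, Real.norm_of_nonneg hρ0]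
      rw [mem_ball_zero_iff] at hw
      gcongr
  exact (hd.differentiableAt (Metric.isOpen_ball.mem_nhds
    (by rwa [mem_ball_zero_iff]))).differentiableWithinAt

theorem power_series_unique {b b' : ℕ → ℂ} {F : ℂ → ℂ}
    (h : ∀ q : ℂ, ‖q‖ < 1 → HasSum (fun k => b k * q ^ k) (F q))
    (h' : ∀ q : ℂ, ‖q‖ < 1 → HasSum (fun k => b' k * q ^ k) (F q)) : b = b' := by
  have key : ∀ c : ℕ → ℂ, (∀ q : ℂ, ‖q‖ < 1 → HasSum (fun k => c k * q ^ k) (F q)) →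
      HasFPowerSeriesAt F (FormalMultilinearSeries.ofScalars ℂ c) 0 := by
    intro c hc
    rw [hasFPowerSeriesAt_iff]
    filter_upwards [Metric.ball_mem_nhds (0 : ℂ) one_pos] with q hq
    rw [mem_ball_zero_iff] at hq
    rw [zero_add]
    refine (hc q hq).congr_fun fun k => ?_
    rw [FormalMultilinearSeries.coeff_ofScalars, smul_eq_mul, mul_comm]
  exact FormalMultilinearSeries.ofScalars_series_injective ℂ ℂ
    ((key b h).eq_formalMultilinearSeries (key b' h'))

/-- The power series of `1 / ∏ (1 - q^n)³` has integral coefficients. -/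
theorem exists_hasSum_inv_jacobiSeries : ∃ d : ℕ → ℤ, ∀ q : ℂ, ‖q‖ < 1 →
    HasSum (fun k => (d k : ℂ) * q ^ k) (jacobiSeries q)⁻¹ := by
  have hd : DifferentiableOn ℂ (fun q => (jacobiSeries q)⁻¹) (Metric.ball 0 1) :=
    differentiableOn_jacobiSeries.inv fun q hq => jacobiSeries_ne_zero (mem_ball_zero_iff.1 hq)
  set c : ℕ → ℂ := fun k => ((k.factorial : ℂ))⁻¹ * iteratedDeriv k (fun q => (jacobiSeries q)⁻¹) 0
  have hc : ∀ q : ℂ, ‖q‖ < 1 → HasSum (fun k => c k * q ^ k) (jacobiSeries q)⁻¹ := by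
    intro q hq
    have := Complex.hasSum_taylorSeries_on_ball hd (mem_ball_zero_iff.2 hq)
    refine this.congr_fun fun k => ?_
    simp only [c, smul_eq_mul, sub_zero]
    ring
  -- The Cauchy product of the series with its inverse is the constant series 1, by uniqueness of
  -- power series.
  have hprod : (fun k => ∑ p ∈ Finset.HasAntidiagonal.antidiagonal k, (jacobiCoeff p.1 : ℂ) * c p.2) =
      fun k : ℕ => if k = 0 then (1 : ℂ) else 0 := by
    refine power_series_unique (F := fun _ => 1) (fun q hq => ?_) fun q hq => ?_
    · have h1 := summable_jacobiCoeff hq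
      have h2 := (hc q hq).summable.norm
      have h3 := tsum_mul_tsum_eq_tsum_sum_antidiagonal_of_summable_norm h1 h2
      have h4 := summable_norm_sum_mul_antidiagonal_of_summable_norm h1 h2
      rw [(hc q hq).tsum_eq, ← jacobiSeries, mul_inv_cancel₀ (jacobiSeries_ne_zero hq)] at h3
      have h5 := h4.of_norm.hasSum
      rw [← h3] at h5
      refine h5.congr_fun fun k => ?_
      rw [Finset.sum_mul]
      refine Finset.sum_congr rfl fun p hp => ?_
      rw [← Finset.HasAntidiagonal.mem_antidiagonal.1 hp, pow_add]
      ring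
    · have := hasSum_single (f := fun k : ℕ => (if k = 0 then (1 : ℂ) else 0) * q ^ k) 0
        fun k hk => by rw [if_neg hk, zero_mul]
      simpa using this
  -- As the series has constant term 1, the recursion expresses each coefficient of the inverse
  -- integrally through earlier ones.
  have hint : ∀ k, ∃ m : ℤ, c k = m := by
    intro k
    induction k using Nat.strong_induction_on with
    | _ k ih =>
      have hk := congrFun hprod k
      cases k with
      | zero =>
        simp only [Finset.Nat.antidiagonal_zero, Finset.sum_singleton, jacobiCoeff_zero,
          if_true] at hk
        exact ⟨1, by simpa using hk⟩
      | succ k =>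
        rw [Finset.Nat.sum_antidiagonal_succ, jacobiCoeff_zero, if_neg (Nat.succ_ne_zero k),
          Int.cast_one, one_mul] at hk
        choose! m hm using ih
        refine ⟨-∑ p ∈ Finset.HasAntidiagonal.antidiagonal k, jacobiCoeff (p.1 + 1) * m p.2, ?_⟩
        rw [eq_neg_of_add_eq_zero_left hk]
        push_cast
        congr 1
        refine Finset.sum_congr rfl fun p hp => ?_
        rw [← hm p.2 (by have := Finset.HasAntidiagonal.mem_antidiagonal.1 hp; omega)]
  choose d hd using hint
  exact ⟨d, fun q hq => by simpa only [hd] using hc q hq⟩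

theorem exists_hasSum_inv_etaCubed : ∃ d : ℕ → ℤ, ∀ τ : ℍ,
    HasSum (fun k : ℕ => (d k : ℂ) * e (((k : ℂ) - 1 / 8) * τ)) (etaCubed τ)⁻¹ := by
  obtain ⟨d, hd⟩ := exists_hasSum_inv_jacobiSeries
  refine ⟨d, fun τ => ?_⟩
  have hq : ‖e τ‖ < 1 := by
    have h1 := norm_e_mul 1 τ
    rw [Complex.ofReal_one, one_mul] at h1
    rw [h1, Real.exp_lt_one_iff]
    have : 0 < (τ : ℂ).im := τ.2
    nlinarith [mul_pos Real.pi_pos this]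
  have h := (hd (e τ) hq).mul_left (e (-(τ / 8)))
  have h2 : e (-(τ / 8)) * (jacobiSeries (e τ))⁻¹ = (etaCubed τ)⁻¹ := by
    rw [jacobiSeries, (hasSum_jacobiCoeff τ).tsum_eq]
    have := e_ne_zero (-(τ / 8))
    have := etaCubed_ne_zero τ
    field_simp
  rw [h2] at h
  refine h.congr_fun fun k => ?_
  rw [← e_nat_mul, mul_left_comm, ← e_add]
  congr 2
  ring

end EtaInverse

/-! ### Collecting terms with equal exponents -/

section Regroup

variable {κ : Type*}

/-- The total coefficient at the exponent `n` of a family of terms with coefficients `c` and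
exponents `ν`. -/
noncomputable def fibreSum (c : κ → ℂ) (ν : κ → ℚ) (n : ℚ) : ℂ := ∑' i : {i // ν i = n}, c i

theorem hasSum_fibreSum {c : κ → ℂ} {ν : κ → ℚ} {φ : ℚ → ℂ} {S : ℂ}
    (h : HasSum (fun i => c i * φ (ν i)) S) : HasSum (fun n => fibreSum c ν n * φ n) S := by
  refine ((Equiv.sigmaFiberEquiv ν).hasSum_iff.2 h).sigma fun n => ?_
  have hs := (h.summable.subtype {i | ν i = n}).hasSum
  have he : (fun i : {i // ν i = n} => c i * φ (ν i)) = fun i : {i // ν i = n} => c i * φ n := by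
    funext i
    rw [i.2]
  have ht : ∑' i : {i // ν i = n}, c i * φ (ν i) = fibreSum c ν n * φ n := by
    rw [he, tsum_mul_right, fibreSum]
  rw [← ht]
  exact hs

theorem exists_of_fibreSum_ne_zero {c : κ → ℂ} {ν : κ → ℚ} {n : ℚ} (h : fibreSum c ν n ≠ 0) :
    ∃ i, ν i = n ∧ c i ≠ 0 := by
  by_contra! hc
  refine h ?_
  rw [fibreSum, ← tsum_zero (α := ℂ) (β := {i // ν i = n})]
  exact tsum_congr fun i => hc i i.2

/-- The partial sums lie in ℤ, which is closed in ℂ, so the limit does too. Without summability the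
sum is 0 by convention. Thus finiteness of the fibres is never needed. -/
theorem exists_tsum_eq_intCast {f : κ → ℂ} (h : ∀ i, ∃ m : ℤ, f i = m) :
    ∃ m : ℤ, ∑' i, f i = m := by
  by_cases hs : Summable f
  · have hcl : IsClosed (Set.range fun m : ℤ => ((m : ℝ) : ℂ)) :=
      (Complex.isometry_ofReal.isClosedEmbedding.comp Int.isClosedEmbedding_coe_real).isClosed_range
    obtain ⟨m, hm⟩ := hcl.mem_of_tendsto hs.hasSum (Filter.Eventually.of_forall fun s => by
      choose F hF using h
      exact ⟨∑ i ∈ s, F i, by push_cast; exact Finset.sum_congr rfl fun i _ => (hF i).symm⟩)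
    exact ⟨m, by rw [← hm]; norm_cast⟩
  · exact ⟨0, by rw [tsum_eq_zero_of_not_summable hs, Int.cast_zero]⟩

theorem exists_fibreSum_eq_div {c : κ → ℂ} {ν : κ → ℚ} {M : ℂ} (hM : M ≠ 0)
    (h : ∀ i, ∃ m : ℤ, M * c i = m) (n : ℚ) : ∃ m : ℤ, fibreSum c ν n = m / M := by
  obtain ⟨m, hm⟩ := exists_tsum_eq_intCast (f := fun i : {i // ν i = n} => M * c i) fun i => h i
  rw [tsum_mul_left] at hm
  exact ⟨m, by rw [← hm, fibreSum, mul_div_cancel_left₀ _ hM]⟩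

end Regroup

/-! ### The q-expansion of the holomorphic part -/

section Expansion

variable (N : ℕ)

/-- The points of the coset `Nℤ + h` as rational numbers. -/
def cosetPoint (h : Disc N) (n : ℤ) : ℚ := ((N ^ 2 * n + h.val : ℤ) : ℚ) / N

theorem cast_cosetPoint [NeZero N] (h : Disc N) (n : ℤ) :
    ((cosetPoint N h n : ℚ) : ℝ) = (N : ℝ) * n + rep N h := by
  rw [coset_eq_div, cosetPoint]
  push_cast
  rfl

theorem e_half_int (m : ℤ) : e (m / 2) = 1 ∨ e (m / 2) = -1 := by
  have h : e (m / 2) ^ 2 = 1 := by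
    rw [← e_nat_mul]
    refine Eq.trans ?_ (e_int m)
    congr 1
    push_cast
    ring
  exact mul_self_eq_one_iff.1 (by rwa [← sq])

theorem thetaCoeff_eq (τ : ℂ) (m : ℤ) :
    thetaCoeff τ m = Complex.I * e (m / 2) * e (((m : ℂ) + 1 / 2) ^ 2 / 2 * τ) := by
  rw [thetaCoeff, ← e_quarter, ← e_add, ← e_add]
  congr 1
  ring

/-- The terms of the double series `∑_r η³ g⁺(r)`. -/
noncomputable def mockTerm (h : Disc N) (τ : ℂ) (p : ℤ × ℤ) : ℂ :=
  (Real.sign (cosetPoint N h p.1) : ℂ) * (cutoff p.2 |(cosetPoint N h p.1 : ℝ)| : ℂ) *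
    e (p.2 / 2) * e ((((p.2 : ℂ) + 1 / 2) ^ 2 - (cosetPoint N h p.1 : ℂ) ^ 2) / 2 * τ)

theorem gTerm_eq_mockTerm (h : Disc N) (τ : ℂ) (p : ℤ × ℤ) :
    gTerm τ p.2 (cosetPoint N h p.1) = Complex.I * mockTerm N h τ p := by
  have : (((p.2 : ℂ) + 1 / 2) ^ 2 - (cosetPoint N h p.1 : ℂ) ^ 2) / 2 * τ =
      ((p.2 : ℂ) + 1 / 2) ^ 2 / 2 * τ + -((cosetPoint N h p.1 : ℂ) ^ 2 / 2 * τ) := by ring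
  rw [gTerm, mockTerm, thetaCoeff_eq, this, e_add, Complex.ofReal_ratCast]
  ring

variable {N} [NeZero N]

/-- The gap m - |r| ≥ 1/(2N) bounds a term by m·exp(-2bm). Since |r| < m, this is at most
m·exp(-bm)·exp(-b|r|), a product of summable families. -/
theorem summable_mockTerm (hN : Even N) (h : Disc N) (τ : ℍ) :
    Summable fun p => ‖mockTerm N h τ p‖ := by
  have hN0 : (0 : ℝ) < N := by exact_mod_cast NeZero.pos N
  set b : ℝ := Real.pi * τ.im * (1 / (2 * N)) / 2 with hb
  have hb0 : 0 < b := by have := τ.im_pos; have := Real.pi_pos; positivity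
  have hs := (summable_exp_neg_coset N hb0 (rep N h)).mul_of_nonneg
    (summable_abs_mul_exp_neg_mul_abs hb0 (1 / 2)) (fun n => (Real.exp_pos _).le)
    (fun m => mul_nonneg (abs_nonneg _) (Real.exp_pos _).le)
  refine Summable.of_nonneg_of_le (fun _ => norm_nonneg _) (fun p => ?_) hs
  obtain ⟨n, m⟩ := p
  have hnorm : ‖mockTerm N h τ (n, m)‖ = ‖gTerm τ m (cosetPoint N h n)‖ := by
    rw [gTerm_eq_mockTerm N h τ (n, m), norm_mul, Complex.norm_I, one_mul]
  rw [hnorm]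
  have hr := cast_cosetPoint N h n
  simp only
  rw [← hr]
  set r : ℝ := ((cosetPoint N h n : ℚ) : ℝ) with hrdef
  by_cases hc : cutoff m |r| = 0
  · rw [gTerm, hc]
    simp only [Complex.ofReal_zero, zero_mul, mul_zero, norm_zero]
    positivity
  · have hne : (m : ℝ) + 1 / 2 ≠ r := fun hm => hc (cutoff_eq_zero (hm ▸ le_abs_self r))
    have hδ := add_le_of_cutoff_ne_zero (ε := 0) hN (N ^ 2 * n + h.val) (hr.trans (coset_eq_div N h n))
      le_rfl (by positivity) hne (by rwa [sub_zero])
    rw [sub_zero] at hδ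
    have hδ0 : (0 : ℝ) < 1 / (2 * N) := by positivity
    have hm0 : 0 < (m : ℝ) + 1 / 2 := by linarith [abs_nonneg r]
    refine (norm_gTerm_le τ m r (by linarith)).trans ?_
    rw [abs_of_pos hm0, mul_left_comm, ← Real.exp_add]
    have hπ : 0 < Real.pi * τ.im := mul_pos Real.pi_pos τ.im_pos
    refine mul_le_mul (by linarith [abs_nonneg r]) (Real.exp_le_exp.2 ?_) (Real.exp_pos _).le hm0.le
    have h1 : (m + 1 / 2 : ℝ) * (1 / (2 * N)) ≤ (m + 1 / 2) * (m + 1 / 2 - |r|) :=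
      mul_le_mul_of_nonneg_left (by linarith) hm0.le
    have h2 := mul_le_mul_of_nonneg_left h1 hπ.le
    have h3 : b * |r| ≤ b * (m + 1 / 2) := mul_le_mul_of_nonneg_left (by linarith) hb0.le
    have h4 : b * (m + 1 / 2) + b * (m + 1 / 2) =
        Real.pi * τ.im * ((m + 1 / 2 : ℝ) * (1 / (2 * N))) := by rw [hb]; ring
    linarith

theorem tsum_mockTerm (hN : Even N) (h : Disc N) (τ : ℍ) :
    ∑' p, mockTerm N h τ p = etaCubed τ * ∑' n : ℤ, gPlus τ ((N : ℝ) * n + rep N h) := by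
  rw [(summable_mockTerm hN h τ).of_norm.tsum_prod, ← tsum_mul_left]
  refine tsum_congr fun n => ?_
  have hη := etaCubed_ne_zero τ
  rw [← cast_cosetPoint, gPlus_eq_tsum, tsum_congr fun m => gTerm_eq_mockTerm N h τ (n, m),
    tsum_mul_left]
  field_simp [Complex.I_ne_zero]

theorem summable_gPlus (hN : Even N) (h : Disc N) (τ : ℍ) :
    Summable fun n : ℤ => gPlus τ ((N : ℝ) * n + rep N h) := by
  refine ((summable_mockTerm hN h τ).of_norm.prod.mul_left (etaCubed τ)⁻¹).congr fun n => ?_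
  have hη := etaCubed_ne_zero τ
  rw [← cast_cosetPoint, gPlus_eq_tsum, tsum_congr fun m => gTerm_eq_mockTerm N h τ (n, m),
    tsum_mul_left]
  field_simp [Complex.I_ne_zero]

/-- The Fourier coefficients of `E₂`. -/
def e2Coeff (m : ℕ) : ℤ := if m = 0 then 1 else -24 * (ArithmeticFunction.sigma 1 m : ℤ)

theorem hasSum_e2Coeff (τ : ℍ) :
    HasSum (fun m : ℕ => (e2Coeff m : ℂ) * e (m * τ)) (EisensteinSeries.E2 τ) := by
  refine (EisensteinSeries.hasSum_qExpansion_E2 τ).congr_fun fun m => ?_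
  rw [e_nat_mul, smul_eq_mul, e2Coeff]
  split_ifs <;> simp [e]

variable (N)

open Classical in
/-- The coefficients of the terms of the holomorphic part of `θ̃_{N,h}`, where `d` are the
coefficients of `η⁻³`. -/
noncomputable def holoCoeff (d : ℕ → ℤ) (h : Disc N) : (ℕ × ℕ) ⊕ ((ℤ × ℤ) × ℕ) → ℂ :=
  Sum.elim
    (fun p => if IsHalfIntegral N h then
      e ((rep N h : ℂ) / 2) / (12 * N * Complex.I) * (e2Coeff p.1 * d p.2) else 0)
    (fun p => (Real.sign (cosetPoint N h p.1.1) : ℂ) *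
      (cutoff p.1.2 |(cosetPoint N h p.1.1 : ℝ)| : ℂ) * e (p.1.2 / 2) * d p.2)

/-- The exponents of the terms of the holomorphic part of `θ̃_{N,h}`. -/
def holoExponent (h : Disc N) : (ℕ × ℕ) ⊕ ((ℤ × ℤ) × ℕ) → ℚ :=
  Sum.elim (fun p => p.1 + (p.2 - 1 / 8))
    (fun p => (((p.1.2 : ℚ) + 1 / 2) ^ 2 - cosetPoint N h p.1.1 ^ 2) / 2 + (p.2 - 1 / 8))

open Classical in
/-- The holomorphic part of `θ̃_{N,h}`. -/
noncomputable def thetaPlus (τ : ℍ) (h : Disc N) : ℂ :=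
  (if IsHalfIntegral N h then
    e ((rep N h : ℂ) / 2) * EisensteinSeries.E2 τ / (12 * N * Complex.I * etaCubed τ) else 0) +
  ∑' n : ℤ, gPlus τ ((N : ℝ) * n + rep N h)

variable {N}

/-- Both summands of `thetaPlus` are products of absolutely convergent series with the series of
1/η³, so they can be multiplied out freely. -/
theorem hasSum_holoCoeff (hN : Even N) {d : ℕ → ℤ}
    (hd : ∀ τ : ℍ, HasSum (fun k : ℕ => (d k : ℂ) * e (((k : ℂ) - 1 / 8) * τ)) (etaCubed τ)⁻¹)
    (h : Disc N) (τ : ℍ) :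
    HasSum (fun i => holoCoeff N d h i * e (holoExponent N h i * τ)) (thetaPlus N τ h) := by
  have hη := etaCubed_ne_zero τ
  have hdn := (hd τ).summable.norm
  refine HasSum.sum ?_ ?_
  · have h1 := hasSum_e2Coeff τ
    have h2 : HasSum (fun p : ℕ × ℕ => ((e2Coeff p.1 : ℂ) * e (p.1 * τ)) *
        ((d p.2 : ℂ) * e (((p.2 : ℂ) - 1 / 8) * τ))) (EisensteinSeries.E2 τ * (etaCubed τ)⁻¹) := by
      have := (summable_mul_of_summable_norm h1.summable.norm hdn).hasSum
      rwa [← tsum_mul_tsum_of_summable_norm h1.summable.norm hdn, h1.tsum_eq, (hd τ).tsum_eq] at this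
    by_cases hh : IsHalfIntegral N h
    · rw [if_pos hh]
      have h3 := h2.mul_left (e ((rep N h : ℂ) / 2) / (12 * N * Complex.I))
      convert! h3 using 1
      · funext p
        simp only [Function.comp_apply, holoCoeff, holoExponent, Sum.elim_inl, if_pos hh]
        have : (((p.1 + (p.2 - 1 / 8) : ℚ)) : ℂ) * (τ : ℂ) = p.1 * τ + ((p.2 : ℂ) - 1 / 8) * τ := by
          push_cast; ring
        rw [this, e_add]
        ring
      · have : (N : ℂ) ≠ 0 := Nat.cast_ne_zero.2 (NeZero.ne N)
        field_simp [Complex.I_ne_zero]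
    · rw [if_neg hh]
      convert! hasSum_zero (α := ℂ) (β := ℕ × ℕ) using 2 with p
      simp [holoCoeff, if_neg hh]
  · have hm := summable_mockTerm hN h τ
    have h2 := (summable_mul_of_summable_norm hm hdn).hasSum
    rw [← tsum_mul_tsum_of_summable_norm hm hdn, (hd τ).tsum_eq, tsum_mockTerm hN] at h2
    convert! h2 using 1
    · funext p
      simp only [Function.comp_apply, holoCoeff, holoExponent, Sum.elim_inr, mockTerm]
      have : (((((p.1.2 : ℚ) + 1 / 2) ^ 2 - cosetPoint N h p.1.1 ^ 2) / 2 + (p.2 - 1 / 8) : ℚ) : ℂ)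
          * (τ : ℂ) = (((p.1.2 : ℂ) + 1 / 2) ^ 2 - (cosetPoint N h p.1.1 : ℂ) ^ 2) / 2 * τ +
          ((p.2 : ℂ) - 1 / 8) * τ := by
        push_cast; ring
      rw [this, e_add]
      ring
    · field_simp

/-- Only m > |r| contributes, so (m² - r²)/2 > 0 and the only negative contribution is the -1/8 from
1/η³. -/
theorem le_holoExponent {N : ℕ} {d : ℕ → ℤ} {h : Disc N} {i : (ℕ × ℕ) ⊕ ((ℤ × ℤ) × ℕ)}
    (hi : holoCoeff N d h i ≠ 0) : -1 / 8 ≤ holoExponent N h i := by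
  rcases i with ⟨j, k⟩ | ⟨⟨n, m⟩, k⟩
  · simp only [holoExponent, Sum.elim_inl]
    have : (0 : ℚ) ≤ j := j.cast_nonneg
    have : (0 : ℚ) ≤ k := k.cast_nonneg
    linarith
  · simp only [holoExponent, Sum.elim_inr]
    have hk : (0 : ℚ) ≤ k := k.cast_nonneg
    have hlt : |(cosetPoint N h n : ℝ)| < (m : ℝ) + 1 / 2 := by
      by_contra hlt
      refine hi ?_
      simp [holoCoeff, cutoff_eq_zero (not_lt.1 hlt)]
    have hq : |cosetPoint N h n| < (m : ℚ) + 1 / 2 := by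
      rw [← Rat.cast_lt (K := ℝ)]
      push_cast
      exact hlt
    have := sq_lt_sq.2 (hq.trans_le (le_abs_self _))
    linarith

theorem exists_holoExponent_eq (h : Disc N) (i : (ℕ × ℕ) ⊕ ((ℤ × ℤ) × ℕ)) :
    ∃ m : ℤ, holoExponent N h i = m / (8 * N ^ 2 : ℕ) := by
  have hN : (N : ℚ) ≠ 0 := Nat.cast_ne_zero.2 (NeZero.ne N)
  rcases i with ⟨j, k⟩ | ⟨⟨n, m⟩, k⟩
  · refine ⟨(8 * j + 8 * k - 1) * N ^ 2, ?_⟩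
    simp only [holoExponent, Sum.elim_inl]
    push_cast
    field_simp
    ring
  · refine ⟨(4 * (m ^ 2 + m) + 8 * k) * N ^ 2 - 4 * (N ^ 2 * n + h.val) ^ 2, ?_⟩
    simp only [holoExponent, Sum.elim_inr, cosetPoint]
    push_cast
    field_simp
    ring

theorem exists_sign_eq (x : ℝ) : ∃ m : ℤ, (Real.sign x : ℂ) = m := by
  rcases Real.sign_apply_eq x with h | h | h
  · exact ⟨-1, by simp [h]⟩
  · exact ⟨0, by simp [h]⟩
  · exact ⟨1, by simp [h]⟩

theorem exists_e_half_int_eq (m : ℤ) : ∃ k : ℤ, e (m / 2) = k := by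
  rcases e_half_int m with h | h
  · exact ⟨1, by rw [h, Int.cast_one]⟩
  · exact ⟨-1, by rw [h, Int.cast_neg, Int.cast_one]⟩

theorem exists_mul_cutoff_eq (hN : Even N) (h : Disc N) (n m : ℤ) :
    ∃ k : ℤ, (N : ℂ) * (cutoff m |(cosetPoint N h n : ℝ)| : ℂ) = k := by
  obtain ⟨M, hM⟩ := hN
  have hNr : (N : ℝ) ≠ 0 := Nat.cast_ne_zero.2 (NeZero.ne N)
  have hMr : (N : ℝ) = M + M := by exact_mod_cast hM
  rcases le_total |(cosetPoint N h n : ℝ)| ((m : ℝ) + 1 / 2) with hle | hle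
  · refine ⟨N * m + M - |(N ^ 2 * n + h.val : ℤ)|, ?_⟩
    have hr : (N : ℝ) * |(cosetPoint N h n : ℝ)| = |(((N ^ 2 * n + h.val : ℤ)) : ℝ)| := by
      rw [cast_cosetPoint, coset_eq_div, abs_div, Nat.abs_cast, mul_div_cancel₀ _ hNr]
    have : (N : ℝ) * cutoff m |(cosetPoint N h n : ℝ)| =
        ((N * m + M - |(N ^ 2 * n + h.val : ℤ)| : ℤ) : ℝ) := by
      rw [cutoff_eq hle, mul_sub, hr]
      push_cast
      linarith
    have h2 := congrArg Complex.ofReal this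
    rwa [Complex.ofReal_mul, Complex.ofReal_natCast, Complex.ofReal_intCast] at h2
  · exact ⟨0, by rw [cutoff_eq_zero hle]; simp⟩

/-- On a half-integral coset 𝐞(h/2)/i = ±1, which leaves the explicit denominator 12N; in the double
series only the weight m - |r| has a denominator, and it divides N. -/
theorem exists_mul_holoCoeff_eq (hN : Even N) (d : ℕ → ℤ) (h : Disc N)
    (i : (ℕ × ℕ) ⊕ ((ℤ × ℤ) × ℕ)) : ∃ m : ℤ, (12 * N : ℂ) * holoCoeff N d h i = m := by
  have hNc : (N : ℂ) ≠ 0 := Nat.cast_ne_zero.2 (NeZero.ne N)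
  rcases i with ⟨j, k⟩ | ⟨⟨n, m⟩, k⟩
  · simp only [holoCoeff, Sum.elim_inl]
    split_ifs with hh
    · obtain ⟨l, hl⟩ := hh
      obtain ⟨s, hs⟩ := exists_e_half_int_eq l
      refine ⟨s * (e2Coeff j * d k), ?_⟩
      have : e ((rep N h : ℂ) / 2) = s * Complex.I := by
        rw [← hs, ← e_quarter, ← e_add, hl]
        congr 1
        push_cast
        ring
      rw [this]
      push_cast
      field_simp [Complex.I_ne_zero]
    · exact ⟨0, by simp⟩
  · obtain ⟨s, hs⟩ := exists_sign_eq (cosetPoint N h n)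
    obtain ⟨c, hc⟩ := exists_mul_cutoff_eq hN h n m
    obtain ⟨t, ht⟩ := exists_e_half_int_eq m
    refine ⟨12 * s * c * t * d k, ?_⟩
    simp only [holoCoeff, Sum.elim_inr]
    push_cast
    rw [← hs, ← hc, ← ht]
    ring

end Expansion

/-! ### The operator ∂/∂τ̄ on holomorphic functions -/

section Dbar

open Complex

variable {F G : ℍ → ℂ} {P : ℂ → ℂ}

theorem differentiableAt_comp_ofComplex (hP : DifferentiableOn ℂ P {z | 0 < z.im})
    (h : ∀ τ : ℍ, F τ = P τ) (τ : ℍ) :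
    DifferentiableAt ℂ (F ∘ UpperHalfPlane.ofComplex) τ :=
  (hP.differentiableAt ((isOpen_lt continuous_const continuous_im).mem_nhds τ.2)).congr_of_eventuallyEq
    (comp_ofComplex_eventuallyEq h τ.2)

theorem dbar_of_differentiableOn (hP : DifferentiableOn ℂ P {z | 0 < z.im})
    (h : ∀ τ : ℍ, F τ = P τ) (τ : ℍ) : dbar F τ = 0 := by
  have hd := differentiableAt_comp_ofComplex hP h τ
  have h1 := hd.fderiv_restrictScalars ℝ
  rw [dbar, h1]
  simp only [ContinuousLinearMap.coe_restrictScalars']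
  have h2 : fderiv ℂ (F ∘ UpperHalfPlane.ofComplex) τ I =
      I * fderiv ℂ (F ∘ UpperHalfPlane.ofComplex) τ 1 := by
    rw [← smul_eq_mul, ← map_smul, smul_eq_mul, mul_one]
  rw [h2, ← mul_assoc, I_mul_I]
  ring

theorem isRealAnalytic_of_differentiableOn (hP : DifferentiableOn ℂ P {z | 0 < z.im})
    (h : ∀ τ : ℍ, F τ = P τ) : IsRealAnalytic F := fun _ hz =>
  ((hP.analyticAt ((isOpen_lt continuous_const continuous_im).mem_nhds hz)).restrictScalars).congr
    (comp_ofComplex_eventuallyEq h hz).symm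

theorem dbar_sub {τ : ℍ} (hF : DifferentiableAt ℝ (F ∘ UpperHalfPlane.ofComplex) τ)
    (hG : DifferentiableAt ℝ (G ∘ UpperHalfPlane.ofComplex) τ) :
    dbar (fun τ => F τ - G τ) τ = dbar F τ - dbar G τ := by
  have : (fun τ => F τ - G τ) ∘ UpperHalfPlane.ofComplex =
      (F ∘ UpperHalfPlane.ofComplex) - (G ∘ UpperHalfPlane.ofComplex) := rfl
  rw [dbar, this, fderiv_sub hF hG, dbar, dbar]
  simp only [sub_apply]
  ring

end Dbar

/-! ### Harmonicity, growth and expansion of the completed theta function -/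

section Coset

variable (N : ℕ) [NeZero N]

theorem isLatticeLike_coset (h : Disc N) : IsLatticeLike fun n : ℤ => (N : ℝ) * n + rep N h := by
  have hN : (0 : ℝ) < N := by exact_mod_cast NeZero.pos N
  have hr : ∀ n : ℤ, (N : ℝ) * n + rep N h = N * (n + rep N h / N) := fun n => by field_simp
  constructor
  · have := ((Real.summable_one_div_int_add_rpow (rep N h / N) 2).2 one_lt_two).mul_left
      (1 / (N : ℝ) ^ 2)
    refine this.congr fun n => ?_
    rw [hr, mul_pow, Real.rpow_two, sq_abs, div_mul_div_comm, one_mul]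
  · intro b hb
    -- The factor e^{b/4} comes from y² ≥ y - 1/4, which trades the Gaussian for an exponential.
    have := (summable_abs_mul_exp_neg_mul_abs (mul_pos hb hN) (rep N h / N)).mul_left
      (Real.exp (b / 4) * N)
    refine this.of_nonneg_of_le (fun n => by positivity) fun n => ?_
    set x : ℝ := n + rep N h / N with hx
    rw [hr, abs_mul, abs_of_pos hN]
    have h1 : Real.exp (-b * (N * x) ^ 2) ≤ Real.exp (b / 4) * Real.exp (-(b * N * |x|)) := by
      rw [← Real.exp_add]
      refine Real.exp_le_exp.2 ?_
      have h2 : (N * |x|) ^ 2 = (N * x) ^ 2 := by rw [mul_pow, sq_abs, mul_pow]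
      rw [← h2]
      nlinarith [mul_nonneg hb.le (sq_nonneg (N * |x| - 1 / 2))]
    calc _ ≤ N * |x| * (Real.exp (b / 4) * Real.exp (-(b * N * |x|))) := by gcongr
      _ = _ := by ring

/-- The non-holomorphic part of `θ̃_{N,h}`, up to sign. -/
noncomputable def thetaStar (τ : ℍ) (h : Disc N) : ℂ :=
  ∑' n : ℤ, gStar τ ((N : ℝ) * n + rep N h)

variable {N}

theorem thetaTilde_eq (hN : Even N) (τ : ℍ) (h : Disc N) :
    thetaTilde N τ h = thetaPlus N τ h - thetaStar N τ h := by
  have hs := (hasSum_gStar (isLatticeLike_coset N h) τ).summable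
  rw [thetaTilde, thetaPlus, thetaStar, add_sub_assoc, ← (summable_gPlus hN h τ).tsum_sub hs]
  rfl

/-- The holomorphic part is an exponential series with exponents bounded below by -1/8, to which
`differentiableOn_tsum_mul_e` applies. -/
theorem exists_differentiableOn_thetaPlus (hN : Even N) (h : Disc N) :
    ∃ P : ℂ → ℂ, DifferentiableOn ℂ P {z | 0 < z.im} ∧ ∀ τ : ℍ, thetaPlus N τ h = P τ := by
  obtain ⟨d, hd⟩ := exists_hasSum_inv_etaCubed
  have hs := hasSum_holoCoeff hN hd h
  refine ⟨_, differentiableOn_tsum_mul_e (c := holoCoeff N d h)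
    (ν := fun i => (holoExponent N h i : ℝ)) (ν₀ := (-1 / 8 : ℚ))
    (fun i hi => by exact_mod_cast le_holoExponent hi) fun τ => ?_, fun τ => ?_⟩
  · simpa using (hs τ).summable
  · simpa using (hs τ).tsum_eq.symm

theorem exists_norm_thetaPlus_le (hN : Even N) (h : Disc N) :
    ∃ C : ℝ, ∀ τ : ℍ, 1 ≤ τ.im → ‖thetaPlus N τ h‖ ≤ C * Real.exp (Real.pi / 4 * τ.im) := by
  obtain ⟨d, hd⟩ := exists_hasSum_inv_etaCubed
  have hs := hasSum_holoCoeff hN hd h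
  obtain ⟨C, hC⟩ := exists_norm_tsum_mul_e_le (c := holoCoeff N d h)
    (ν := fun i => (holoExponent N h i : ℝ)) (ν₀ := (-1 / 8 : ℚ))
    (fun i hi => by exact_mod_cast le_holoExponent hi)
    (fun τ => by simpa using (hs τ).summable)
  refine ⟨C, fun τ hτ => ?_⟩
  have h1 := hC τ hτ
  simp only [Complex.ofReal_ratCast] at h1
  rw [(hs τ).tsum_eq] at h1
  refine h1.trans_eq ?_
  congr 2
  push_cast
  ring

theorem exists_norm_thetaStar_le (h : Disc N) :
    ∃ B : ℝ, ∀ τ : ℍ, 1 ≤ τ.im → ‖thetaStar N τ h‖ ≤ B := by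
  have hs := summable_exp_neg_coset N (b := Real.pi) Real.pi_pos (rep N h)
  refine ⟨∑' n : ℤ, Real.exp (Real.pi / 4) * Real.exp (-(Real.pi * |(N : ℝ) * n + rep N h|)),
    fun τ hτ => tsum_of_norm_bounded (hs.mul_left _).hasSum fun n => ?_⟩
  refine (norm_gStar_le τ _).trans ?_
  rw [← Real.exp_add]
  refine Real.exp_le_exp.2 ?_
  rw [← sq_abs]
  set x := |(N : ℝ) * n + rep N h|
  have h1 : Real.pi * x ^ 2 ≤ Real.pi * τ.im * x ^ 2 := by
    refine mul_le_mul_of_nonneg_right ?_ (sq_nonneg x)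
    nlinarith [Real.pi_pos]
  nlinarith [mul_nonneg Real.pi_pos.le (sq_nonneg (x - 1 / 2))]

theorem isRealAnalytic_thetaTilde (hN : Even N) (h : Disc N) :
    IsRealAnalytic fun τ => thetaTilde N τ h := by
  obtain ⟨P, hP, hPe⟩ := exists_differentiableOn_thetaPlus hN h
  have h1 := isRealAnalytic_of_differentiableOn (F := fun τ => thetaPlus N τ h) hP hPe
  have h2 := isRealAnalytic_tsum_gStar (isLatticeLike_coset N h)
  have h3 : (fun τ => thetaTilde N τ h) = fun τ => thetaPlus N τ h - thetaStar N τ h :=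
    funext fun τ => thetaTilde_eq hN τ h
  rw [h3]
  exact h1.sub h2

theorem unaryTheta_eq (N : ℕ) (τ : ℍ) (h : Disc N) : unaryTheta N τ h =
    ∑' n : ℤ, (((N : ℝ) * n + rep N h : ℝ) : ℂ) *
      e ((((((N : ℝ) * n + rep N h) ^ 2 / 2 : ℝ)) : ℂ) * τ) := by
  rw [unaryTheta]
  refine tsum_congr fun n => ?_
  push_cast
  rfl

theorem xi_thetaTilde (hN : Even N) (h : Disc N) (τ : ℍ) :
    xi (1 / 2) (fun τ => thetaTilde N τ h) τ =
      ((1 / Real.sqrt 2 : ℝ) : ℂ) * unaryTheta N τ h := by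
  obtain ⟨P, hP, hPe⟩ := exists_differentiableOn_thetaPlus hN h
  have h3 : (fun τ => thetaTilde N τ h) = fun τ => thetaPlus N τ h - thetaStar N τ h :=
    funext fun τ => thetaTilde_eq hN τ h
  have h4 : dbar (fun τ => thetaStar N τ h) τ = _ :=
    dbar_tsum_gStar (isLatticeLike_coset N h) τ
  have hU : ∑' n : ℤ, (((N : ℝ) * n + rep N h : ℝ) : ℂ) *
      e ((((N : ℝ) * n + rep N h : ℝ) : ℂ) ^ 2 / 2 * τ) = unaryTheta N τ h :=
    tsum_congr fun n => by push_cast; rfl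
  rw [h3, xi, dbar_sub (G := fun τ => thetaStar N τ h)
    ((differentiableAt_comp_ofComplex (F := fun τ => thetaPlus N τ h) hP hPe τ).restrictScalars ℝ)
    ((isRealAnalytic_tsum_gStar (isLatticeLike_coset N h)) τ τ.2).differentiableAt,
    dbar_of_differentiableOn (F := fun τ => thetaPlus N τ h) hP hPe, h4, hU]
  have hv : (Real.sqrt τ.im : ℂ) ≠ 0 := by
    exact_mod_cast (Real.sqrt_pos.2 τ.im_pos).ne'
  have h2 : (Real.sqrt 2 : ℂ) ≠ 0 := by exact_mod_cast (Real.sqrt_pos.2 two_pos).ne'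
  have hsq : (Real.sqrt 2 : ℂ) ^ 2 = 2 := by exact_mod_cast Real.sq_sqrt zero_le_two
  rw [← Real.sqrt_eq_rpow, zero_sub, neg_mul, neg_neg, map_mul, Complex.conj_conj, map_div₀,
    map_mul, map_mul, Complex.conj_I, Complex.conj_ofReal, Complex.conj_ofReal, map_ofNat]
  push_cast
  field_simp
  rw [hsq, Complex.I_sq]
  ring

/-- The nonzero points of the coset have `r² ≥ N⁻²`. -/
theorem le_sq_coset {h : Disc N} {n : ℤ} (hn : (((N : ℝ) * n + rep N h : ℝ) : ℂ) ≠ 0) :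
    1 / (2 * (N : ℝ) ^ 2) ≤ ((N : ℝ) * n + rep N h) ^ 2 / 2 := by
  have hN : (0 : ℝ) < N := by exact_mod_cast NeZero.pos N
  rw [Complex.ofReal_ne_zero, coset_eq_div] at hn
  rw [coset_eq_div]
  set K : ℤ := N ^ 2 * n + h.val
  have hK : K ≠ 0 := by
    intro h0
    rw [h0] at hn
    simp at hn
  have h1 : (1 : ℝ) ≤ (K : ℝ) ^ 2 := by
    exact_mod_cast Int.one_le_abs hK |>.trans (by nlinarith [sq_abs K, Int.one_le_abs hK])
  rw [div_pow, div_div, mul_comm _ (2 : ℝ)]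
  gcongr

theorem summable_unaryTheta (h : Disc N) (τ : ℍ) :
    Summable fun n : ℤ => (((N : ℝ) * n + rep N h : ℝ) : ℂ) *
      e ((((((N : ℝ) * n + rep N h) ^ 2 / 2 : ℝ)) : ℂ) * τ) := by
  refine Summable.of_norm (((isLatticeLike_coset N h).gauss (Real.pi * τ.im)
    (mul_pos Real.pi_pos τ.im_pos)).congr fun n => ?_)
  rw [norm_mul, norm_e_mul, Complex.norm_real, Real.norm_eq_abs, UpperHalfPlane.coe_im]
  congr 2
  ring

/-- By `xi_thetaTilde` the image under ξ is a multiple of a holomorphic theta series, which the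
second ξ annihilates. -/
theorem laplacian_thetaTilde (hN : Even N) (h : Disc N) (τ : ℍ) :
    laplacian (1 / 2) (fun τ => thetaTilde N τ h) τ = 0 := by
  have hx : xi (1 / 2) (fun τ => thetaTilde N τ h) = fun τ =>
      ((1 / Real.sqrt 2 : ℝ) : ℂ) * unaryTheta N τ h := funext fun τ => xi_thetaTilde hN h τ
  have hd := differentiableOn_tsum_mul_e (fun n hn => le_sq_coset hn) (summable_unaryTheta h)
  rw [laplacian, hx, xi, dbar_of_differentiableOn (hd.const_mul ((1 / Real.sqrt 2 : ℝ) : ℂ))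
    fun τ => by rw [unaryTheta_eq]]
  simp

theorem isZeroAtImInfty_xi_thetaTilde (hN : Even N) (h : Disc N) :
    UpperHalfPlane.IsZeroAtImInfty (xi (1 / 2) fun τ => thetaTilde N τ h) := by
  have hx : xi (1 / 2) (fun τ => thetaTilde N τ h) = fun τ =>
      ((1 / Real.sqrt 2 : ℝ) : ℂ) * unaryTheta N τ h := funext fun τ => xi_thetaTilde hN h τ
  obtain ⟨C, hC⟩ := exists_norm_tsum_mul_e_le (fun n hn => le_sq_coset hn) (summable_unaryTheta h)
  rw [hx]
  have hN0 : (0 : ℝ) < N := by exact_mod_cast NeZero.pos N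
  have hlim : Filter.Tendsto (fun τ : ℍ => C * Real.exp (-2 * Real.pi * (1 / (2 * (N : ℝ) ^ 2)) * τ.im))
      UpperHalfPlane.atImInfty (nhds 0) := by
    rw [← mul_zero C]
    refine (Real.tendsto_exp_atBot.comp ?_).const_mul C
    refine Filter.Tendsto.const_mul_atTop_of_neg ?_ Filter.tendsto_comap
    have := Real.pi_pos
    have : 0 < Real.pi * (1 / (2 * (N : ℝ) ^ 2)) := by positivity
    linarith
  have hu : Filter.Tendsto (fun τ : ℍ => unaryTheta N τ h) UpperHalfPlane.atImInfty (nhds 0) := by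
    refine squeeze_zero_norm' ?_ hlim
    filter_upwards [Filter.preimage_mem_comap (Filter.Ici_mem_atTop (1 : ℝ))] with τ hτ
    rw [unaryTheta_eq]
    exact hC τ hτ
  have := hu.const_mul ((1 / Real.sqrt 2 : ℝ) : ℂ)
  rwa [mul_zero] at this

theorem thetaTilde_isBigO (hN : Even N) (h : Disc N) :
    (fun τ => thetaTilde N τ h) =O[UpperHalfPlane.atImInfty]
      fun τ => Real.exp (Real.pi / 4 * τ.im) := by
  obtain ⟨C, hC⟩ := exists_norm_thetaPlus_le hN h
  obtain ⟨B, hB⟩ := exists_norm_thetaStar_le h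
  refine Asymptotics.IsBigO.of_bound (C + |B|) ?_
  filter_upwards [Filter.preimage_mem_comap (Filter.Ici_mem_atTop (1 : ℝ))] with τ hτ
  rw [thetaTilde_eq hN, Real.norm_eq_abs, abs_of_pos (Real.exp_pos _), add_mul]
  refine (norm_sub_le _ _).trans (add_le_add (hC τ hτ) ?_)
  have h1 : 1 ≤ Real.exp (Real.pi / 4 * τ.im) :=
    Real.one_le_exp (mul_nonneg (by positivity) τ.im_pos.le)
  exact ((hB τ hτ).trans (le_abs_self B)).trans (le_mul_of_one_le_right (abs_nonneg B) h1)

theorem isHarmonicMaassForm_thetaTilde (hN : Even N) :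
    IsHarmonicMaassForm 1 (conjRep (weilRep N hN)) (thetaTilde N) where
  realAnalytic := isRealAnalytic_thetaTilde hN
  modular A τ := by rw [zpow_one]; exact thetaTilde_modular hN A τ
  harmonic h τ := by rw [Int.cast_one]; exact laplacian_thetaTilde hN h τ
  growth := ⟨Real.pi / 4, thetaTilde_isBigO hN⟩
  xi_cusp h := by rw [Int.cast_one]; exact isZeroAtImInfty_xi_thetaTilde hN h

/-- The coefficients of the terms of the non-holomorphic part. -/
noncomputable def starCoeff (h : Disc N) (n : ℤ) : ℂ := (Real.sign (cosetPoint N h n) : ℂ)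

/-- The exponents of the terms of the non-holomorphic part. -/
def starExponent (h : Disc N) (n : ℤ) : ℚ := cosetPoint N h n ^ 2 / 2

theorem starExponent_pos {N : ℕ} {h : Disc N} {n : ℤ} (hn : starCoeff h n ≠ 0) : 0 < starExponent h n := by
  have : cosetPoint N h n ≠ 0 := by
    intro h0
    simp [starCoeff, h0] at hn
  rw [starExponent]
  positivity

theorem exists_starExponent_eq (h : Disc N) (n : ℤ) :
    ∃ m : ℤ, starExponent h n = m / (8 * N ^ 2 : ℕ) := by
  have hN : (N : ℚ) ≠ 0 := Nat.cast_ne_zero.2 (NeZero.ne N)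
  refine ⟨4 * (N ^ 2 * n + h.val) ^ 2, ?_⟩
  rw [starExponent, cosetPoint]
  push_cast
  field_simp
  ring

/-- With exponent r²/2, `upperGamma_half` turns the incomplete Gamma value into √π·erfc; the factor
2√π absorbs this and the 1/2 in `gStar`. -/
theorem hasSum_starCoeff (h : Disc N) (τ : ℍ) :
    HasSum (fun n => starCoeff h n *
      ((upperGamma (1 - 1 / 2) (4 * Real.pi * starExponent h n * τ.im) : ℂ) *
        e (-starExponent h n * τ))) (2 * Real.sqrt Real.pi * thetaStar N τ h) := by
  have hs := (hasSum_gStar (isLatticeLike_coset N h) τ).summable.hasSum.mul_left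
    (2 * (Real.sqrt Real.pi : ℂ))
  refine hs.congr_fun fun n => ?_
  rw [← cast_cosetPoint, gStar, starCoeff]
  rcases eq_or_ne (cosetPoint N h n) 0 with h0 | h0
  · simp [h0]
  have hpos : (0 : ℝ) < (cosetPoint N h n : ℝ) ^ 2 := by
    have : (cosetPoint N h n : ℝ) ≠ 0 := by exact_mod_cast h0
    positivity
  have hv := τ.im_pos
  have h1 : 4 * Real.pi * (starExponent h n : ℝ) * τ.im =
      2 * Real.pi * τ.im * (cosetPoint N h n : ℝ) ^ 2 := by
    rw [starExponent]
    push_cast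
    ring
  have h2 : (0 : ℝ) < 2 * Real.pi * τ.im := by positivity
  rw [h1, upperGamma_half (mul_pos h2 hpos), Real.sqrt_mul h2.le, Real.sqrt_sq_eq_abs]
  have h3 : -(starExponent h n : ℂ) * (τ : ℂ) = -(((cosetPoint N h n : ℝ) : ℂ) ^ 2 / 2 * τ) := by
    rw [starExponent]
    push_cast
    ring
  rw [h3]
  push_cast
  ring

theorem hasHarmonicExpansion_thetaTilde (hN : Even N) {d : ℕ → ℤ}
    (hd : ∀ τ : ℍ, HasSum (fun k : ℕ => (d k : ℂ) * e (((k : ℂ) - 1 / 8) * τ)) (etaCubed τ)⁻¹) :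
    HasHarmonicExpansion (1 / 2) (thetaTilde N)
      (fun h => fibreSum (holoCoeff N d h) (holoExponent N h))
      fun h => fibreSum (starCoeff h) (starExponent h) := by
  have hA := fun (h : Disc N) (τ : ℍ) => hasSum_fibreSum (φ := fun n => e (n * τ)) (hasSum_holoCoeff hN hd h τ)
  have hB := fun (h : Disc N) (τ : ℍ) => hasSum_fibreSum (c := starCoeff h) (ν := starExponent h) (φ := fun n : ℚ =>
    (upperGamma (1 - 1 / 2) (4 * Real.pi * n * τ.im) : ℂ) * e (-n * τ)) (hasSum_starCoeff h τ)
  refine ⟨⟨8 * N ^ 2, by have := NeZero.pos N; positivity, ?_⟩, ⟨-1 / 8, ?_⟩, ?_, ?_, ?_, ?_⟩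
  · rintro h n (hn | hn)
    · obtain ⟨i, rfl, -⟩ := exists_of_fibreSum_ne_zero hn
      exact exists_holoExponent_eq h i
    · obtain ⟨i, rfl, -⟩ := exists_of_fibreSum_ne_zero hn
      exact exists_starExponent_eq h i
  · intro h n hn
    obtain ⟨i, rfl, hi⟩ := exists_of_fibreSum_ne_zero hn
    exact le_holoExponent hi
  · intro h n hn
    obtain ⟨i, rfl, hi⟩ := exists_of_fibreSum_ne_zero hn
    exact starExponent_pos hi
  · exact fun h τ => (hA h τ).summable
  · exact fun h τ => (hB h τ).summable.congr fun n => by ring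
  · intro h τ
    -- The prefactor (4π)^{-1/2} of the expansion is exactly the inverse of that factor 2√π.
    have hK : (((4 * Real.pi) ^ ((1 / 2 : ℝ) - 1) : ℝ) : ℂ) * (2 * Real.sqrt Real.pi) = 1 := by
      have h4 : Real.sqrt (4 * Real.pi) = 2 * Real.sqrt Real.pi := by
        rw [Real.sqrt_mul (by norm_num), show (4 : ℝ) = 2 ^ 2 by norm_num, Real.sqrt_sq zero_le_two]
      have : (4 * Real.pi) ^ ((1 / 2 : ℝ) - 1) * (2 * Real.sqrt Real.pi) = 1 := by
        rw [← h4, show (1 / 2 : ℝ) - 1 = -(1 / 2) by norm_num,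
          Real.rpow_neg (by positivity), ← Real.sqrt_eq_rpow]
        exact inv_mul_cancel₀ (Real.sqrt_pos.2 (by positivity)).ne'
      exact_mod_cast this
    simp only [mul_assoc (fibreSum _ _ _) _ (e _)]
    rw [(hA h τ).tsum_eq, (hB h τ).tsum_eq, ← mul_assoc, hK, one_mul, thetaTilde_eq hN]

end Coset

end WeilMaass

theorem theorem3 (N : ℕ) [NeZero N] (hN : Even N) :
    (∀ (τ : ℍ) (h : WeilMaass.Disc N),
      Summable fun n : ℤ => WeilMaass.g τ ((N : ℝ) * n + WeilMaass.rep N h)) ∧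
    (∀ (h : WeilMaass.Disc N) (τ : ℍ),
      WeilMaass.xi (1 / 2) (fun τ => WeilMaass.thetaTilde N τ h) τ =
        ((1 / Real.sqrt 2 : ℝ) : ℂ) * WeilMaass.unaryTheta N τ h) ∧
    WeilMaass.IsHarmonicMaassForm 1 (WeilMaass.conjRep (WeilMaass.weilRep N hN))
      (WeilMaass.thetaTilde N) ∧
    ∃ a b : WeilMaass.Disc N → ℚ → ℂ,
      WeilMaass.HasHarmonicExpansion (1 / 2) (WeilMaass.thetaTilde N) a b ∧
      ∀ h n, ∃ m : ℤ, a h n = m / (12 * N) := by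
  obtain ⟨d, hd⟩ := WeilMaass.exists_hasSum_inv_etaCubed
  have hN0 : (N : ℂ) ≠ 0 := Nat.cast_ne_zero.2 (NeZero.ne N)
  exact ⟨WeilMaass.summable_g hN, WeilMaass.xi_thetaTilde hN,
    WeilMaass.isHarmonicMaassForm_thetaTilde hN, _, _,
    WeilMaass.hasHarmonicExpansion_thetaTilde hN hd, fun h =>
      WeilMaass.exists_fibreSum_eq_div (mul_ne_zero (by norm_num) hN0)
        (WeilMaass.exists_mul_holoCoeff_eq hN d h)⟩
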